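/- **Setting.** Let $G$ be a finite group with $|G|\ge 2$ and let $\mathrm{scf}(G)=\mathbb{C}\text{-span}\{\mathbb 1,\mathbf{reg}\}$ be the space of functions constant on $G-\{1\}$. Put $\langle\psi,\gamma\rangle=\frac1{|G|}\sum_g\psi(g)\overline{\gamma(g)}$ and $(\mathbf{reg}-\mathbb 1)^*=\frac{\mathbf{reg}-\mathbb 1}{|G|-1}$. For $n\ge1$ let $\mathrm{scf}(G^{n-1})=\mathrm{scf}(G)^{\otimes(n-1)}$ be the space of functions on $G^{n-1}$ constant on products of the superclasses $\{1\}$, $G-\{1\}$, and let $\mathrm{scf}(G^{0-1})=\mathbb{C}\chi^\emptyset$. For a set composition $c$ of $\{1,\dots,n\}$ and $1\le j\le n-1$ put: $\mathrm{lc}(c)_j=1$ if $j$ is not the maximum of its block; $\mathrm{llc}(c)_j=1$ if $j+1$ lies in the block of $j$ or in a later one; $\mathrm{bc}(c)_j=1$ if $j+1$ lies in the block of $j$; and $0$ otherwise. Let $G^{n-1}_{a}=\{g\in G^{n-1}: g_j\ne1\Rightarrow a_j=1\}$ for $a\in\{0,1\}^{n-1}$. Define $\mathrm{Dn}_c[\tau,\alpha,\beta]:\mathrm{scf}(G^{n-1})\to\mathrm{scf}(G^{n-1}_{\mathrm{lc}(c)})$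 as follows: multiply by the function with factor $1$ in coordinate $j$ if $\mathrm{bc}(c)_j=1$, factor $\alpha$ if $\mathrm{bc}(c)_j<\mathrm{llc}(c)_j$, and factor $\beta$ if $\mathrm{llc}(c)_j=0$; deflate to $G^{n-1}_{\mathrm{bc}(c)}$ (average over the coordinates $j$ with $\mathrm{bc}(c)_j=0$); inflate to $G^{n-1}_{\mathrm{lc}(c)}$; multiply by $\tau$ in the coordinates with $\mathrm{bc}(c)_j<\mathrm{lc}(c)_j$. The Hopf algebra $\mathcal H=\mathcal H_{(\mathbf{reg},\mathbb 1,(\mathbf{reg}-\mathbb 1)^*)}=\bigoplus_{n\ge0}\mathrm{scf}(G^{n-1})$ has unit $\chi^\emptyset$ and counit the projection to degree $0$. Its product is $(\psi_1\otimes\cdots\otimes\psi_{m-1})\cdot(\gamma_1\otimes\cdots\otimes\gamma_{n-1})=\psi_1\otimes\cdots\otimes\psi_{m-1}\otimes\mathbf{reg}\otimes\gamma_1\otimes\cdots\otimes\gamma_{n-1}$ for $m,n\ge1$. Its coproduct on $\mathrm{scf}(G^{n-1})$ is $\sum_{A\subseteq\{1,\dots,n\}}\mathrm{Dn}_{(A,\overline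 A)}[\mathbf{reg},\mathbb 1,(\mathbf{reg}-\mathbb 1)^*]$, where $G^{n-1}_{\mathrm{lc}(A,\overline A)}$ is identified with $G^{|A|-1}\times G^{|\overline A|-1}$ by rearranging coordinates block by block, and the terms for $A=\emptyset$ and $\overline A=\emptyset$ are $\chi^\emptyset\otimes\psi$ and $\psi\otimes\chi^\emptyset$. Let $\mathbb F$ be a finite field with $q$ elements, and $\mathfrak{ut}_n$ the additive group of strictly upper triangular $n\times n$ matrices over $\mathbb F$. For $w\in S_n$ let $c_i(w)=\#\{h<w^{-1}(i)\mid w(h)>i\}$ and $$\mathfrak{ut}_w=\{u\in\mathfrak{ut}_n\mid u_{ij}=0\text{ if }j-i>c_i(w)\},\qquad \mathfrak{ut}_w^+=\{u\in\mathfrak{ut}_n\mid u_{ij}=0\text{ if }j-i-1>c_i(w)\}.$$ For $P\subseteq Q$ equal to $\mathfrak{ut}_w\subseteq\mathfrak{ut}_w^+$, let $\mathrm{Inf}[\mathbf{reg}-\mathbb 1]$ be inflation followed by multiplication by $\mathbf{reg}-\mathbb 1$ (for the group $\mathbb F^+$) in each matrix position of $Q$ not in $P$, and let $\chi^w=\mathrm{Ind}_{\mathfrak{ut}_w^+}^{\mathfrak{ut}_n}\big(\mathrm{Inf}[\mathbf{reg}-\mathbb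 1](\mathbb 1_{\mathfrak{ut}_w})\big)$. Let $\mathrm{scf}(\mathfrak{ut}_n)$ be the space of functions on $\mathfrak{ut}_n$ that are equal on any two elements lying in exactly the same subgroups $\mathfrak{ut}_w$, $w\in S_n$; the $\chi^w$ are its supercharacters. Let $\mathrm{MR}$ be the Malvenuto–Reutenauer Hopf algebra with fundamental basis $F_w$ ($w\in S_n$, $n\ge0$): for $u\in S_m$, $v\in S_n$, $F_uF_v$ is the sum of $F_w$ over the shuffles $w$ of the words $u$ and $v$ shifted by $m$; and $\Delta F_w=\sum_{k=0}^nF_{\mathrm{std}(w(1)\cdots w(k))}\otimes F_{\mathrm{std}(w(k+1)\cdots w(n))}$. The Hopf structure of $\mathrm{scf}(\mathfrak{ut}_\bullet)=\bigoplus_{n\ge0}\mathrm{scf}(\mathfrak{ut}_n)$ is the one transported from $\mathrm{MR}$ along $\mathrm{ch}:\chi^w\mapsto F_w$. For $w\in S_n$ and $\tilde w=(\{w(1)\},\dots,\{w(n)\})$ let $$\mathrm{twst}_w=\mathrm{Ind}_{\mathfrak{ut}_w^+}^{\mathfrak{ut}_n}\circ\mathrm{Inf}[\mathbf{reg}-\mathbb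 1]\circ\mathrm{Inf}_{\{1\}}^{\mathfrak{ut}_w}\circ\mathrm{Dn}_{\tilde w}[\mathbf{reg},\mathbb 1,(\mathbf{reg}-\mathbb 1)^*]:\mathrm{scf}(G^{n-1})\to\mathrm{scf}(\mathfrak{ut}_n),$$ and let $\mathrm{twst}$ be the linear map equal to $\sum_{w\in S_n}\mathrm{twst}_w$ in degree $n$. Let $\mathrm{NSym}$ be the Hopf algebra of noncommutative symmetric functions: the free algebra on $H_1,H_2,\dots$ with $\Delta H_n=\sum_{j=0}^nH_j\otimes H_{n-j}$, where $H_0=1$. Its ribbon basis $R_\mu$ is determined by $H_\mu=\sum_{\nu\text{ coarsens }\mu}R_\nu$. For a composition $\mu=(\mu_1,\dots,\mu_\ell)$ of $n$ let $(\mathbb 1)^{\mathbf{reg}-\mathbb 1}_\mu\in\mathrm{scf}(G^{n-1})$ have factor $\mathbf{reg}-\mathbb 1$ in the coordinates $\mu_1,\mu_1+\mu_2,\dots,n-\mu_\ell$ and factor $\mathbb 1$ in the others. **Proposition.** 1. $\mathcal H$ and $\mathrm{scf}(\mathfrak{ut}_\bullet)$ are Hopf algebras, and $\mathrm{twst}:\mathcal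 H\to\mathrm{scf}(\mathfrak{ut}_\bullet)$ is an injective Hopf algebra morphism. 2. $\mathrm{ch}:\mathrm{scf}(\mathfrak{ut}_\bullet)\to\mathrm{MR}$, $\chi^w\mapsto F_w$, is an isomorphism of Hopf algebras. 3. There is an isomorphism of Hopf algebras $\Phi:\mathrm{NSym}\to\mathcal H$ with $\Phi(R_\mu)=(\mathbb 1)^{\mathbf{reg}-\mathbb 1}_\mu$ for all $\mu$, and $\mathrm{ch}\circ\mathrm{twst}\circ\Phi:\mathrm{NSym}\to\mathrm{MR}$ is the standard embedding: an injective Hopf algebra morphism with $$R_\mu\longmapsto\sum_{w\in S_n,\ \mathrm{desc}(w^{-1})=\{\mu_1,\mu_1+\mu_2,\dots,n-\mu_\ell\}}F_w\qquad(\mu\vDash n),$$ where $\mathrm{desc}(v)=\{1\le i<n\mid v(i)>v(i+1)\}$. -/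

import Mathlib

open scoped TensorProduct DirectSum

noncomputable section

namespace TwstEmbedding

/-! ### Hopf algebras, given by their structure maps -/

/-- The structure maps of a (candidate) Hopf algebra over `ℂ`. -/
structure HopfData (V : Type*) [AddCommGroup V] [Module ℂ V] where
  mul : V →ₗ[ℂ] V →ₗ[ℂ] V
  one : V
  comul : V →ₗ[ℂ] V ⊗[ℂ] V
  counit : V →ₗ[ℂ] ℂ

section Hopf

variable {V : Type*} [AddCommGroup V] [Module ℂ V] {W : Type*} [AddCommGroup W] [Module ℂ W]

/-- The product of `V ⊗ V`: `(a ⊗ b) (c ⊗ d) = a c ⊗ b d`. -/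
def HopfData.mulTensor (D : HopfData V) : (V ⊗[ℂ] V) ⊗[ℂ] (V ⊗[ℂ] V) →ₗ[ℂ] V ⊗[ℂ] V :=
  TensorProduct.map (TensorProduct.lift D.mul) (TensorProduct.lift D.mul) ∘ₗ
    (TensorProduct.tensorTensorTensorComm ℂ V V V V).toLinearMap

/-- The Hopf algebra axioms: an associative unital algebra, a coassociative counital coalgebra,
compatibility of the two, and existence of an antipode. -/
structure HopfData.IsHopfAlgebra (D : HopfData V) : Prop where
  mul_assoc : ∀ x y z, D.mul (D.mul x y) z = D.mul x (D.mul y z)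
  one_mul : ∀ x, D.mul D.one x = x
  mul_one : ∀ x, D.mul x D.one = x
  coassoc : (TensorProduct.assoc ℂ V V V).toLinearMap ∘ₗ D.comul.rTensor V ∘ₗ D.comul =
    D.comul.lTensor V ∘ₗ D.comul
  rTensor_counit_comul : D.counit.rTensor V ∘ₗ D.comul = TensorProduct.mk ℂ ℂ V 1
  lTensor_counit_comul : D.counit.lTensor V ∘ₗ D.comul = (TensorProduct.mk ℂ V ℂ).flip 1
  counit_one : D.counit D.one = 1
  counit_mul : ∀ x y, D.counit (D.mul x y) = D.counit x * D.counit y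
  comul_one : D.comul D.one = D.one ⊗ₜ[ℂ] D.one
  comul_mul : ∀ x y, D.comul (D.mul x y) = D.mulTensor (D.comul x ⊗ₜ[ℂ] D.comul y)
  exists_antipode : ∃ S : V →ₗ[ℂ] V,
    TensorProduct.lift D.mul ∘ₗ S.rTensor V ∘ₗ D.comul = D.counit.smulRight D.one ∧
    TensorProduct.lift D.mul ∘ₗ S.lTensor V ∘ₗ D.comul = D.counit.smulRight D.one

/-- `f` is a morphism of Hopf algebras: source and target are Hopf algebras, and `f` respects
product, unit, coproduct and counit (such an `f` automatically commutes with the antipodes). -/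
structure IsHopfMorphism (D : HopfData V) (E : HopfData W) (f : V →ₗ[ℂ] W) : Prop where
  source : D.IsHopfAlgebra
  target : E.IsHopfAlgebra
  map_mul : ∀ x y, f (D.mul x y) = E.mul (f x) (f y)
  map_one : f D.one = E.one
  map_comul : ∀ x, E.comul (f x) = TensorProduct.map f f (D.comul x)
  map_counit : ∀ x, E.counit (f x) = D.counit x

end Hopf

/-! ### Superclass functions of `G` and of its powers

The supercharacter theory of `G` is the one with superclasses `{1}` and `G - {1}`. -/

/-- `scf(G)`: the functions on `G` that are constant on `G - {1}` (and on `{1}`). -/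
def scfOne (G : Type*) [Group G] : Submodule ℂ (G → ℂ) where
  carrier := {ψ | ∀ g h : G, g ≠ 1 → h ≠ 1 → ψ g = ψ h}
  add_mem' {a b} ha hb g h hg hh := by simp [ha g h hg hh, hb g h hg hh]
  zero_mem' g h _ _ := rfl
  smul_mem' r a ha g h hg hh := by simp [ha g h hg hh]

/-- The trivial character. -/
def trivialChar (G : Type*) [Group G] : scfOne G := ⟨fun _ => 1, fun _ _ _ _ => rfl⟩

open scoped Classical in
/-- The regular character. -/
def regChar (G : Type*) [Group G] : scfOne G :=
  ⟨fun g => if g = 1 then (Nat.card G : ℂ) else 0, fun g h hg hh => by simp [hg, hh]⟩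

/-- `(reg - 1)^*`, the element of `scf(G)` with `⟨1, ·⟩ = 0` and `⟨reg - 1, ·⟩ = 1`. -/
def regSubOneDual (G : Type*) [Group G] : scfOne G :=
  ((Nat.card G : ℂ) - 1)⁻¹ • (regChar G - trivialChar G)

/-- `scf(G^k)`: the functions on `G^k` that are constant on all products of `k` superclasses
of `G`. In degree `n` of the Hopf algebra sits `scf (G^(n-1))`; for `n = 0` and for `n = 1` this is
the line spanned by the constant function `1` on a one-point set. -/
def scf (G : Type*) [Group G] (k : ℕ) : Submodule ℂ ((Fin k → G) → ℂ) where
  carrier := {ψ | ∀ g h : Fin k → G, (∀ j, g j = 1 ↔ h j = 1) → ψ g = ψ h}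
  add_mem' {a b} ha hb g h hgh := by simp [ha g h hgh, hb g h hgh]
  zero_mem' g h _ := rfl
  smul_mem' r a ha g h hgh := by simp [ha g h hgh]

/-- The graded space `scf(G^•) = ⨁ₙ scf(G^(n-1))`. -/
abbrev ScfG (G : Type*) [Group G] : Type _ := ⨁ n : ℕ, scf G (n - 1)

theorem scfOne_apply_eq {G : Type*} [Group G] (ι : scfOne G) {g h : G} (H : g = 1 ↔ h = 1) :
    ι.1 g = ι.1 h := by
  by_cases hg : g = 1
  · rw [hg, H.1 hg]
  · exact ι.2 g h hg fun hh => hg (H.2 hh)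

/-! ### Set compositions and their binary sequences

A set composition of `{0, …, n-1}` is recorded by a map `c` giving the index of the block of each
element (only the order of the indices matters). The coordinates `1, …, n-1` of
`G^(n-1)` are indexed by `Fin (n-1)`; coordinate `j` lies between the elements `lo j` and `hi j`. -/

/-- The element `j` of `{0, …, n-1}` for a coordinate `j`. -/
def lo {n : ℕ} (j : Fin (n - 1)) : Fin n := ⟨j, by omega⟩

/-- The element `j + 1` of `{0, …, n-1}` for a coordinate `j`. -/
def hi {n : ℕ} (j : Fin (n - 1)) : Fin n := ⟨j + 1, by omega⟩

/-- `lc_j = 1`: `j` is not the maximum of its block. -/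
def lc {n : ℕ} (c : Fin n → ℕ) (j : Fin (n - 1)) : Prop := ∃ k : Fin n, lo j < k ∧ c k = c (lo j)

/-- `llc_j = 1`: `j + 1` is in the block of `j` or in a later one. -/
def llc {n : ℕ} (c : Fin n → ℕ) (j : Fin (n - 1)) : Prop := c (lo j) ≤ c (hi j)

/-- `bc_j = 1`: `j + 1` is in the block of `j`. -/
def bc {n : ℕ} (c : Fin n → ℕ) (j : Fin (n - 1)) : Prop := c (hi j) = c (lo j)

/-! ### The functors -/

section Functors

variable {G : Type*} [Group G]

/-- The subgroup `G^k_a` of `G^k`, for a binary sequence `a`. -/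
def coordSubgroup (G : Type*) [Group G] {k : ℕ} (a : Fin k → Prop) : Subgroup (Fin k → G) where
  carrier := {g | ∀ j, g j ≠ 1 → a j}
  one_mem' j h := absurd rfl h
  mul_mem' {x y} hx hy j h := by
    by_contra ha
    have h1 : x j = 1 := by_contra fun h' => ha (hx j h')
    have h2 : y j = 1 := by_contra fun h' => ha (hy j h')
    exact h (by simp [h1, h2])
  inv_mem' {x} hx j h := hx j (by simpa using h)

open scoped Classical in
/-- The projection of `G^k` onto `G^k_a`. -/
def coordProj {k : ℕ} (a : Fin k → Prop) (g : Fin k → G) : coordSubgroup G a :=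
  ⟨fun j => if a j then g j else 1, fun j h => by
    by_contra ha
    simp [ha] at h⟩

/-- Inflation from `G^k_a` to `G^k_b` (used for `a ≤ b`). -/
def inflation {k : ℕ} (a b : Fin k → Prop) :
    (coordSubgroup G a → ℂ) →ₗ[ℂ] (coordSubgroup G b → ℂ) :=
  LinearMap.funLeft ℂ ℂ fun g => coordProj a g.1

/-- Inflation from `G^k_a` to `G^k`. -/
def inflationTop {k : ℕ} (a : Fin k → Prop) :
    (coordSubgroup G a → ℂ) →ₗ[ℂ] ((Fin k → G) → ℂ) :=
  LinearMap.funLeft ℂ ℂ (coordProj a)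

open scoped Classical in
/-- Deflation from `G^k` to the quotient `G^k_a`: the average over the fibres of the projection. -/
def deflation [Fintype G] {k : ℕ} (a : Fin k → Prop) :
    ((Fin k → G) → ℂ) →ₗ[ℂ] (coordSubgroup G a → ℂ) :=
  LinearMap.pi fun x =>
    ((Finset.univ.filter fun h : Fin k → G => coordProj a h = x).card : ℂ)⁻¹ •
      ∑ h ∈ Finset.univ.filter (fun h : Fin k → G => coordProj a h = x), LinearMap.proj h

open scoped Classical in
/-- `Inf_A^B[ι]` for the one-block composition `B`: inflate, and insert `ι` in the new
coordinates. -/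
def infTop {n : ℕ} (c : Fin n → ℕ) (ι : scfOne G) :
    (coordSubgroup G (lc c) → ℂ) →ₗ[ℂ] ((Fin (n - 1) → G) → ℂ) :=
  LinearMap.mulLeft ℂ (fun g : Fin (n - 1) → G => ∏ j, if lc c j then 1 else ι.1 (g j)) ∘ₗ
    inflationTop (lc c)

open scoped Classical in
/-- `Dn_A^B[τ, α, β]` for the one-block composition `B`. -/
def dn [Fintype G] {n : ℕ} (c : Fin n → ℕ) (τ α β : scfOne G) :
    ((Fin (n - 1) → G) → ℂ) →ₗ[ℂ] (coordSubgroup G (lc c) → ℂ) :=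
  LinearMap.mulLeft ℂ
      (fun g : coordSubgroup G (lc c) => ∏ j, if lc c j ∧ ¬ bc c j then τ.1 (g.1 j) else 1) ∘ₗ
    inflation (bc c) (lc c) ∘ₗ
    deflation (bc c) ∘ₗ
    LinearMap.mulLeft ℂ (fun h : Fin (n - 1) → G =>
      ∏ j, if bc c j then 1 else if llc c j then α.1 (h j) else β.1 (h j))

end Functors

/-! ### The Hopf algebra `H_(ι, α, β)` -/

section HopfG

variable {G : Type*} [Group G]

/-- The set composition `({0, …, m-1}, {m, …, m+n-1})`. -/
def twoBlocks (m n : ℕ) (x : Fin (m + n)) : ℕ := if (x : ℕ) < m then 0 else 1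

/-- `γ ⊗ ψ` as a function on `G^(m-1) × G^(n-1)`, embedded as a subgroup of `G^(m+n-1)`. -/
def outer (m n : ℕ) (γ : (Fin (m - 1) → G) → ℂ) (ψ : (Fin (n - 1) → G) → ℂ) :
    coordSubgroup G (lc (twoBlocks m n)) → ℂ :=
  fun g => γ (fun i => g.1 ⟨i, by omega⟩) * ψ (fun i => g.1 ⟨m + i, by omega⟩)

theorem infTop_outer_mem (ι : scfOne G) (m n : ℕ) (γ : scf G (m - 1)) (ψ : scf G (n - 1)) :
    infTop (twoBlocks m n) ι (outer m n γ.1 ψ.1) ∈ scf G (m + n - 1) := by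
  classical
  intro g h hgh
  have key : ∀ j, ((coordProj (lc (twoBlocks m n)) g).1 j = 1 ↔
      (coordProj (lc (twoBlocks m n)) h).1 j = 1) := by
    intro j
    by_cases hj : lc (twoBlocks m n) j <;> simp [coordProj, hj, hgh j]
  simp only [infTop, inflationTop, outer, LinearMap.comp_apply, LinearMap.mulLeft_apply,
    Pi.mul_apply, LinearMap.funLeft_apply]
  congr 1
  · refine Finset.prod_congr rfl fun j _ => ?_
    split_ifs
    · rfl
    · exact scfOne_apply_eq ι (hgh j)
  · congr 1
    · exact γ.2 _ _ fun i => key _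
    · exact ψ.2 _ _ fun i => key _

set_option synthInstance.maxHeartbeats 200000 in
/-- The product `scf(G^(m-1)) ⊗ scf(G^(n-1)) → scf(G^(m+n-1))`, `γ ⊗ ψ ↦ Inf[ι](γ ⊗ ψ)`. (If `m`
or `n` is `0`, this is scalar multiplication.) -/
def mulDeg (ι : scfOne G) (m n : ℕ) :
    scf G (m - 1) →ₗ[ℂ] scf G (n - 1) →ₗ[ℂ] scf G (m + n - 1) :=
  LinearMap.mk₂ ℂ (fun γ ψ => ⟨_, infTop_outer_mem ι m n γ ψ⟩)
    (fun a b c => Subtype.ext (by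
      funext g; simp [infTop, inflationTop, outer, LinearMap.funLeft_apply]; ring))
    (fun r a c => Subtype.ext (by
      funext g; simp [infTop, inflationTop, outer, LinearMap.funLeft_apply]; ring))
    (fun a b c => Subtype.ext (by
      funext g; simp [infTop, inflationTop, outer, LinearMap.funLeft_apply]; ring))
    (fun r a c => Subtype.ext (by
      funext g; simp [infTop, inflationTop, outer, LinearMap.funLeft_apply]; ring))

open scoped Classical in
/-- The superclass identifier function of the superclass of `G^p` formed by the elements whose
nontrivial coordinates are exactly those in `S`. -/
def classIndicator (G : Type*) [Group G] {p : ℕ} (S : Finset (Fin p)) : scf G p :=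
  ⟨fun g => if ∀ j, g j ≠ 1 ↔ j ∈ S then 1 else 0, fun g h hgh => by simp [hgh]⟩

open scoped Classical in
/-- An element of that superclass. -/
def classRep (G : Type*) [Group G] [Nontrivial G] {p : ℕ} (S : Finset (Fin p)) : Fin p → G :=
  fun j => if j ∈ S then Classical.choose (exists_ne (1 : G)) else 1

/-- The identification of the superclass functions on `G^p × G^q` with
`scf(G^p) ⊗ scf(G^q)`: expand in superclass identifier functions. -/
def toTensor (G : Type*) [Group G] [Nontrivial G] (p q : ℕ) :
    ((Fin p → G) × (Fin q → G) → ℂ) →ₗ[ℂ] scf G p ⊗[ℂ] scf G q :=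
  ∑ S : Finset (Fin p), ∑ T : Finset (Fin q),
    (LinearMap.proj (classRep G S, classRep G T) :
      ((Fin p → G) × (Fin q → G) → ℂ) →ₗ[ℂ] ℂ).smulRight
      (classIndicator G S ⊗ₜ[ℂ] classIndicator G T)

/-- The set composition `(A, complement of A)`. -/
def splitBlocks {n : ℕ} (A : Finset (Fin n)) (x : Fin n) : ℕ := if x ∈ A then 0 else 1

/-- The number of elements of `A` smaller than `i`. -/
def rankIn {n : ℕ} (A : Finset (Fin n)) (i : Fin n) : ℕ := (A.filter fun a => a < i).card

theorem exists_gt_of_rankIn_lt {n : ℕ} {A : Finset (Fin n)} {i : Fin n} (hi : i ∈ A)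
    (h : rankIn A i < A.card - 1) : ∃ k ∈ A, i < k := by
  by_contra! H
  have : A.filter (fun a => a < i) = A.erase i := by
    ext a
    simp only [Finset.mem_filter, Finset.mem_erase]
    constructor
    · rintro ⟨h1, h2⟩
      exact ⟨h2.ne, h1⟩
    · rintro ⟨h1, h2⟩
      exact ⟨h2, lt_of_le_of_ne (H a h2) h1⟩
  rw [rankIn, this, Finset.card_erase_of_mem hi] at h
  exact lt_irrefl _ h

/-- The isomorphism `G^(|A|-1) × G^(n-|A|-1) → G^(n-1)_{lc(A, complement)}` that places the
coordinates of `x` at the nonmaximal elements of `A`, and those of `y` at the nonmaximal elements of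
the complement, in increasing order. -/
def shuffleCoords {n : ℕ} (A : Finset (Fin n)) (x : Fin (A.card - 1) → G)
    (y : Fin (n - A.card - 1) → G) : coordSubgroup G (lc (splitBlocks A)) :=
  ⟨fun j =>
    if lo j ∈ A then
      if h : rankIn A (lo j) < A.card - 1 then x ⟨rankIn A (lo j), h⟩ else 1
    else
      if h : rankIn Aᶜ (lo j) < n - A.card - 1 then y ⟨rankIn Aᶜ (lo j), h⟩ else 1, by
    intro j hj
    by_cases hA : lo j ∈ A
    · by_cases h : rankIn A (lo j) < A.card - 1
      · obtain ⟨k, hk, hlt⟩ := exists_gt_of_rankIn_lt hA h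
        exact ⟨k, hlt, by simp [splitBlocks, hk, hA]⟩
      · simp [hA, h] at hj
    · by_cases h : rankIn Aᶜ (lo j) < n - A.card - 1
      · have h' : rankIn Aᶜ (lo j) < Aᶜ.card - 1 := by
          rwa [Finset.card_compl, Fintype.card_fin]
        obtain ⟨k, hk, hlt⟩ := exists_gt_of_rankIn_lt (Finset.mem_compl.2 hA) h'
        exact ⟨k, hlt, by simp [splitBlocks, Finset.mem_compl.1 hk, hA]⟩
      · simp [hA, h] at hj⟩

/-- The coproduct on `scf(G^(n-1))`: the sum over all `A ⊆ {0, …, n-1}` of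
`Dn_(A, complement)[τ, α, β]`, read in `scf(G^(|A|-1)) ⊗ scf(G^(n-|A|-1))`. (For `A` empty or
everything this gives `1 ⊗ ψ` and `ψ ⊗ 1`.) -/
def comulDeg [Fintype G] [Nontrivial G] (τ α β : scfOne G) (n : ℕ) :
    scf G (n - 1) →ₗ[ℂ] ScfG G ⊗[ℂ] ScfG G :=
  ∑ A : Finset (Fin n),
    TensorProduct.map
        (DirectSum.lof ℂ ℕ (fun k => scf G (k - 1)) A.card)
        (DirectSum.lof ℂ ℕ (fun k => scf G (k - 1)) (n - A.card)) ∘ₗ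
      toTensor G (A.card - 1) (n - A.card - 1) ∘ₗ
      LinearMap.funLeft ℂ ℂ (fun p => shuffleCoords A p.1 p.2) ∘ₗ
      dn (splitBlocks A) τ α β ∘ₗ
      (scf G (n - 1)).subtype

/-- The Hopf algebra `H_(ι, α, β)`. The unit is the function `1` in degree `0`, and the counit is
the projection to degree `0`. -/
def hopfG [Fintype G] [Nontrivial G] (ι α β : scfOne G) : HopfData (ScfG G) where
  mul := DirectSum.toModule ℂ ℕ _ fun m => LinearMap.flip <|
    DirectSum.toModule ℂ ℕ _ fun n => LinearMap.flip <|
      (mulDeg ι m n).compr₂ (DirectSum.lof ℂ ℕ (fun k => scf G (k - 1)) (m + n))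
  one := DirectSum.lof ℂ ℕ (fun k => scf G (k - 1)) 0 ⟨fun _ => 1, fun _ _ _ => rfl⟩
  comul := DirectSum.toModule ℂ ℕ _ fun n => comulDeg ι α β n
  counit := LinearMap.proj (fun i : Fin 0 => i.elim0 : Fin 0 → G) ∘ₗ (scf G 0).subtype ∘ₗ
    DirectSum.component ℂ ℕ (fun k => scf G (k - 1)) 0

end HopfG

/-! ### The Malvenuto-Reutenauer Hopf algebra -/

/-- The underlying space, with basis `F_w`, `w ∈ S_n`, `n ≥ 0`. -/
abbrev MR : Type := (Σ n : ℕ, Equiv.Perm (Fin n)) →₀ ℂ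

/-- The fundamental basis element `F_w`. -/
def fund {n : ℕ} (w : Equiv.Perm (Fin n)) : MR := Finsupp.single ⟨n, w⟩ 1

/-- The word `w(1) … w(m+n)` is a shuffle of the word of `u` and of the word of `v` shifted
by `m`. -/
def IsShuffle {m n : ℕ} (u : Equiv.Perm (Fin m)) (v : Equiv.Perm (Fin n))
    (w : Equiv.Perm (Fin (m + n))) : Prop :=
  (∀ i j : Fin m, w.symm (Fin.castAdd n i) < w.symm (Fin.castAdd n j) ↔ u.symm i < u.symm j) ∧
  (∀ i j : Fin n, w.symm (Fin.natAdd m i) < w.symm (Fin.natAdd m j) ↔ v.symm i < v.symm j)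

/-- Standardization of a word with distinct letters: the permutation with the same relative order
(`Tuple.sort f` lists the positions of the letters in increasing order of the letters). -/
def std {k n : ℕ} (f : Fin k → Fin n) : Equiv.Perm (Fin k) := (Tuple.sort f).symm

open scoped Classical in
/-- `F_u F_v` is the sum of `F_w` over the shuffles `w` of `u` and shifted `v`, and
`Δ F_w = ∑ₖ F_{std(w(1) … w(k))} ⊗ F_{std(w(k+1) … w(n))}`. -/
def hopfMR : HopfData MR where
  mul := Finsupp.lift _ ℂ _ fun u => Finsupp.lift _ ℂ _ fun v =>
    ∑ w ∈ Finset.univ.filter (fun w => IsShuffle u.2 v.2 w), fund w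
  one := fund (1 : Equiv.Perm (Fin 0))
  comul := Finsupp.lift _ ℂ _ fun w => ∑ k : Fin (w.1 + 1),
    fund (std fun i : Fin k => w.2 ⟨i, by omega⟩) ⊗ₜ[ℂ]
      fund (std fun i : Fin (w.1 - k) => w.2 ⟨k + i, by omega⟩)
  counit := Finsupp.lift _ ℂ _ fun w => if w.1 = 0 then 1 else 0

/-! ### Superclass functions of the groups `ut_n` -/

section Ut

/-- The additive group of matrices supported in the positions `P`. -/
def pattern (F : Type*) [Field F] {n : ℕ} (P : Fin n → Fin n → Prop) :
    AddSubgroup (Matrix (Fin n) (Fin n) F) where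
  carrier := {u | ∀ i j, ¬ P i j → u i j = 0}
  zero_mem' _ _ _ := rfl
  add_mem' ha hb i j h := by simp [ha i j h, hb i j h]
  neg_mem' ha i j h := by simp [ha i j h]

/-- Positions strictly above the diagonal. -/
def utPos (n : ℕ) (i j : Fin n) : Prop := i < j

/-- `ut_n`, the strictly upper triangular matrices. -/
abbrev ut (F : Type*) [Field F] (n : ℕ) : AddSubgroup (Matrix (Fin n) (Fin n) F) :=
  pattern F (utPos n)

/-- The number of letters of the word `w(1) … w(n)` that are larger than the letter `i` and to the
left of it. -/
def code {n : ℕ} (w : Equiv.Perm (Fin n)) (i : Fin n) : ℕ :=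
  (Finset.univ.filter fun h : Fin n => h < w.symm i ∧ i < w h).card

/-- The positions of `ut_w`. -/
def utwPos {n : ℕ} (w : Equiv.Perm (Fin n)) (i j : Fin n) : Prop :=
  i < j ∧ (j : ℕ) - i ≤ code w i

/-- The positions of `ut_w^+`. -/
def utwPlusPos {n : ℕ} (w : Equiv.Perm (Fin n)) (i j : Fin n) : Prop :=
  i < j ∧ (j : ℕ) - i - 1 ≤ code w i

variable {F : Type*} [Field F]

/-- Two elements of `ut_n` are in the same superclass if they lie in the same subgroups `ut_w`;
since the codes of the `w ∈ S_n` are all sequences `(a_i)` with `a_i ≤ n - i`, this means that in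
each row they vanish beyond the same positions. -/
def SameSuperclass {n : ℕ} (u v : ut F n) : Prop :=
  ∀ i k : Fin n, (∀ j, k < j → u.1 i j = 0) ↔ (∀ j, k < j → v.1 i j = 0)

/-- `scf(ut_n)`: the functions constant on superclasses. -/
def scfUt (F : Type*) [Field F] (n : ℕ) : Submodule ℂ (ut F n → ℂ) where
  carrier := {ψ | ∀ u v, SameSuperclass u v → ψ u = ψ v}
  add_mem' {a b} ha hb u v h := by simp [ha u v h, hb u v h]
  zero_mem' _ _ _ := rfl
  smul_mem' r a ha u v h := by simp [ha u v h]

/-- The graded space `scf(ut_•)`. -/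
abbrev ScfUt (F : Type*) [Field F] : Type _ := ⨁ n : ℕ, scfUt F n

open scoped Classical in
/-- The character `reg - 1` of the additive group of `F`. -/
def regSubOneAdd (F : Type*) [Field F] (x : F) : ℂ := (if x = 0 then (Nat.card F : ℂ) else 0) - 1

open scoped Classical in
/-- The projection that erases the entries outside the positions `P`. -/
def patternProj {n : ℕ} (P : Fin n → Fin n → Prop) (u : Matrix (Fin n) (Fin n) F) :
    pattern F P :=
  ⟨fun i j => if P i j then u i j else 0, fun i j h => by simp [h]⟩

open scoped Classical in
/-- `Inf[ι]` from the positions `P` to the positions `Q ⊇ P`: inflate, and insert `ι` in each new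
position. -/
def patternInf {n : ℕ} (P Q : Fin n → Fin n → Prop) (ι : F → ℂ) :
    (pattern F P → ℂ) →ₗ[ℂ] (pattern F Q → ℂ) :=
  LinearMap.mulLeft ℂ
      (fun u : pattern F Q => ∏ i, ∏ j, if Q i j ∧ ¬ P i j then ι (u.1 i j) else 1) ∘ₗ
    LinearMap.funLeft ℂ ℂ fun u : pattern F Q => patternProj P u.1

open scoped Classical in
/-- Induction between abelian groups of matrices, from the positions `P` to the positions
`Q ⊇ P`. -/
def patternInd {n : ℕ} (P Q : Fin n → Fin n → Prop) :
    (pattern F P → ℂ) →ₗ[ℂ] (pattern F Q → ℂ) :=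
  LinearMap.pi fun u =>
    if h : u.1 ∈ pattern F P then
      ((Nat.card (pattern F Q) : ℂ) / (Nat.card (pattern F P) : ℂ)) • LinearMap.proj ⟨u.1, h⟩
    else 0

/-- `Ind_{ut_w^+}^{ut_n} ∘ Inf[reg - 1]_{ut_w}^{ut_w^+}`. -/
def indInf {n : ℕ} (w : Equiv.Perm (Fin n)) :
    (pattern F (utwPos w) → ℂ) →ₗ[ℂ] (ut F n → ℂ) :=
  patternInd (utwPlusPos w) (utPos n) ∘ₗ
    patternInf (utwPos w) (utwPlusPos w) (regSubOneAdd F)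

theorem indInf_const_mem {n : ℕ} (w : Equiv.Perm (Fin n)) (r : ℂ) :
    indInf (F := F) w (fun _ => r) ∈ scfUt F n := by
  classical
  intro u v huv
  have hrow : ∀ (i : Fin n) (m : ℕ), (∀ j : Fin n, m < j → u.1 i j = 0) ↔
      (∀ j : Fin n, m < j → v.1 i j = 0) := by
    intro i m
    by_cases hm : m < n
    · exact huv i ⟨m, hm⟩
    · exact ⟨fun _ j hj => by omega, fun _ j hj => by omega⟩
  have hmemiff : ∀ x : ut F n, x.1 ∈ pattern F (utwPlusPos w) ↔
      ∀ i j : Fin n, (i : ℕ) + code w i + 1 < j → x.1 i j = 0 := by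
    intro x
    constructor
    · intro hx i j hij
      exact hx i j fun h => by have := h.2; omega
    · intro hx i j hij
      by_cases hlt : i < j
      · refine hx i j ?_
        by_contra hcon
        exact hij ⟨hlt, by omega⟩
      · exact x.2 i j hlt
  have hmem : u.1 ∈ pattern F (utwPlusPos w) ↔ v.1 ∈ pattern F (utwPlusPos w) := by
    rw [hmemiff, hmemiff]
    exact forall_congr' fun i => hrow i _
  simp only [indInf, patternInd, LinearMap.comp_apply, LinearMap.pi_apply]
  by_cases hu : u.1 ∈ pattern F (utwPlusPos w)
  · have hv := hmem.1 hu
    simp only [dif_pos hu, dif_pos hv, LinearMap.smul_apply, LinearMap.proj_apply, patternInf,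
      LinearMap.comp_apply, LinearMap.mulLeft_apply, Pi.mul_apply, LinearMap.funLeft_apply]
    congr 2
    refine Finset.prod_congr rfl fun i _ => Finset.prod_congr rfl fun j _ => ?_
    split_ifs with hc
    · obtain ⟨⟨hij, h1⟩, h2⟩ := hc
      have hj : (j : ℕ) = i + code w i + 1 := by
        have : ¬ ((j : ℕ) - i ≤ code w i) := fun h => h2 ⟨hij, h⟩
        have h3 : (i : ℕ) < j := hij
        omega
      have aux : ∀ x : ut F n, x.1 ∈ pattern F (utwPlusPos w) →
          (x.1 i j = 0 ↔ ∀ k : Fin n, (i : ℕ) + code w i < k → x.1 i k = 0) := by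
        intro x hx
        constructor
        · intro h0 k hk
          by_cases hkj : k = j
          · rw [hkj]; exact h0
          · have : (k : ℕ) ≠ j := fun h => hkj (Fin.ext h)
            exact (hmemiff x).1 hx i k (by omega)
        · intro h
          exact h j (by omega)
      have : u.1 i j = 0 ↔ v.1 i j = 0 := by
        rw [aux u hu, aux v hv]
        exact hrow i _
      simp only [regSubOneAdd, this]
    · rfl
  · have hv : v.1 ∉ pattern F (utwPlusPos w) := fun h => hu (hmem.2 h)
    simp only [dif_neg hu, dif_neg hv, LinearMap.zero_apply]

/-- The supercharacter `χ^w` of `ut_n`. -/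
def superChar (F : Type*) [Field F] {n : ℕ} (w : Equiv.Perm (Fin n)) : scfUt F n :=
  ⟨indInf w fun _ => 1, indInf_const_mem w 1⟩

open scoped Classical in
/-- The inner product `⟨ψ, φ⟩` of functions on `ut_n`, as a linear form in `ψ`. -/
def utInner [Fintype F] {n : ℕ} (φ : ut F n → ℂ) : (ut F n → ℂ) →ₗ[ℂ] ℂ :=
  (Nat.card (ut F n) : ℂ)⁻¹ • ∑ u : ut F n, starRingEnd ℂ (φ u) • LinearMap.proj u

/-- The degree `n` part of `ch`: the expansion of a superclass function in the orthogonal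
supercharacters `χ^w`, with `F_w` in place of `χ^w`. -/
def chDeg (F : Type*) [Field F] [Fintype F] (n : ℕ) : scfUt F n →ₗ[ℂ] MR :=
  ∑ w : Equiv.Perm (Fin n),
    (((utInner (superChar F w).1 (superChar F w).1)⁻¹ • utInner (superChar F w).1) ∘ₗ
      (scfUt F n).subtype).smulRight (fund w)

/-- The linear map `ch : scf(ut_•) → MR` with `χ^w ↦ F_w`. -/
def ch (F : Type*) [Field F] [Fintype F] : ScfUt F →ₗ[ℂ] MR :=
  DirectSum.toModule ℂ ℕ _ (chDeg F)

/-- The linear map `MR → scf(ut_•)` with `F_w ↦ χ^w`. -/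
def chInv (F : Type*) [Field F] : MR →ₗ[ℂ] ScfUt F :=
  Finsupp.lift _ ℂ _ fun w => DirectSum.lof ℂ ℕ (fun n => scfUt F n) w.1 (superChar F w.2)

/-- The Hopf algebra `scf(ut_•)`: the supercharacters `χ^w` are multiplied and comultiplied as the
fundamental basis elements `F_w` of `MR`. -/
def hopfUt (F : Type*) [Field F] [Fintype F] : HopfData (ScfUt F) where
  mul := (hopfMR.mul.compl₁₂ (ch F) (ch F)).compr₂ (chInv F)
  one := chInv F hopfMR.one
  comul := TensorProduct.map (chInv F) (chInv F) ∘ₗ hopfMR.comul ∘ₗ ch F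
  counit := hopfMR.counit ∘ₗ ch F

end Ut

/-! ### The map `twst` -/

section Twst

variable (G : Type*) [Group G] [Fintype G] (F : Type*) [Field F]

/-- The set composition `({w(1)}, …, {w(n)})`. -/
def permBlocks {n : ℕ} (w : Equiv.Perm (Fin n)) (x : Fin n) : ℕ := w.symm x

/-- `Inf_{1}^{ut_w} ∘ Dn_w̃[reg, 1, (reg - 1)^*]`; here `Dn_w̃` takes values in the functions on a
trivial subgroup of `G^(n-1)`. -/
def infDn {n : ℕ} (w : Equiv.Perm (Fin n)) :
    scf G (n - 1) →ₗ[ℂ] (pattern F (utwPos w) → ℂ) :=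
  LinearMap.funLeft ℂ ℂ
      (fun _ : pattern F (utwPos w) => (1 : coordSubgroup G (lc (permBlocks w)))) ∘ₗ
    dn (permBlocks w) (regChar G) (trivialChar G) (regSubOneDual G) ∘ₗ
    (scf G (n - 1)).subtype

/-- `twst_w : scf(G^(n-1)) → scf(ut_n)`. -/
def twstPerm {n : ℕ} (w : Equiv.Perm (Fin n)) : scf G (n - 1) →ₗ[ℂ] scfUt F n :=
  LinearMap.codRestrict (scfUt F n) (indInf w ∘ₗ infDn G F w) fun _ => indInf_const_mem w _

/-- `twst = ∑_w twst_w` in degree `n`. -/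
def twstDeg (n : ℕ) : scf G (n - 1) →ₗ[ℂ] scfUt F n :=
  ∑ w : Equiv.Perm (Fin n), twstPerm G F w

/-- `twst : scf(G^•) → scf(ut_•)`. -/
def twst : ScfG G →ₗ[ℂ] ScfUt F :=
  DirectSum.toModule ℂ ℕ _ fun n => DirectSum.lof ℂ ℕ (fun n => scfUt F n) n ∘ₗ twstDeg G F n

end Twst

/-! ### Noncommutative symmetric functions -/

/-- `NSym` is the free algebra on `H_1, H_2, …`. -/
abbrev NSym : Type := FreeAlgebra ℂ ℕ+

/-- `H_n`, with `H_0 = 1`. -/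
def nsymGen (n : ℕ) : NSym := if h : 0 < n then FreeAlgebra.ι ℂ ⟨n, h⟩ else 1

/-- `H_μ = H_{μ_1} H_{μ_2} ⋯`. -/
def nsymH {n : ℕ} (μ : Composition n) : NSym := (μ.blocks.map nsymGen).prod

open scoped Classical in
/-- The ribbon basis, i.e. the solution of `H_μ = ∑ R_ν` (sum over the coarsenings `ν` of `μ`):
`R_μ = ∑ (-1)^(ℓ(μ) - ℓ(ν)) H_ν`. -/
def nsymR {n : ℕ} (μ : Composition n) : NSym :=
  ∑ ν ∈ Finset.univ.filter (fun ν : Composition n => ν.boundaries ⊆ μ.boundaries),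
    (-1 : ℂ) ^ (μ.length - ν.length) • nsymH ν

/-- The Hopf algebra `NSym`: `Δ` is the algebra morphism with `Δ H_n = ∑ H_j ⊗ H_{n-j}`. -/
def hopfNSym : HopfData NSym where
  mul := LinearMap.mul ℂ NSym
  one := 1
  comul := (FreeAlgebra.lift ℂ (fun n : ℕ+ =>
    ∑ j ∈ Finset.range (n + 1), nsymGen j ⊗ₜ[ℂ] nsymGen (n - j)) :
      NSym →ₐ[ℂ] NSym ⊗[ℂ] NSym).toLinearMap
  counit := (FreeAlgebra.lift ℂ (fun _ : ℕ+ => (0 : ℂ)) : NSym →ₐ[ℂ] ℂ).toLinearMap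

/-- `s ∈ {μ_1, μ_1 + μ_2, …, μ_1 + ⋯ + μ_{ℓ-1}}`. -/
def IsPartialSum {n : ℕ} (μ : Composition n) (s : ℕ) : Prop :=
  ∃ i, 0 < i ∧ i < μ.length ∧ μ.sizeUpTo i = s

open scoped Classical in
/-- `(1)^{reg - 1}_μ ∈ scf(G^(n-1))`: the tensor product with factor `reg - 1` in the coordinates
that are proper partial sums of `μ` (coordinates counted from `1`), and factor `1` elsewhere. -/
def ribbonG (G : Type*) [Group G] {n : ℕ} (μ : Composition n) : scf G (n - 1) :=
  ⟨fun g => ∏ j : Fin (n - 1),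
    if IsPartialSum μ (j + 1) then (regChar G - trivialChar G).1 (g j) else 1,
    fun _ _ hgh => Finset.prod_congr rfl fun j _ => by
      split_ifs
      · exact scfOne_apply_eq _ (hgh j)
      · rfl⟩

open scoped Classical in
/-- The image of `R_μ` under the standard embedding `NSym → MR`: the sum of `F_w` over the `w` such
that the descents of `w⁻¹` are the proper partial sums of `μ`. -/
def ribbonMR {n : ℕ} (μ : Composition n) : MR :=
  ∑ w ∈ Finset.univ.filter (fun w : Equiv.Perm (Fin n) =>
    ∀ j : Fin (n - 1), w.symm (hi j) < w.symm (lo j) ↔ IsPartialSum μ (j + 1)), fund w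

end TwstEmbedding

end

/-!
# The twisted embedding of superclass functions into the Malvenuto-Reutenauer algebra

Write `H` for the Hopf algebra `H_(reg, 1, (reg - 1)^*)` and `Ψ` for the composite of `ch` and
`twst`, from `H` to `MR`. Everything is computed on two families of pure tensors in `scf(G^(n-1))`:
those with factors `reg` and `1` (`regTensor`), and those with factors `reg - 1` and `1`
(`ribbonTensor`). In each coordinate `Dn` pairs a factor with `1` or with `(reg - 1)^*`, and these
pairings only take the values `0` and `1`. Hence `Ψ` sends the `regTensor` with factor `reg` in the
coordinates `T` to the sum of the `F_w` such that all descents of `w⁻¹` lie in `T`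
(`ch_twst_regTensorAt`), and the corresponding `ribbonTensor` to the sum of the `F_w` such that the
set of descents of `w⁻¹` is exactly `T` (`ch_twst_ribbonTensor`). The latter sums are nonempty and
disjoint, so `Ψ` is injective (`ch_twst_injective`).

*The map `ch`.* The `χ^w` are orthogonal, because permutations with the same code are equal, and the
superclasses of `ut_n` number at most `n!`; so the `χ^w` form a basis of `scf(ut_n)`, and `ch` is
bijective (`ch_chInv`, `chInv_ch`). As the structure of `scf(ut_•)` is transported from `MR`, what
remains to be seen is that `MR` is a Hopf algebra. Its bialgebra axioms are those of the shuffle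
algebra on words, where they follow from recursions in the first letters, transferred along
standardization (`hopfMR_isBialgebra`); the antipode is the geometric series that exists in each
connected graded bialgebra (`isHopfAlgebra_of_graded`).

*The Hopf algebra `H`.* Its product concatenates `regTensor`s, with a new factor `reg` in between,
and its coproduct splits them along subsets (`hopfG_mul_regTensorAt`, `hopfG_comul_regTensorAt`).
From these formulas the coproduct is multiplicative (`hopfG_comul_mul`), the constant functions `1`
satisfy the coproduct formula of the generators `H_n` of `NSym` (`hopfG_comul_trivial`), and `Ψ` is
multiplicative (`ch_twst_mul`). So there is an algebra morphism `NSym → H` sending `H_n` to the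
constant function `1` of degree `n`. It sends `H_μ` to the `regTensor` of the partial sums of `μ`,
hence is bijective and sends `R_μ` to the `ribbonTensor` of the partial sums, by inclusion and
exclusion. Compatibility with the coproduct needs to be checked on the generators `H_n` only, both
for `NSym → H` and for its composite with `Ψ`; as `NSym → H` is surjective, `Ψ` respects the
coproduct as well (`ch_twst_respects`). Coassociativity and the other axioms of `H` that are left
then come from `MR` through the injection `Ψ`, and `NSym` is a Hopf algebra by transport from `H`.
-/

open scoped TensorProduct DirectSum

noncomputable section

namespace TwstEmbedding

/-! ### Maps between Hopf algebras, and antipodes of connected graded bialgebras -/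

section General

variable {V : Type*} [AddCommGroup V] [Module ℂ V] {W : Type*} [AddCommGroup W] [Module ℂ W]

theorem HopfData.mulTensor_tmul (D : HopfData V) (a b c d : V) :
    D.mulTensor ((a ⊗ₜ[ℂ] b) ⊗ₜ[ℂ] (c ⊗ₜ[ℂ] d)) = D.mul a c ⊗ₜ[ℂ] D.mul b d := by
  simp [HopfData.mulTensor]

/-- The bialgebra axioms, i.e. all Hopf algebra axioms except the existence of an antipode. -/
structure HopfData.IsBialgebra (D : HopfData V) : Prop where
  mul_assoc : ∀ x y z, D.mul (D.mul x y) z = D.mul x (D.mul y z)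
  one_mul : ∀ x, D.mul D.one x = x
  mul_one : ∀ x, D.mul x D.one = x
  coassoc : (TensorProduct.assoc ℂ V V V).toLinearMap ∘ₗ D.comul.rTensor V ∘ₗ D.comul =
    D.comul.lTensor V ∘ₗ D.comul
  rTensor_counit_comul : D.counit.rTensor V ∘ₗ D.comul = TensorProduct.mk ℂ ℂ V 1
  lTensor_counit_comul : D.counit.lTensor V ∘ₗ D.comul = (TensorProduct.mk ℂ V ℂ).flip 1
  counit_one : D.counit D.one = 1
  counit_mul : ∀ x y, D.counit (D.mul x y) = D.counit x * D.counit y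
  comul_one : D.comul D.one = D.one ⊗ₜ[ℂ] D.one
  comul_mul : ∀ x y, D.comul (D.mul x y) = D.mulTensor (D.comul x ⊗ₜ[ℂ] D.comul y)

theorem HopfData.IsHopfAlgebra.isBialgebra {D : HopfData V} (h : D.IsHopfAlgebra) :
    D.IsBialgebra where
  mul_assoc := h.mul_assoc
  one_mul := h.one_mul
  mul_one := h.mul_one
  coassoc := h.coassoc
  rTensor_counit_comul := h.rTensor_counit_comul
  lTensor_counit_comul := h.lTensor_counit_comul
  counit_one := h.counit_one
  counit_mul := h.counit_mul
  comul_one := h.comul_one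
  comul_mul := h.comul_mul

/-- `f` respects product, unit, coproduct and counit, with no axioms asked of source and target. -/
structure HopfData.Respects (D : HopfData V) (E : HopfData W) (f : V →ₗ[ℂ] W) : Prop where
  map_mul : ∀ x y, f (D.mul x y) = E.mul (f x) (f y)
  map_one : f D.one = E.one
  map_comul : ∀ x, E.comul (f x) = TensorProduct.map f f (D.comul x)
  map_counit : ∀ x, E.counit (f x) = D.counit x

theorem HopfData.Respects.isHopfMorphism {D : HopfData V} {E : HopfData W} {f : V →ₗ[ℂ] W}
    (h : D.Respects E f) (hD : D.IsHopfAlgebra) (hE : E.IsHopfAlgebra) : IsHopfMorphism D E f :=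
  ⟨hD, hE, h.map_mul, h.map_one, h.map_comul, h.map_counit⟩

theorem HopfData.Respects.comp {U : Type*} [AddCommGroup U] [Module ℂ U] {C : HopfData U}
    {D : HopfData V} {E : HopfData W} {f : V →ₗ[ℂ] W} {g : U →ₗ[ℂ] V}
    (hf : D.Respects E f) (hg : C.Respects D g) : C.Respects E (f ∘ₗ g) where
  map_mul x y := by simp [hg.map_mul, hf.map_mul]
  map_one := by simp [hg.map_one, hf.map_one]
  map_comul x := by simp [hf.map_comul, hg.map_comul, TensorProduct.map_comp]
  map_counit x := by simp [hf.map_counit, hg.map_counit]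

/-- Cancellation: if `f` is injective and both `f` and `f ∘ g` respect the structure, so does
`g`. -/
theorem HopfData.Respects.of_comp {U : Type*} [AddCommGroup U] [Module ℂ U] {C : HopfData U}
    {D : HopfData V} {E : HopfData W} {f : V →ₗ[ℂ] W} {g : U →ₗ[ℂ] V}
    (hf : D.Respects E f) (hinj : Function.Injective f) (hfg : C.Respects E (f ∘ₗ g)) :
    C.Respects D g where
  map_mul x y := hinj (by simpa [hf.map_mul] using hfg.map_mul x y)
  map_one := hinj (by simpa [hf.map_one] using hfg.map_one)
  map_comul x := by
    have hff : Function.Injective (TensorProduct.map f f) := by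
      rw [← LinearMap.lTensor_comp_rTensor]
      exact (Module.Flat.lTensor_preserves_injective_linearMap f hinj).comp
        (Module.Flat.rTensor_preserves_injective_linearMap f hinj)
    refine hff ?_
    have h := hfg.map_comul x
    rw [LinearMap.comp_apply, hf.map_comul] at h
    rw [h, TensorProduct.map_comp, LinearMap.comp_apply]
  map_counit x := by
    rw [← hfg.map_counit, LinearMap.comp_apply, hf.map_counit]

theorem map_mulTensor {D : HopfData V} {E : HopfData W} {f : V →ₗ[ℂ] W}
    (hmul : ∀ x y, f (D.mul x y) = E.mul (f x) (f y)) (s t : V ⊗[ℂ] V) :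
    TensorProduct.map f f (D.mulTensor (s ⊗ₜ[ℂ] t)) =
      E.mulTensor (TensorProduct.map f f s ⊗ₜ[ℂ] TensorProduct.map f f t) := by
  induction s with
  | zero => simp
  | add a b ha hb => simp only [TensorProduct.add_tmul, map_add, ha, hb]
  | tmul a b =>
    induction t with
    | zero => simp
    | add c d hc hd => simp only [TensorProduct.tmul_add, map_add, hc, hd]
    | tmul c d => simp [HopfData.mulTensor_tmul, hmul]

/-- The bialgebra axioms descend along an injective map that respects the structure. -/
theorem HopfData.Respects.isBialgebra {D : HopfData V} {E : HopfData W} {f : V →ₗ[ℂ] W}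
    (h : D.Respects E f) (hinj : Function.Injective f) (hE : E.IsBialgebra) : D.IsBialgebra := by
  have hff : Function.Injective (TensorProduct.map f f) := by
    rw [← LinearMap.lTensor_comp_rTensor]
    exact (Module.Flat.lTensor_preserves_injective_linearMap f hinj).comp
      (Module.Flat.rTensor_preserves_injective_linearMap f hinj)
  have hfff : Function.Injective (TensorProduct.map f (TensorProduct.map f f)) := by
    rw [← LinearMap.lTensor_comp_rTensor]
    exact (Module.Flat.lTensor_preserves_injective_linearMap _ hff).comp
      (Module.Flat.rTensor_preserves_injective_linearMap f hinj)
  have hΔ : E.comul ∘ₗ f = TensorProduct.map f f ∘ₗ D.comul := LinearMap.ext h.map_comul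
  have hε : E.counit ∘ₗ f = D.counit := LinearMap.ext h.map_counit
  refine ⟨fun x y z => hinj ?_, fun x => hinj ?_, fun x => hinj ?_, ?_, ?_, ?_, ?_, ?_, ?_, ?_⟩
  · simp only [h.map_mul, hE.mul_assoc]
  · simp only [h.map_mul, h.map_one, hE.one_mul]
  · simp only [h.map_mul, h.map_one, hE.mul_one]
  · ext x
    refine hfff ?_
    have key := LinearMap.congr_fun hE.coassoc (f x)
    simp only [LinearMap.comp_apply, LinearEquiv.coe_coe] at key ⊢
    rw [h.map_comul] at key
    have e1 : ∀ t : V ⊗[ℂ] V, E.comul.lTensor W (TensorProduct.map f f t) =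
        TensorProduct.map f (TensorProduct.map f f) (D.comul.lTensor V t) := fun t => by
      induction t with
      | zero => simp
      | add a b ha hb => simp only [map_add, ha, hb]
      | tmul a b => simp [h.map_comul]
    have e2 : ∀ t : V ⊗[ℂ] V, TensorProduct.assoc ℂ W W W
          (E.comul.rTensor W (TensorProduct.map f f t)) =
        TensorProduct.map f (TensorProduct.map f f)
          (TensorProduct.assoc ℂ V V V (D.comul.rTensor V t)) := fun t => by
      induction t with
      | zero => simp
      | add a b ha hb => simp only [map_add, ha, hb]
      | tmul a b =>
        simp only [TensorProduct.map_tmul, LinearMap.rTensor_tmul, h.map_comul]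
        generalize D.comul a = s
        induction s with
        | zero => simp
        | add a b ha hb => simp only [TensorProduct.add_tmul, map_add, ha, hb]
        | tmul c d => simp
    rw [e1, e2] at key
    exact key
  · ext x
    refine Module.Flat.lTensor_preserves_injective_linearMap (M := ℂ) f hinj ?_
    have key := LinearMap.congr_fun hE.rTensor_counit_comul (f x)
    simp only [LinearMap.comp_apply] at key ⊢
    rw [h.map_comul, ← LinearMap.comp_apply, LinearMap.rTensor_comp_map, hε] at key
    rw [← LinearMap.comp_apply, LinearMap.lTensor_comp_rTensor, key]
    simp
  · ext x
    refine Module.Flat.rTensor_preserves_injective_linearMap (M := ℂ) f hinj ?_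
    have key := LinearMap.congr_fun hE.lTensor_counit_comul (f x)
    simp only [LinearMap.comp_apply] at key ⊢
    rw [h.map_comul, ← LinearMap.comp_apply, LinearMap.lTensor_comp_map, hε] at key
    rw [← LinearMap.comp_apply, LinearMap.rTensor_comp_lTensor, key]
    simp
  · rw [← h.map_counit, h.map_one, hE.counit_one]
  · intro x y
    simp only [← h.map_counit, h.map_mul, hE.counit_mul]
  · refine hff ?_
    rw [← h.map_comul, h.map_one, hE.comul_one, TensorProduct.map_tmul, h.map_one]
  · intro x y
    refine hff ?_
    rw [← h.map_comul, h.map_mul, hE.comul_mul, map_mulTensor h.map_mul, h.map_comul, h.map_comul]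

theorem HopfData.IsBialgebra.isHopfAlgebra {D : HopfData V} (h : D.IsBialgebra)
    (hS : ∃ S : V →ₗ[ℂ] V,
      TensorProduct.lift D.mul ∘ₗ S.rTensor V ∘ₗ D.comul = D.counit.smulRight D.one ∧
      TensorProduct.lift D.mul ∘ₗ S.lTensor V ∘ₗ D.comul = D.counit.smulRight D.one) :
    D.IsHopfAlgebra :=
  ⟨h.mul_assoc, h.one_mul, h.mul_one, h.coassoc, h.rTensor_counit_comul, h.lTensor_counit_comul,
    h.counit_one, h.counit_mul, h.comul_one, h.comul_mul, hS⟩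

/-- The Hopf algebra axioms transfer along a linear equivalence that respects the structure. -/
theorem HopfData.Respects.isHopfAlgebra {D : HopfData V} {E : HopfData W} (e : V ≃ₗ[ℂ] W)
    (h : D.Respects E e.toLinearMap) (hE : E.IsHopfAlgebra) : D.IsHopfAlgebra := by
  refine (h.isBialgebra e.injective hE.isBialgebra).isHopfAlgebra ?_
  obtain ⟨S, hS1, hS2⟩ := hE.exists_antipode
  refine ⟨e.symm.toLinearMap ∘ₗ S ∘ₗ e.toLinearMap, ?_, ?_⟩
  · ext x
    apply e.injective
    have key := LinearMap.congr_fun hS1 (e x)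
    have hc := h.map_comul x
    have h1 := h.map_one
    have hmul := h.map_mul
    have hε := h.map_counit x
    simp only [LinearEquiv.coe_coe] at hc h1 hε hmul
    simp only [LinearMap.comp_apply, LinearMap.smulRight_apply, hc, hε] at key
    simp only [LinearMap.comp_apply, LinearMap.smulRight_apply, map_smul, h1, ← key]
    generalize D.comul x = t
    induction t with
    | zero => simp
    | add a b ha hb => simp only [map_add, ha, hb]
    | tmul a b => simp [hmul]
  · ext x
    apply e.injective
    have key := LinearMap.congr_fun hS2 (e x)
    have hc := h.map_comul x
    have h1 := h.map_one
    have hmul := h.map_mul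
    have hε := h.map_counit x
    simp only [LinearEquiv.coe_coe] at hc h1 hε hmul
    simp only [LinearMap.comp_apply, LinearMap.smulRight_apply, hc, hε] at key
    simp only [LinearMap.comp_apply, LinearMap.smulRight_apply, map_smul, h1, ← key]
    generalize D.comul x = t
    induction t with
    | zero => simp
    | add a b ha hb => simp only [map_add, ha, hb]
    | tmul a b => simp [hmul]

/-- The convolution product `μ ∘ (f ⊗ g) ∘ Δ` of two linear endomorphisms. -/
def HopfData.conv (D : HopfData V) (f g : V →ₗ[ℂ] V) : V →ₗ[ℂ] V :=
  TensorProduct.lift D.mul ∘ₗ TensorProduct.map f g ∘ₗ D.comul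

/-- The unit `x ↦ ε(x) 1` of the convolution product. -/
def HopfData.convOne (D : HopfData V) : V →ₗ[ℂ] V := D.counit.smulRight D.one

theorem HopfData.conv_add (D : HopfData V) (f g k : V →ₗ[ℂ] V) :
    D.conv f (g + k) = D.conv f g + D.conv f k := by
  ext x; simp [conv, TensorProduct.map_add_right]

theorem HopfData.add_conv (D : HopfData V) (f g k : V →ₗ[ℂ] V) :
    D.conv (f + g) k = D.conv f k + D.conv g k := by
  ext x; simp [conv, TensorProduct.map_add_left]

theorem HopfData.smul_conv (D : HopfData V) (r : ℂ) (f g : V →ₗ[ℂ] V) :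
    D.conv (r • f) g = r • D.conv f g := by
  ext x; simp [conv, TensorProduct.map_smul_left]

theorem HopfData.conv_smul (D : HopfData V) (r : ℂ) (f g : V →ₗ[ℂ] V) :
    D.conv f (r • g) = r • D.conv f g := by
  ext x; simp [conv, TensorProduct.map_smul_right]

variable {D : HopfData V}

theorem HopfData.IsBialgebra.conv_assoc (h : D.IsBialgebra) (f g k : V →ₗ[ℂ] V) :
    D.conv (D.conv f g) k = D.conv f (D.conv g k) := by
  have e1 : ∀ t : V ⊗[ℂ] V,
      TensorProduct.lift D.mul (TensorProduct.map (D.conv f g) k t) =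
      TensorProduct.lift D.mul (TensorProduct.map f
        (TensorProduct.lift D.mul ∘ₗ TensorProduct.map g k)
        (TensorProduct.assoc ℂ V V V (D.comul.rTensor V t))) := fun t => by
    induction t with
    | zero => simp
    | add a b ha hb => simp only [map_add, ha, hb]
    | tmul a b =>
      simp only [TensorProduct.map_tmul, conv, LinearMap.comp_apply, LinearMap.rTensor_tmul]
      generalize D.comul a = s
      induction s with
      | zero => simp
      | add c d hc hd =>
        simp only [TensorProduct.add_tmul, map_add, hc, hd]
      | tmul c d => simp [h.mul_assoc]
  have e2 : ∀ t : V ⊗[ℂ] V,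
      TensorProduct.lift D.mul (TensorProduct.map f (D.conv g k) t) =
      TensorProduct.lift D.mul (TensorProduct.map f
        (TensorProduct.lift D.mul ∘ₗ TensorProduct.map g k) (D.comul.lTensor V t)) := fun t => by
    induction t with
    | zero => simp
    | add a b ha hb => simp only [map_add, ha, hb]
    | tmul a b => simp [conv]
  ext x
  have hc := LinearMap.congr_fun h.coassoc x
  simp only [LinearMap.comp_apply, LinearEquiv.coe_coe] at hc
  change TensorProduct.lift D.mul (TensorProduct.map (D.conv f g) k (D.comul x)) =
    TensorProduct.lift D.mul (TensorProduct.map f (D.conv g k) (D.comul x))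
  rw [e1, e2, hc]

theorem HopfData.IsBialgebra.conv_convOne (h : D.IsBialgebra) (f : V →ₗ[ℂ] V) :
    D.conv f D.convOne = f := by
  ext x
  have hc := LinearMap.congr_fun h.lTensor_counit_comul x
  have e : ∀ t : V ⊗[ℂ] V, TensorProduct.lift D.mul (TensorProduct.map f D.convOne t) =
      f (TensorProduct.rid ℂ V (D.counit.lTensor V t)) := fun t => by
    induction t with
    | zero => simp
    | add a b ha hb => simp only [map_add, ha, hb]
    | tmul a b => simp [convOne, h.mul_one]
  change TensorProduct.lift D.mul (TensorProduct.map f D.convOne (D.comul x)) = f x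
  simp only [LinearMap.comp_apply] at hc
  rw [e, hc]
  simp

theorem HopfData.IsBialgebra.convOne_conv (h : D.IsBialgebra) (f : V →ₗ[ℂ] V) :
    D.conv D.convOne f = f := by
  ext x
  have hc := LinearMap.congr_fun h.rTensor_counit_comul x
  have e : ∀ t : V ⊗[ℂ] V, TensorProduct.lift D.mul (TensorProduct.map D.convOne f t) =
      f (TensorProduct.lid ℂ V (D.counit.rTensor V t)) := fun t => by
    induction t with
    | zero => simp
    | add a b ha hb => simp only [map_add, ha, hb]
    | tmul a b => simp [convOne, h.one_mul]
  change TensorProduct.lift D.mul (TensorProduct.map D.convOne f (D.comul x)) = f x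
  simp only [LinearMap.comp_apply] at hc
  rw [e, hc]
  simp

/-- The convolution powers of `id - ε(·) 1`. -/
def HopfData.convPow (D : HopfData V) : ℕ → V →ₗ[ℂ] V
  | 0 => D.convOne
  | k + 1 => D.conv (D.convPow k) (LinearMap.id - D.convOne)

theorem HopfData.IsBialgebra.conv_convPow (h : D.IsBialgebra) (k : ℕ) :
    D.conv (LinearMap.id - D.convOne) (D.convPow k) = D.convPow (k + 1) := by
  induction k with
  | zero => rw [convPow, convPow, convPow, h.conv_convOne, h.convOne_conv]
  | succ k ih => rw [convPow, ← h.conv_assoc, ih]; rfl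

/-- The truncated geometric series `∑_{k < N} (-1)^k (id - ε(·) 1)^{*k}`. -/
def HopfData.convGeom (D : HopfData V) (N : ℕ) : V →ₗ[ℂ] V :=
  ∑ k ∈ Finset.range N, (-1 : ℂ) ^ k • D.convPow k

theorem HopfData.IsBialgebra.convGeom_conv_id (h : D.IsBialgebra) (N : ℕ) :
    D.conv (D.convGeom N) LinearMap.id = D.convOne - (-1 : ℂ) ^ N • D.convPow N := by
  have hid : (LinearMap.id : V →ₗ[ℂ] V) = D.convOne + (LinearMap.id - D.convOne) := by simp
  induction N with
  | zero => ext x; simp [convGeom, conv, convPow]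
  | succ N ih =>
    have : D.convGeom (N + 1) = D.convGeom N + (-1 : ℂ) ^ N • D.convPow N := by
      rw [convGeom, Finset.sum_range_succ, convGeom]
    rw [this, D.add_conv, ih, D.smul_conv]
    rw [hid]
    have hsucc : D.conv (D.convPow N) (LinearMap.id - D.convOne) = D.convPow (N + 1) := rfl
    rw [D.conv_add, h.conv_convOne, hsucc, pow_succ, smul_add]
    module

theorem HopfData.IsBialgebra.id_conv_convGeom (h : D.IsBialgebra) (N : ℕ) :
    D.conv LinearMap.id (D.convGeom N) = D.convOne - (-1 : ℂ) ^ N • D.convPow N := by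
  have hid : (LinearMap.id : V →ₗ[ℂ] V) = D.convOne + (LinearMap.id - D.convOne) := by simp
  induction N with
  | zero => ext x; simp [convGeom, conv, convPow]
  | succ N ih =>
    have : D.convGeom (N + 1) = D.convGeom N + (-1 : ℂ) ^ N • D.convPow N := by
      rw [convGeom, Finset.sum_range_succ, convGeom]
    rw [this, D.conv_add, ih, D.conv_smul]
    rw [hid]
    rw [D.add_conv, h.convOne_conv, h.conv_convPow, pow_succ, smul_add]
    module

/-- A connected graded bialgebra has an antipode, namely the geometric series
`∑_k (-1)^k (id - ε(·) 1)^{*k}`, which is finite on each element. The set `𝒢 n` is thought of as a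
spanning set of the degree `n` part. -/
theorem HopfData.IsBialgebra.isHopfAlgebra_of_graded (h : D.IsBialgebra) (𝒢 : ℕ → Set V)
    (hspan : Submodule.span ℂ (⋃ n, 𝒢 n) = ⊤) (h0 : 𝒢 0 ⊆ Submodule.span ℂ {D.one})
    (hΔ : ∀ n, ∀ x ∈ 𝒢 n, D.comul x ∈ Submodule.span ℂ
      {t | ∃ i j a b, i + j = n ∧ a ∈ 𝒢 i ∧ b ∈ 𝒢 j ∧ t = a ⊗ₜ[ℂ] b}) :
    D.IsHopfAlgebra := by
  have hp : ∀ b ∈ 𝒢 0, ((LinearMap.id : V →ₗ[ℂ] V) - D.convOne) b = 0 := fun b hb => by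
    obtain ⟨r, rfl⟩ := Submodule.mem_span_singleton.1 (h0 hb)
    simp [convOne, h.counit_one]
  have hpow : ∀ k n, n < k → ∀ x ∈ 𝒢 n, D.convPow k x = 0 := by
    intro k
    induction k with
    | zero => intro n hn; omega
    | succ k ih =>
      intro n hn x hx
      change (TensorProduct.lift D.mul ∘ₗ
        TensorProduct.map (D.convPow k) (LinearMap.id - D.convOne)) (D.comul x) = 0
      rw [← LinearMap.mem_ker]
      refine Submodule.span_le.2 ?_ (hΔ n x hx)
      rintro _ ⟨i, j, a, b, hij, ha, hb, rfl⟩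
      rw [SetLike.mem_coe, LinearMap.mem_ker, LinearMap.comp_apply, TensorProduct.map_tmul]
      by_cases hi : i < k
      · rw [ih i hi a ha]; simp
      · obtain rfl : j = 0 := by omega
        rw [hp b hb]; simp
  have hfin : ∀ x, ∃ N, ∀ k, N ≤ k → D.convPow k x = 0 := by
    intro x
    have hx : x ∈ Submodule.span ℂ (⋃ n, 𝒢 n) := hspan ▸ Submodule.mem_top
    induction hx using Submodule.span_induction with
    | mem x hx =>
      obtain ⟨n, hn⟩ := Set.mem_iUnion.1 hx
      exact ⟨n + 1, fun k hk => hpow k n (by omega) x hn⟩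
    | zero => exact ⟨0, fun k _ => map_zero _⟩
    | add x y _ _ hx hy =>
      obtain ⟨N, hN⟩ := hx
      obtain ⟨M, hM⟩ := hy
      exact ⟨max N M, fun k hk => by
        rw [map_add, hN k (le_trans (le_max_left _ _) hk), hM k (le_trans (le_max_right _ _) hk),
          add_zero]⟩
    | smul r x _ hx =>
      obtain ⟨N, hN⟩ := hx
      exact ⟨N, fun k hk => by rw [map_smul, hN k hk, smul_zero]⟩
  have hsupp : ∀ x, (Function.support fun k => (-1 : ℂ) ^ k • D.convPow k x).Finite := by
    intro x
    obtain ⟨N, hN⟩ := hfin x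
    refine (Set.finite_lt_nat N).subset fun k hk => ?_
    by_contra hlt
    exact hk (by simp [hN k (not_lt.1 hlt)])
  let S : V →ₗ[ℂ] V :=
    { toFun x := ∑ᶠ k, (-1 : ℂ) ^ k • D.convPow k x
      map_add' x y := by
        rw [← finsum_add_distrib (hsupp x) (hsupp y)]
        simp
      map_smul' r x := by
        rw [RingHom.id_apply, smul_finsum]
        refine finsum_congr fun k => ?_
        rw [map_smul, smul_comm] }
  have hS : ∀ N n, n < N → ∀ x ∈ 𝒢 n, S x = D.convGeom N x := by
    intro N n hn x hx
    change ∑ᶠ k, (-1 : ℂ) ^ k • D.convPow k x = _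
    rw [finsum_eq_sum_of_support_subset (s := Finset.range N)]
    · simp [convGeom]
    · intro k hk
      by_contra hlt
      refine hk ?_
      have : N ≤ k := by simpa using hlt
      simp [hpow k n (by omega) x hx]
  refine h.isHopfAlgebra ⟨S, ?_, ?_⟩
  · refine LinearMap.ext_on hspan fun x hx => ?_
    obtain ⟨n, hn⟩ := Set.mem_iUnion.1 hx
    have e : S.rTensor V (D.comul x) =
        TensorProduct.map (D.convGeom (n + 1)) LinearMap.id (D.comul x) := by
      rw [← sub_eq_zero, ← LinearMap.sub_apply, ← LinearMap.mem_ker]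
      refine Submodule.span_le.2 ?_ (hΔ n x hn)
      rintro _ ⟨i, j, a, b, hij, ha, hb, rfl⟩
      simp [hS (n + 1) i (by omega) a ha]
    have key := LinearMap.congr_fun (h.convGeom_conv_id (n + 1)) x
    simp only [conv, LinearMap.comp_apply, LinearMap.sub_apply, LinearMap.smul_apply,
      hpow _ n (Nat.lt_succ_self n) x hn, smul_zero, sub_zero] at key
    rw [LinearMap.comp_apply, LinearMap.comp_apply, e, key, convOne]
  · refine LinearMap.ext_on hspan fun x hx => ?_
    obtain ⟨n, hn⟩ := Set.mem_iUnion.1 hx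
    have e : S.lTensor V (D.comul x) =
        TensorProduct.map LinearMap.id (D.convGeom (n + 1)) (D.comul x) := by
      rw [← sub_eq_zero, ← LinearMap.sub_apply, ← LinearMap.mem_ker]
      refine Submodule.span_le.2 ?_ (hΔ n x hn)
      rintro _ ⟨i, j, a, b, hij, ha, hb, rfl⟩
      simp [hS (n + 1) j (by omega) b hb]
    have key := LinearMap.congr_fun (h.id_conv_convGeom (n + 1)) x
    simp only [conv, LinearMap.comp_apply, LinearMap.sub_apply, LinearMap.smul_apply,
      hpow _ n (Nat.lt_succ_self n) x hn, smul_zero, sub_zero] at key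
    rw [LinearMap.comp_apply, LinearMap.comp_apply, e, key, convOne]

end General

/-! ### The shuffle algebra -/

section Words

variable {α : Type*}

/-- The list of all shuffles of two words, with multiplicities. -/
def shuffles : List α → List α → List (List α)
  | [], y => [y]
  | a :: x, [] => [a :: x]
  | a :: x, b :: y =>
    (shuffles x (b :: y)).map (List.cons a) ++ (shuffles (a :: x) y).map (List.cons b)

theorem shuffles_nil_right (x : List α) : shuffles x [] = [x] := by
  cases x <;> simp [shuffles]

theorem shuffles_map {β : Type*} (f : α → β) (x y : List α) :
    shuffles (x.map f) (y.map f) = (shuffles x y).map (List.map f) := by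
  induction x, y using shuffles.induct with
  | case1 y => simp [shuffles]
  | case2 a x => simp [shuffles]
  | case3 a x b y ih1 ih2 =>
    simp only [List.map_cons] at ih1 ih2
    simp [shuffles, ih1, ih2, Function.comp_def]

theorem perm_of_mem_shuffles {x y l : List α} (h : l ∈ shuffles x y) : l.Perm (x ++ y) := by
  induction x, y using shuffles.induct generalizing l with
  | case1 y => simp_all [shuffles]
  | case2 a x => simp_all [shuffles]
  | case3 a x b y ih1 ih2 =>
    simp only [shuffles, List.mem_append, List.mem_map] at h
    rcases h with ⟨l, hl, rfl⟩ | ⟨l, hl, rfl⟩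
    · exact (ih1 hl).cons a
    · exact ((ih2 hl).cons b).trans List.perm_middle.symm

/-- A shuffle of two words that are told apart by a property of the letters is recognized by its two
subwords. -/
theorem mem_shuffles_iff (p : α → Bool) {x y : List α} (hx : ∀ a ∈ x, p a)
    (hy : ∀ b ∈ y, ¬ p b) (l : List α) :
    l ∈ shuffles x y ↔ l.filter p = x ∧ l.filter (fun a => !p a) = y := by
  induction x, y using shuffles.induct generalizing l with
  | case1 y =>
    simp only [shuffles, List.mem_singleton]
    constructor
    · rintro rfl
      exact ⟨List.filter_eq_nil_iff.2 hy, List.filter_eq_self.2 fun a ha => by simpa using hy a ha⟩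
    · rintro ⟨h1, h2⟩
      rw [← h2]
      exact (List.filter_eq_self.2 fun a ha => by
        simpa using List.filter_eq_nil_iff.1 h1 a ha).symm
  | case2 a x =>
    simp only [shuffles, List.mem_singleton]
    constructor
    · rintro rfl
      exact ⟨List.filter_eq_self.2 hx, List.filter_eq_nil_iff.2 fun a ha => by simpa using hx a ha⟩
    · rintro ⟨h1, h2⟩
      rw [← h1]
      exact (List.filter_eq_self.2 fun a ha => by
        simpa using List.filter_eq_nil_iff.1 h2 a ha).symm
  | case3 a x b y ih1 ih2 =>
    have ih1 := ih1 (fun c hc => hx c (List.mem_cons_of_mem _ hc)) hy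
    have ih2 := ih2 hx (fun c hc => hy c (List.mem_cons_of_mem _ hc))
    have hpa : p a = true := hx a List.mem_cons_self
    have hpb : p b = false := by simpa using hy b List.mem_cons_self
    simp only [shuffles, List.mem_append, List.mem_map]
    cases l with
    | nil => simp
    | cons c l =>
      by_cases hc : p c
      · have hcb : b ≠ c := fun h => by simp [← h, hpb] at hc
        simp only [List.cons.injEq, hcb, false_and, and_false, exists_false, or_false, hc,
          List.filter_cons_of_pos, Bool.not_true, Bool.false_eq_true, not_false_eq_true,
          List.filter_cons_of_neg]
        constructor
        · rintro ⟨l', hl', rfl, rfl⟩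
          have := (ih1 _).1 hl'
          exact ⟨⟨rfl, this.1⟩, this.2⟩
        · rintro ⟨⟨rfl, h1⟩, h2⟩
          exact ⟨l, (ih1 _).2 ⟨h1, h2⟩, rfl, rfl⟩
      · have hca : a ≠ c := fun h => by simp [← h, hpa] at hc
        have hc' : p c = false := by simpa using hc
        simp only [List.cons.injEq, hca, false_and, and_false, exists_false, false_or, hc',
          List.filter_cons_of_pos, Bool.not_false, Bool.false_eq_true, not_false_eq_true,
          List.filter_cons_of_neg]
        constructor
        · rintro ⟨l', hl', rfl, rfl⟩
          have := (ih2 _).1 hl'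
          exact ⟨this.1, ⟨rfl, this.2⟩⟩
        · rintro ⟨h1, ⟨rfl, h2⟩⟩
          exact ⟨l, (ih2 _).2 ⟨h1, h2⟩, rfl, rfl⟩

theorem nodup_shuffles {x y : List α} (h : x.Disjoint y) : (shuffles x y).Nodup := by
  induction x, y using shuffles.induct with
  | case1 y => simp [shuffles]
  | case2 a x => simp [shuffles]
  | case3 a x b y ih1 ih2 =>
    rw [shuffles, List.nodup_append']
    refine ⟨(ih1 (List.disjoint_of_disjoint_cons_left h)).map (List.cons_injective),
      (ih2 (List.disjoint_of_disjoint_cons_right h)).map (List.cons_injective), ?_⟩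
    intro l h1 h2
    obtain ⟨l1, -, rfl⟩ := List.mem_map.1 h1
    obtain ⟨l2, -, h3⟩ := List.mem_map.1 h2
    have : b = a := (List.cons.inj h3).1
    exact h (a := a) List.mem_cons_self (this ▸ List.mem_cons_self)

/-- The space of formal linear combinations of words. -/
abbrev WordSpace (α : Type*) : Type _ := List α →₀ ℂ

/-- A word, as a basis element. -/
def wordBasis (l : List α) : WordSpace α := Finsupp.single l 1

/-- Prepending a letter. -/
def consLin (a : α) : WordSpace α →ₗ[ℂ] WordSpace α := Finsupp.lmapDomain ℂ ℂ (List.cons a)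

theorem consLin_wordBasis (a : α) (l : List α) : consLin a (wordBasis l) = wordBasis (a :: l) := by
  simp [consLin, wordBasis]

/-- The shuffle algebra: words with the shuffle product and the deconcatenation coproduct. -/
def hopfWord (α : Type*) : HopfData (WordSpace α) where
  mul := Finsupp.lift _ ℂ _ fun x => Finsupp.lift _ ℂ _ fun y =>
    ((shuffles x y).map wordBasis).sum
  one := wordBasis []
  comul := Finsupp.lift _ ℂ _ fun l => ∑ k ∈ Finset.range (l.length + 1),
    wordBasis (l.take k) ⊗ₜ[ℂ] wordBasis (l.drop k)
  counit := Finsupp.lift _ ℂ _ fun l => if l.length = 0 then 1 else 0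

theorem word_induction {motive : WordSpace α → Prop} (x : WordSpace α) (zero : motive 0)
    (add : ∀ x y, motive x → motive y → motive (x + y))
    (smul : ∀ (r : ℂ) x, motive x → motive (r • x))
    (basis : ∀ l, motive (wordBasis l)) : motive x := by
  induction x using Finsupp.induction_linear with
  | zero => exact zero
  | add x y hx hy => exact add x y hx hy
  | single l r =>
    have : Finsupp.single l r = r • wordBasis l := by simp [wordBasis]
    rw [this]
    exact smul r _ (basis l)

theorem hopfWord_mul_basis (x y : List α) :
    (hopfWord α).mul (wordBasis x) (wordBasis y) = ((shuffles x y).map wordBasis).sum := by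
  simp [hopfWord, wordBasis]

theorem hopfWord_one_mul (x : WordSpace α) : (hopfWord α).mul (wordBasis []) x = x := by
  induction x using word_induction with
  | zero => simp
  | add x y hx hy => rw [map_add, hx, hy]
  | smul r x hx => rw [map_smul, hx]
  | basis l => simp [hopfWord_mul_basis, shuffles]

theorem hopfWord_mul_one (x : WordSpace α) : (hopfWord α).mul x (wordBasis []) = x := by
  induction x using word_induction with
  | zero => simp
  | add x y hx hy => rw [map_add, LinearMap.add_apply, hx, hy]
  | smul r x hx => rw [map_smul, LinearMap.smul_apply, hx]
  | basis l => simp [hopfWord_mul_basis, shuffles_nil_right]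

theorem hopfWord_mul_cons_basis (a b : α) (x y : List α) :
    (hopfWord α).mul (wordBasis (a :: x)) (wordBasis (b :: y)) =
      consLin a ((hopfWord α).mul (wordBasis x) (wordBasis (b :: y))) +
      consLin b ((hopfWord α).mul (wordBasis (a :: x)) (wordBasis y)) := by
  simp only [hopfWord_mul_basis, shuffles, List.map_append, List.sum_append, List.map_map,
    map_list_sum]
  congr 3 <;> · funext l; simp [consLin_wordBasis]

/-- The recursion for the shuffle product, from which all properties of the product follow by
induction. -/
theorem hopfWord_mul_cons (a b : α) (x y : WordSpace α) :
    (hopfWord α).mul (consLin a x) (consLin b y) =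
      consLin a ((hopfWord α).mul x (consLin b y)) +
      consLin b ((hopfWord α).mul (consLin a x) y) := by
  induction x using word_induction with
  | zero => simp
  | add x x' hx hy =>
    simp only [map_add, LinearMap.add_apply, hx, hy]
    abel
  | smul r x hx => simp only [map_smul, LinearMap.smul_apply, hx, smul_add]
  | basis l =>
    induction y using word_induction with
    | zero => simp
    | add x x' hx hy =>
      simp only [map_add, hx, hy]
      abel
    | smul r x hx => simp only [map_smul, hx, smul_add]
    | basis l' => simp only [consLin_wordBasis, hopfWord_mul_cons_basis]

theorem hopfWord_mul_assoc_basis (x y z : List α) :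
    (hopfWord α).mul ((hopfWord α).mul (wordBasis x) (wordBasis y)) (wordBasis z) =
      (hopfWord α).mul (wordBasis x) ((hopfWord α).mul (wordBasis y) (wordBasis z)) := by
  induction x generalizing y z with
  | nil => simp only [hopfWord_one_mul]
  | cons a x ihx =>
    induction y generalizing z with
    | nil => simp only [hopfWord_one_mul, hopfWord_mul_one]
    | cons b y ihy =>
      induction z with
      | nil => simp only [hopfWord_mul_one]
      | cons c z ihz =>
        have ihz' := ihz
        have h1 := ihx (b :: y) (c :: z)
        have h2 := ihy (c :: z)
        rw [hopfWord_mul_cons_basis a b, map_add, LinearMap.add_apply] at ihz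
        rw [hopfWord_mul_cons_basis b c, map_add] at h1
        rw [hopfWord_mul_cons_basis b c, hopfWord_mul_cons_basis a b]
        simp only [← consLin_wordBasis] at *
        simp only [map_add, LinearMap.add_apply, hopfWord_mul_cons] at *
        rw [h1, h2, ← ihz']
        simp only [map_add]
        abel

theorem hopfWord_comul_basis (l : List α) :
    (hopfWord α).comul (wordBasis l) = ∑ k ∈ Finset.range (l.length + 1),
      wordBasis (l.take k) ⊗ₜ[ℂ] wordBasis (l.drop k) := by
  simp [hopfWord, wordBasis]

/-- The recursion for deconcatenation: the cut is either in front of the first letter or after it.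
-/
theorem hopfWord_comul_cons (a : α) (x : WordSpace α) :
    (hopfWord α).comul (consLin a x) =
      wordBasis [] ⊗ₜ[ℂ] consLin a x + (consLin a).rTensor _ ((hopfWord α).comul x) := by
  induction x using word_induction with
  | zero => simp
  | add x x' hx hy =>
    simp only [map_add, hx, hy, TensorProduct.tmul_add]
    abel
  | smul r x hx => simp only [map_smul, hx, smul_add, TensorProduct.tmul_smul]
  | basis l =>
    rw [consLin_wordBasis, hopfWord_comul_basis, hopfWord_comul_basis, List.length_cons,
      Finset.sum_range_succ', add_comm]
    simp [consLin_wordBasis]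

theorem hopfWord_comul_one :
    (hopfWord α).comul (wordBasis []) = wordBasis [] ⊗ₜ[ℂ] wordBasis [] := by
  simp [hopfWord_comul_basis]

theorem mulTensor_one_left (x : WordSpace α) (s : WordSpace α ⊗[ℂ] WordSpace α) (b : α) :
    (hopfWord α).mulTensor ((wordBasis [] ⊗ₜ[ℂ] x) ⊗ₜ[ℂ] (consLin b).rTensor _ s) =
      (consLin b).rTensor _ ((hopfWord α).mulTensor ((wordBasis [] ⊗ₜ[ℂ] x) ⊗ₜ[ℂ] s)) := by
  induction s with
  | zero => simp
  | add c d hc hd => simp only [TensorProduct.tmul_add, map_add, hc, hd]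
  | tmul c d => simp [HopfData.mulTensor_tmul, hopfWord_one_mul]

theorem mulTensor_one_right (x : WordSpace α) (s : WordSpace α ⊗[ℂ] WordSpace α) (a : α) :
    (hopfWord α).mulTensor ((consLin a).rTensor _ s ⊗ₜ[ℂ] (wordBasis [] ⊗ₜ[ℂ] x)) =
      (consLin a).rTensor _ ((hopfWord α).mulTensor (s ⊗ₜ[ℂ] (wordBasis [] ⊗ₜ[ℂ] x))) := by
  induction s with
  | zero => simp
  | add c d hc hd => simp only [TensorProduct.add_tmul, map_add, hc, hd]
  | tmul c d => simp [HopfData.mulTensor_tmul, hopfWord_mul_one]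

theorem mulTensor_cons (a b : α) (s t : WordSpace α ⊗[ℂ] WordSpace α) :
    (hopfWord α).mulTensor ((consLin a).rTensor _ s ⊗ₜ[ℂ] (consLin b).rTensor _ t) =
      (consLin a).rTensor _ ((hopfWord α).mulTensor (s ⊗ₜ[ℂ] (consLin b).rTensor _ t)) +
      (consLin b).rTensor _ ((hopfWord α).mulTensor ((consLin a).rTensor _ s ⊗ₜ[ℂ] t)) := by
  induction s with
  | zero => simp
  | add c d hc hd =>
    simp only [TensorProduct.add_tmul, map_add, hc, hd]
    abel
  | tmul p q =>
    induction t with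
    | zero => simp
    | add c d hc hd =>
      simp only [TensorProduct.tmul_add, map_add, hc, hd]
      abel
    | tmul p' q' =>
      simp [HopfData.mulTensor_tmul, hopfWord_mul_cons, TensorProduct.add_tmul]

theorem hopfWord_comul_mul_basis (x y : List α) :
    (hopfWord α).comul ((hopfWord α).mul (wordBasis x) (wordBasis y)) =
      (hopfWord α).mulTensor
        ((hopfWord α).comul (wordBasis x) ⊗ₜ[ℂ] (hopfWord α).comul (wordBasis y)) := by
  have unitL : ∀ s : WordSpace α ⊗[ℂ] WordSpace α, (hopfWord α).mulTensor
      ((wordBasis [] ⊗ₜ[ℂ] wordBasis []) ⊗ₜ[ℂ] s) = s := fun s => by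
    induction s with
    | zero => simp
    | add c d hc hd => simp only [TensorProduct.tmul_add, map_add, hc, hd]
    | tmul c d => simp [HopfData.mulTensor_tmul, hopfWord_one_mul]
  have unitR : ∀ s : WordSpace α ⊗[ℂ] WordSpace α, (hopfWord α).mulTensor
      (s ⊗ₜ[ℂ] (wordBasis [] ⊗ₜ[ℂ] wordBasis [])) = s := fun s => by
    induction s with
    | zero => simp
    | add c d hc hd => simp only [TensorProduct.add_tmul, map_add, hc, hd]
    | tmul c d => simp [HopfData.mulTensor_tmul, hopfWord_mul_one]
  induction x generalizing y with
  | nil => rw [hopfWord_comul_one, unitL, hopfWord_one_mul]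
  | cons a x ihx =>
    induction y with
    | nil => rw [hopfWord_comul_one, unitR, hopfWord_mul_one]
    | cons b y ihy =>
      have h1 := ihx (b :: y)
      simp only [← consLin_wordBasis] at *
      rw [hopfWord_mul_cons, map_add, hopfWord_comul_cons, hopfWord_comul_cons, h1, ihy,
        hopfWord_comul_cons, hopfWord_comul_cons]
      simp only [TensorProduct.add_tmul, TensorProduct.tmul_add, map_add, mulTensor_cons,
        mulTensor_one_left, mulTensor_one_right, HopfData.mulTensor_tmul, hopfWord_one_mul,
        hopfWord_mul_cons]
      abel

theorem hopfWord_coassoc :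
    (TensorProduct.assoc ℂ _ _ _).toLinearMap ∘ₗ (hopfWord α).comul.rTensor (WordSpace α) ∘ₗ
      (hopfWord α).comul = (hopfWord α).comul.lTensor (WordSpace α) ∘ₗ (hopfWord α).comul := by
  refine LinearMap.ext fun x => ?_
  induction x using word_induction with
  | zero => simp
  | add x y hx hy => rw [map_add, hx, hy, map_add]
  | smul r x hx => rw [map_smul, hx, map_smul]
  | basis l =>
    simp only [LinearMap.comp_apply, LinearEquiv.coe_coe]
    induction l with
    | nil => simp [hopfWord_comul_one]
    | cons a l ih =>
      have e1 : ∀ s : WordSpace α ⊗[ℂ] WordSpace α, (TensorProduct.assoc ℂ _ _ _)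
          ((hopfWord α).comul.rTensor (WordSpace α) ((consLin a).rTensor _ s)) =
          wordBasis [] ⊗ₜ[ℂ] (consLin a).rTensor _ s + (consLin a).rTensor _
            ((TensorProduct.assoc ℂ _ _ _)
              ((hopfWord α).comul.rTensor (WordSpace α) s)) := fun s => by
        induction s with
        | zero => simp
        | add c d hc hd =>
          simp only [TensorProduct.tmul_add, map_add, hc, hd]
          abel
        | tmul c d =>
          simp only [LinearMap.rTensor_tmul, hopfWord_comul_cons, TensorProduct.add_tmul, map_add,
            TensorProduct.assoc_tmul]
          congr 1
          generalize (hopfWord α).comul c = t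
          induction t with
          | zero => simp
          | add c d hc hd => simp only [TensorProduct.add_tmul, map_add, hc, hd]
          | tmul c d => simp
      have e2 : ∀ s : WordSpace α ⊗[ℂ] WordSpace α,
          (hopfWord α).comul.lTensor (WordSpace α) ((consLin a).rTensor _ s) =
          (consLin a).rTensor _ ((hopfWord α).comul.lTensor (WordSpace α) s) := fun s => by
        induction s with
        | zero => simp
        | add c d hc hd => simp only [map_add, hc, hd]
        | tmul c d => simp
      rw [← consLin_wordBasis, hopfWord_comul_cons, map_add, map_add, map_add, e1, e2, ih]
      simp only [LinearMap.rTensor_tmul, LinearMap.lTensor_tmul, hopfWord_comul_one,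
        hopfWord_comul_cons, TensorProduct.assoc_tmul, TensorProduct.tmul_add]
      abel

end Words

section WordCounit

variable {α : Type*}

theorem hopfWord_counit_basis (l : List α) :
    (hopfWord α).counit (wordBasis l) = if l.length = 0 then 1 else 0 := by
  simp [hopfWord, wordBasis]

theorem hopfWord_counit_consLin (a : α) : (hopfWord α).counit ∘ₗ consLin a = 0 := by
  refine LinearMap.ext fun x => ?_
  induction x using word_induction with
  | zero => simp
  | add x y hx hy => rw [map_add, hx, hy, map_add]
  | smul r x hx => rw [map_smul, hx, map_smul]
  | basis l => simp [consLin_wordBasis, hopfWord_counit_basis]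

theorem hopfWord_rTensor_counit_comul :
    (hopfWord α).counit.rTensor _ ∘ₗ (hopfWord α).comul = TensorProduct.mk ℂ ℂ _ 1 := by
  refine LinearMap.ext fun x => ?_
  induction x using word_induction with
  | zero => simp
  | add x y hx hy => rw [map_add, hx, hy, map_add]
  | smul r x hx => rw [map_smul, hx, map_smul]
  | basis l =>
    cases l with
    | nil => simp [hopfWord_comul_one, hopfWord_counit_basis]
    | cons a l =>
      rw [LinearMap.comp_apply, ← consLin_wordBasis, hopfWord_comul_cons, map_add,
        ← LinearMap.comp_apply, ← LinearMap.rTensor_comp, hopfWord_counit_consLin]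
      simp [hopfWord_counit_basis]

theorem hopfWord_lTensor_counit_comul :
    (hopfWord α).counit.lTensor _ ∘ₗ (hopfWord α).comul = (TensorProduct.mk ℂ _ ℂ).flip 1 := by
  refine LinearMap.ext fun x => ?_
  induction x using word_induction with
  | zero => simp
  | add x y hx hy => rw [map_add, hx, hy, map_add]
  | smul r x hx => rw [map_smul, hx, map_smul]
  | basis l =>
    induction l with
    | nil => simp [hopfWord_comul_one, hopfWord_counit_basis]
    | cons a l ih =>
      have e : (hopfWord α).counit.lTensor (WordSpace α) ∘ₗ (consLin a).rTensor (WordSpace α) =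
          (consLin a).rTensor ℂ ∘ₗ (hopfWord α).counit.lTensor (WordSpace α) := by
        rw [LinearMap.lTensor_comp_rTensor, LinearMap.rTensor_comp_lTensor]
      rw [LinearMap.comp_apply] at ih
      rw [LinearMap.comp_apply, ← consLin_wordBasis, hopfWord_comul_cons, map_add,
        ← LinearMap.comp_apply (LinearMap.lTensor _ _), e, LinearMap.comp_apply, ih,
        LinearMap.lTensor_tmul, ← LinearMap.comp_apply, hopfWord_counit_consLin]
      simp

theorem hopfWord_counit_mul_basis (x y : List α) :
    (hopfWord α).counit ((hopfWord α).mul (wordBasis x) (wordBasis y)) =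
      (hopfWord α).counit (wordBasis x) * (hopfWord α).counit (wordBasis y) := by
  cases x with
  | nil => rw [hopfWord_one_mul]; simp [hopfWord_counit_basis]
  | cons a x =>
    cases y with
    | nil => rw [hopfWord_mul_one]; simp [hopfWord_counit_basis]
    | cons b y =>
      have hc : ∀ (c : α) t, (hopfWord α).counit (consLin c t) = 0 := fun c t =>
        LinearMap.congr_fun (hopfWord_counit_consLin c) t
      rw [hopfWord_mul_cons_basis, map_add, hc, hc]
      simp [hopfWord_counit_basis]

end WordCounit

/-! ### Standardization and the Malvenuto-Reutenauer algebra -/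

section Standardization

/-- The sorting permutation of a tuple depends only on its inversions. -/
theorem sort_eq_sort {n : ℕ} {α β : Type*} [LinearOrder α] [LinearOrder β] (f : Fin n → α)
    (g : Fin n → β) (h : ∀ i j, i < j → (f j < f i ↔ g j < g i)) : Tuple.sort f = Tuple.sort g := by
  obtain ⟨hm, hs⟩ := Tuple.eq_sort_iff.1 (rfl : Tuple.sort f = Tuple.sort f)
  have key : ∀ a b, a < b → Tuple.sort f b < Tuple.sort f a →
      g (Tuple.sort f a) < g (Tuple.sort f b) := fun a b hab hlt => by
    refine (h _ _ hlt).1 (lt_of_le_of_ne (hm hab.le) fun he => ?_)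
    exact lt_asymm hlt (hs a b hab he)
  refine Tuple.eq_sort_iff.2 ⟨fun a b hab => ?_, fun a b hab he => ?_⟩
  · rcases hab.eq_or_lt with rfl | hab
    · exact le_rfl
    · rcases lt_trichotomy (Tuple.sort f a) (Tuple.sort f b) with hlt | heq | hlt
      · by_contra hcon
        exact absurd (hm hab.le) (not_le.2 ((h _ _ hlt).2 (not_le.1 hcon)))
      · exact (congrArg g heq).le
      · exact (key a b hab hlt).le
  · rcases lt_trichotomy (Tuple.sort f a) (Tuple.sort f b) with hlt | heq | hlt
    · exact hlt
    · exact absurd ((Tuple.sort f).injective heq) hab.ne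
    · exact absurd he (key a b hab hlt).ne

/-- A tuple and its standardization have the same inversions. -/
theorem sort_symm_lt_iff {n : ℕ} {α : Type*} [LinearOrder α] (f : Fin n → α) {i j : Fin n}
    (hij : i < j) : f j < f i ↔ (Tuple.sort f).symm j < (Tuple.sort f).symm i := by
  obtain ⟨hm, hs⟩ := Tuple.eq_sort_iff.1 (rfl : Tuple.sort f = Tuple.sort f)
  constructor
  · intro hlt
    by_contra hcon
    have := hm (not_lt.1 hcon)
    simp only [Function.comp_apply, Equiv.apply_symm_apply] at this
    exact absurd hlt (not_lt.2 this)
  · intro hlt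
    have h1 := hm hlt.le
    have h2 := hs _ _ hlt
    simp only [Function.comp_apply, Equiv.apply_symm_apply] at h1 h2
    exact lt_of_le_of_ne h1 fun he => lt_asymm hij (h2 he)

variable {α : Type*} [LinearOrder α]

/-- Standardization of a word, the permutation being recorded together with its length. -/
def stdWord (l : List α) : Σ n : ℕ, Equiv.Perm (Fin n) :=
  ⟨(List.equivSigmaTuple l).1, (Tuple.sort (List.equivSigmaTuple l).2).symm⟩

theorem stdWord_ofFn {n : ℕ} (f : Fin n → α) : stdWord (List.ofFn f) =
    ⟨n, (Tuple.sort f).symm⟩ := by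
  have : List.equivSigmaTuple (List.ofFn f) = ⟨n, f⟩ :=
    List.equivSigmaTuple.apply_symm_apply ⟨n, f⟩
  unfold stdWord
  rw [this]

theorem stdWord_ofFn_congr {β : Type*} [LinearOrder β] {n : ℕ} (f : Fin n → α) (g : Fin n → β)
    (h : ∀ i j, i < j → (f j < f i ↔ g j < g i)) :
    stdWord (List.ofFn f) = stdWord (List.ofFn g) := by
  rw [stdWord_ofFn, stdWord_ofFn, sort_eq_sort f g h]

/-- Two images of a word have the same standardization if the two maps order its letters in the same
way. -/
theorem stdWord_map_congr {β γ : Type*} [LinearOrder β] (L : List γ) (f : γ → α)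
    (g : γ → β) (h : ∀ p ∈ L, ∀ q ∈ L, (f p < f q ↔ g p < g q)) :
    stdWord (L.map f) = stdWord (L.map g) := by
  have e : L = List.ofFn L.get := (List.ofFn_get L).symm
  rw [e, List.map_ofFn, List.map_ofFn]
  exact stdWord_ofFn_congr _ _ fun i j _ => h _ (List.get_mem _ _) _ (List.get_mem _ _)

/-- The linear map from words to `MR`, `l ↦ F_{std(l)}`. -/
def stdLin (α : Type*) [LinearOrder α] : WordSpace α →ₗ[ℂ] MR := Finsupp.lmapDomain ℂ ℂ stdWord

theorem stdLin_basis (l : List α) : stdLin α (wordBasis l) = Finsupp.single (stdWord l) 1 := by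
  simp [stdLin, wordBasis]

theorem stdLin_ofFn {n : ℕ} (f : Fin n → α) :
    stdLin α (wordBasis (List.ofFn f)) = fund (Tuple.sort f).symm := by
  rw [stdLin_basis, stdWord_ofFn, fund]

/-- The word `w(1) … w(n)` of a permutation. -/
def permWord {n : ℕ} (w : Equiv.Perm (Fin n)) : List ℕ := List.ofFn fun i => (w i : ℕ)

theorem sort_perm_val {n : ℕ} (w : Equiv.Perm (Fin n)) : Tuple.sort w = w.symm := by
  refine (Tuple.eq_sort_iff.2 ⟨fun a b hab => by simpa using hab, fun a b hab he => ?_⟩).symm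
  simp at he
  exact absurd he hab.ne

theorem stdLin_ofFn_perm {n : ℕ} (w : Equiv.Perm (Fin n)) :
    stdLin (Fin n) (wordBasis (List.ofFn w)) = fund w := by
  rw [stdLin_ofFn, sort_perm_val, Equiv.symm_symm]

theorem stdLin_map_of_strictMono {β : Type*} [LinearOrder β] (f : α → β) (hf : StrictMono f)
    (l : List α) : stdLin β (wordBasis (l.map f)) = stdLin α (wordBasis l) := by
  rw [stdLin_basis, stdLin_basis]
  have := stdWord_map_congr l f id fun p _ q _ => hf.lt_iff_lt
  rw [this, List.map_id]

theorem permWord_eq_map {n : ℕ} (w : Equiv.Perm (Fin n)) :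
    permWord w = (List.ofFn w).map Fin.val := by
  rw [permWord, List.map_ofFn]; rfl

theorem stdLin_permWord {n : ℕ} (w : Equiv.Perm (Fin n)) :
    stdLin ℕ (wordBasis (permWord w)) = fund w := by
  rw [permWord_eq_map, stdLin_map_of_strictMono _ Fin.val_strictMono, stdLin_ofFn_perm]

theorem MR_induction {motive : MR → Prop} (x : MR) (zero : motive 0)
    (add : ∀ x y, motive x → motive y → motive (x + y))
    (smul : ∀ (r : ℂ) x, motive x → motive (r • x))
    (basis : ∀ {n : ℕ} (w : Equiv.Perm (Fin n)), motive (fund w)) : motive x := by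
  induction x using Finsupp.induction_linear with
  | zero => exact zero
  | add x y hx hy => exact add x y hx hy
  | single w r =>
    have : Finsupp.single w r = r • fund w.2 := by simp [fund]
    rw [this]
    exact smul r _ (basis w.2)

theorem stdLin_surjective : Function.Surjective (stdLin ℕ) := by
  intro x
  induction x using MR_induction with
  | zero => exact ⟨0, map_zero _⟩
  | add x y hx hy =>
    obtain ⟨a, rfl⟩ := hx
    obtain ⟨b, rfl⟩ := hy
    exact ⟨a + b, map_add _ _ _⟩
  | smul r x hx =>
    obtain ⟨a, rfl⟩ := hx
    exact ⟨r • a, map_smul _ _ _⟩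
  | basis w => exact ⟨_, stdLin_permWord w⟩

theorem hopfMR_comul_fund {n : ℕ} (w : Equiv.Perm (Fin n)) :
    hopfMR.comul (fund w) = ∑ k : Fin (n + 1),
      fund (std fun i : Fin k => w ⟨i, by omega⟩) ⊗ₜ[ℂ]
        fund (std fun i : Fin (n - k) => w ⟨k + i, by omega⟩) := by
  simp [hopfMR, fund]

/-- Standardization maps deconcatenation of words to the coproduct of `MR`, without any condition on
the letters. -/
theorem hopfMR_comul_stdLin (x : WordSpace α) :
    hopfMR.comul (stdLin α x) =
      TensorProduct.map (stdLin α) (stdLin α) ((hopfWord α).comul x) := by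
  induction x using word_induction with
  | zero => simp
  | add x y hx hy => simp only [map_add, hx, hy]
  | smul r x hx => simp only [map_smul, hx]
  | basis l =>
    obtain ⟨⟨n, f⟩, rfl⟩ := List.equivSigmaTuple.symm.surjective l
    change hopfMR.comul (stdLin α (wordBasis (List.ofFn f))) = TensorProduct.map _ _
      ((hopfWord α).comul (wordBasis (List.ofFn f)))
    rw [stdLin_ofFn, hopfMR_comul_fund, hopfWord_comul_basis, map_sum, List.length_ofFn,
      Finset.sum_range]
    refine Finset.sum_congr rfl fun k _ => ?_
    have hk : (k : ℕ) ≤ n := by omega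
    have h1 : (List.ofFn f).take k = List.ofFn fun i : Fin k => f ⟨i, by omega⟩ := by
      apply List.ext_getElem
      · simp [hk]
      · intro i h1 h2; simp
    have h2 : (List.ofFn f).drop k = List.ofFn fun i : Fin (n - k) => f ⟨k + i, by omega⟩ := by
      apply List.ext_getElem
      · simp
      · intro i h1 h2; simp
    rw [TensorProduct.map_tmul, h1, h2, stdLin_ofFn, stdLin_ofFn, std, std]
    refine congrArg₂ (fun a b => fund a ⊗ₜ[ℂ] fund b) ?_ ?_
    · refine congrArg Equiv.symm (sort_eq_sort _ _ fun i j hij => ?_)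
      exact (sort_symm_lt_iff f (i := ⟨i, by omega⟩) (j := ⟨j, by omega⟩) hij).symm
    · refine congrArg Equiv.symm (sort_eq_sort _ _ fun i j hij => ?_)
      exact (sort_symm_lt_iff f (i := ⟨k + i, by omega⟩) (j := ⟨k + j, by omega⟩)
        (by simpa using hij)).symm

theorem hopfMR_counit_fund {n : ℕ} (w : Equiv.Perm (Fin n)) :
    hopfMR.counit (fund w) = if n = 0 then 1 else 0 := by
  simp [hopfMR, fund]

theorem hopfMR_counit_stdLin (x : WordSpace α) :
    hopfMR.counit (stdLin α x) = (hopfWord α).counit x := by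
  induction x using word_induction with
  | zero => simp
  | add x y hx hy => simp only [map_add, hx, hy]
  | smul r x hx => simp only [map_smul, hx]
  | basis l =>
    obtain ⟨⟨n, f⟩, rfl⟩ := List.equivSigmaTuple.symm.surjective l
    change hopfMR.counit (stdLin α (wordBasis (List.ofFn f))) =
      (hopfWord α).counit (wordBasis (List.ofFn f))
    rw [stdLin_ofFn, hopfMR_counit_fund, hopfWord_counit_basis, List.length_ofFn]

theorem stdLin_nil : stdLin α (wordBasis []) = hopfMR.one := by
  have h := stdLin_ofFn (fun i : Fin 0 => (i.elim0 : α))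
  rw [List.ofFn_zero] at h
  rw [h]
  exact congrArg fund (Subsingleton.elim _ _)

theorem hopfMR_mul_fund {m n : ℕ} (u : Equiv.Perm (Fin m)) (v : Equiv.Perm (Fin n))
    [DecidablePred (IsShuffle u v)] :
    hopfMR.mul (fund u) (fund v) = ∑ w ∈ Finset.univ.filter (fun w => IsShuffle u v w), fund w := by
  simp only [hopfMR, fund, Finsupp.lift_apply, Finsupp.sum_single_index, zero_smul, one_smul]

theorem isShuffle_iff_mem {m n : ℕ} (u : Equiv.Perm (Fin m)) (v : Equiv.Perm (Fin n))
    (w : Equiv.Perm (Fin (m + n))) : IsShuffle u v w ↔ List.ofFn w ∈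
      shuffles ((List.ofFn u).map (Fin.castAdd n)) ((List.ofFn v).map (Fin.natAdd m)) := by
  have hw : (List.ofFn w).Pairwise fun a b => w.symm a < w.symm b := by
    rw [List.pairwise_ofFn]; intro i j hij; simpa using hij
  have hnd : (List.ofFn w).Nodup := List.nodup_ofFn.2 w.injective
  have hu : ((List.ofFn u).map (Fin.castAdd n)).Nodup :=
    (List.nodup_ofFn.2 u.injective).map (Fin.castAdd_injective m n)
  have hv : ((List.ofFn v).map (Fin.natAdd m)).Nodup :=
    (List.nodup_ofFn.2 v.injective).map (Fin.natAdd_injective n m)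
  rw [mem_shuffles_iff (fun a : Fin (m + n) => decide ((a : ℕ) < m)) (by simp) (by simp)]
  constructor
  · rintro ⟨h1, h2⟩
    constructor
    · refine List.Perm.eq_of_pairwise (le := fun a b => w.symm a < w.symm b)
        (fun a b _ _ h h' => absurd h (lt_asymm h')) (hw.filter _) ?_ ?_
      · rw [List.pairwise_map, List.pairwise_ofFn]
        intro i j hij
        rw [h1]; simpa using hij
      · rw [List.perm_ext_iff_of_nodup (hnd.filter _) hu]
        intro a
        simp only [List.mem_filter, List.mem_ofFn, decide_eq_true_eq, List.mem_map]
        constructor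
        · rintro ⟨-, ha⟩
          exact ⟨⟨a, ha⟩, ⟨u.symm ⟨a, ha⟩, by simp⟩, rfl⟩
        · rintro ⟨b, -, rfl⟩
          exact ⟨⟨w.symm (Fin.castAdd n b), by simp⟩, by simp⟩
    · refine List.Perm.eq_of_pairwise (le := fun a b => w.symm a < w.symm b)
        (fun a b _ _ h h' => absurd h (lt_asymm h')) (hw.filter _) ?_ ?_
      · rw [List.pairwise_map, List.pairwise_ofFn]
        intro i j hij
        rw [h2]; simpa using hij
      · rw [List.perm_ext_iff_of_nodup (hnd.filter _) hv]
        intro a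
        simp only [List.mem_filter, List.mem_ofFn, List.mem_map, Bool.not_eq_true',
          decide_eq_false_iff_not, not_lt]
        constructor
        · rintro ⟨-, ha⟩
          exact ⟨⟨a - m, by omega⟩, ⟨v.symm ⟨a - m, by omega⟩, by simp⟩,
            Fin.ext (by simp; omega)⟩
        · rintro ⟨b, -, rfl⟩
          exact ⟨⟨w.symm (Fin.natAdd m b), by simp⟩, by simp⟩
  · rintro ⟨h1, h2⟩
    have p1 := hw.filter fun a : Fin (m + n) => decide ((a : ℕ) < m)
    have p2 := hw.filter fun a : Fin (m + n) => !decide ((a : ℕ) < m)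
    rw [h1, List.pairwise_map, List.pairwise_ofFn] at p1
    rw [h2, List.pairwise_map, List.pairwise_ofFn] at p2
    have m1 : StrictMono fun i => w.symm (Fin.castAdd n (u i)) := fun i j hij => p1 hij
    have m2 : StrictMono fun i => w.symm (Fin.natAdd m (v i)) := fun i j hij => p2 hij
    constructor
    · intro i j
      have := m1.lt_iff_lt (a := u.symm i) (b := u.symm j)
      simpa using this
    · intro i j
      have := m2.lt_iff_lt (a := v.symm i) (b := v.symm j)
      simpa using this

/-- The product of `F_u` and `F_v`, as the sum over the shuffles of two words. -/
theorem hopfMR_mul_fund_eq {m n : ℕ} (u : Equiv.Perm (Fin m)) (v : Equiv.Perm (Fin n)) :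
    hopfMR.mul (fund u) (fund v) = stdLin _ ((hopfWord (Fin (m + n))).mul
      (wordBasis ((List.ofFn u).map (Fin.castAdd n)))
      (wordBasis ((List.ofFn v).map (Fin.natAdd m)))) := by
  classical
  have hdisj : List.Disjoint ((List.ofFn u).map (Fin.castAdd n))
      ((List.ofFn v).map (Fin.natAdd m)) := by
    intro a h1 h2
    obtain ⟨b, -, rfl⟩ := List.mem_map.1 h1
    obtain ⟨c, -, h3⟩ := List.mem_map.1 h2
    have := congrArg Fin.val h3
    simp at this
    omega
  rw [hopfMR_mul_fund, hopfWord_mul_basis, map_list_sum, List.map_map,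
    ← List.sum_toFinset _ (nodup_shuffles hdisj)]
  refine Finset.sum_bij (fun w _ => List.ofFn w) ?_ ?_ ?_ ?_
  · intro w hw
    rw [List.mem_toFinset]
    exact (isShuffle_iff_mem u v w).1 (by simpa using hw)
  · intro w _ w' _ h
    exact Equiv.ext (congrFun (List.ofFn_injective h))
  · intro l hl
    rw [List.mem_toFinset] at hl
    have hp := perm_of_mem_shuffles hl
    have hlen : l.length = m + n := by simpa using hp.length_eq
    have hnd : l.Nodup := by
      rw [hp.nodup_iff, List.nodup_append']
      exact ⟨(List.nodup_ofFn.2 u.injective).map (Fin.castAdd_injective m n),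
        (List.nodup_ofFn.2 v.injective).map (Fin.natAdd_injective n m), hdisj⟩
    obtain ⟨⟨k, f⟩, rfl⟩ := List.equivSigmaTuple.symm.surjective l
    change (List.ofFn f).length = m + n at hlen
    rw [List.length_ofFn] at hlen
    subst hlen
    have hinj : Function.Injective f := List.nodup_ofFn.1 hnd
    refine ⟨Equiv.ofBijective f (Finite.injective_iff_bijective.1 hinj), ?_, rfl⟩
    rw [Finset.mem_filter]
    exact ⟨Finset.mem_univ _, (isShuffle_iff_mem u v _).2 hl⟩
  · intro w _
    exact (stdLin_ofFn_perm w).symm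

/-- If the letters of `x` are smaller than those of `y`, then
`F_{std(x)} F_{std(y)} = F_{std(x ⧢ y)}`. -/
theorem hopfMR_mul_stdLin {x y : List α} (hx : x.Nodup) (hy : y.Nodup)
    (hxy : ∀ a ∈ x, ∀ b ∈ y, a < b) :
    hopfMR.mul (stdLin α (wordBasis x)) (stdLin α (wordBasis y)) =
      stdLin α ((hopfWord α).mul (wordBasis x) (wordBasis y)) := by
  obtain ⟨⟨m, f⟩, rfl⟩ := List.equivSigmaTuple.symm.surjective x
  obtain ⟨⟨n, g⟩, rfl⟩ := List.equivSigmaTuple.symm.surjective y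
  change (List.ofFn f).Nodup at hx
  change (List.ofFn g).Nodup at hy
  change ∀ a ∈ List.ofFn f, ∀ b ∈ List.ofFn g, a < b at hxy
  change hopfMR.mul (stdLin α (wordBasis (List.ofFn f))) (stdLin α (wordBasis (List.ofFn g))) =
    stdLin α ((hopfWord α).mul (wordBasis (List.ofFn f)) (wordBasis (List.ofFn g)))
  rw [List.nodup_ofFn] at hx hy
  have hxy' : ∀ i j, f i < g j := fun i j => hxy _ (by simp) _ (by simp)
  have hmono : ∀ {k : ℕ} {h : Fin k → α}, Function.Injective h → ∀ i j,
      (h i < h j ↔ (Tuple.sort h).symm i < (Tuple.sort h).symm j) := by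
    intro k h hh i j
    have : StrictMono (h ∘ Tuple.sort h) :=
      (Tuple.monotone_sort h).strictMono_of_injective (hh.comp (Tuple.sort h).injective)
    have := this.lt_iff_lt (a := (Tuple.sort h).symm i) (b := (Tuple.sort h).symm j)
    simpa using this
  rw [stdLin_ofFn, stdLin_ofFn, hopfMR_mul_fund_eq, hopfWord_mul_basis, hopfWord_mul_basis,
    map_list_sum, map_list_sum, List.map_map, List.map_map]
  -- Both sides come from the shuffles of two words over the alphabet of positions.
  let φ : Fin m ⊕ Fin n → Fin (m + n) := Sum.elim
    (fun i => Fin.castAdd n ((Tuple.sort f).symm i)) (fun i => Fin.natAdd m ((Tuple.sort g).symm i))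
  let ψ : Fin m ⊕ Fin n → α := Sum.elim f g
  have e1 : (List.ofFn (Tuple.sort f).symm).map (Fin.castAdd n) =
      (List.ofFn (Sum.inl : Fin m → Fin m ⊕ Fin n)).map φ := by
    rw [List.map_ofFn, List.map_ofFn]; rfl
  have e2 : (List.ofFn (Tuple.sort g).symm).map (Fin.natAdd m) =
      (List.ofFn (Sum.inr : Fin n → Fin m ⊕ Fin n)).map φ := by
    rw [List.map_ofFn, List.map_ofFn]; rfl
  have e3 : List.ofFn f = (List.ofFn (Sum.inl : Fin m → Fin m ⊕ Fin n)).map ψ := by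
    rw [List.map_ofFn]; rfl
  have e4 : List.ofFn g = (List.ofFn (Sum.inr : Fin n → Fin m ⊕ Fin n)).map ψ := by
    rw [List.map_ofFn]; rfl
  rw [e1, e2, e3, e4, shuffles_map, shuffles_map, List.map_map, List.map_map]
  congr 1
  refine List.map_congr_left fun l _ => ?_
  simp only [Function.comp_apply, stdLin_basis]
  rw [stdWord_map_congr l φ ψ]
  rintro (i | i) - (j | j) -
  · exact (hmono hx i j).symm
  · simp only [φ, ψ, Sum.elim_inl, Sum.elim_inr, hxy', iff_true, Fin.lt_def, Fin.val_castAdd,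
      Fin.val_natAdd]
    omega
  · simp only [φ, ψ, Sum.elim_inl, Sum.elim_inr, (hxy' j i).not_gt, iff_false, Fin.lt_def,
      Fin.val_castAdd, Fin.val_natAdd]
    omega
  · exact Iff.trans Nat.add_lt_add_iff_left (Fin.lt_def.symm.trans (hmono hy i j).symm)

/-- Each `F_w` is the image of a word with letters in a prescribed interval, so that several `F_w`
can be represented by words whose letters increase from one word to the next. -/
theorem exists_stdLin_eq {n : ℕ} (w : Equiv.Perm (Fin n)) (m : ℕ) :
    ∃ l : List ℕ, l.Nodup ∧ (∀ a ∈ l, m ≤ a ∧ a < m + n) ∧ stdLin ℕ (wordBasis l) = fund w := by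
  refine ⟨(permWord w).map (m + ·), ?_, ?_, ?_⟩
  · refine List.Nodup.map (fun a b h => Nat.add_left_cancel h) ?_
    exact List.nodup_ofFn.2 (Fin.val_injective.comp w.injective)
  · intro a ha
    obtain ⟨b, hb, rfl⟩ := List.mem_map.1 ha
    obtain ⟨i, rfl⟩ := (List.mem_ofFn' _ _).1 hb
    exact ⟨Nat.le_add_right _ _, Nat.add_lt_add_left (w i).2 m⟩
  · rw [stdLin_map_of_strictMono _ (fun a b h => Nat.add_lt_add_left h m), stdLin_permWord]

/-- Every axiom is inherited from the shuffle algebra through the surjection `l ↦ F_{std(l)}`. This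
map is multiplicative only on words with letters in increasing order, see `hopfMR_mul_stdLin`; this
is enough, as all `F_w` can be represented by such words. -/
theorem hopfMR_isBialgebra : hopfMR.IsBialgebra := by
  have hΔ : hopfMR.comul ∘ₗ stdLin ℕ =
      TensorProduct.map (stdLin ℕ) (stdLin ℕ) ∘ₗ (hopfWord ℕ).comul :=
    LinearMap.ext hopfMR_comul_stdLin
  have hε : hopfMR.counit ∘ₗ stdLin ℕ = (hopfWord ℕ).counit := LinearMap.ext hopfMR_counit_stdLin
  refine ⟨?_, ?_, ?_, ?_, ?_, ?_, ?_, ?_, ?_, ?_⟩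
  · have key : ∀ {m n p : ℕ} (u : Equiv.Perm (Fin m)) (v : Equiv.Perm (Fin n))
        (w : Equiv.Perm (Fin p)), hopfMR.mul (hopfMR.mul (fund u) (fund v)) (fund w) =
          hopfMR.mul (fund u) (hopfMR.mul (fund v) (fund w)) := by
      intro m n p u v w
      obtain ⟨x, hx, hx', ex⟩ := exists_stdLin_eq u 0
      obtain ⟨y, hy, hy', ey⟩ := exists_stdLin_eq v m
      obtain ⟨z, hz, hz', ez⟩ := exists_stdLin_eq w (m + n)
      have hxy : ∀ a ∈ x, ∀ b ∈ y, a < b := fun a ha b hb => by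
        have := hx' a ha; have := hy' b hb; omega
      have hyz : ∀ a ∈ y, ∀ b ∈ z, a < b := fun a ha b hb => by
        have := hy' a ha; have := hz' b hb; omega
      have hxz : ∀ a ∈ x, ∀ b ∈ z, a < b := fun a ha b hb => by
        have := hx' a ha; have := hz' b hb; omega
      have e1 : hopfMR.mul (stdLin ℕ ((hopfWord ℕ).mul (wordBasis x) (wordBasis y)))
          (stdLin ℕ (wordBasis z)) = stdLin ℕ ((hopfWord ℕ).mul
            ((hopfWord ℕ).mul (wordBasis x) (wordBasis y)) (wordBasis z)) := by
        have aux : ∀ L : List (List ℕ), (∀ l ∈ L, l.Perm (x ++ y)) →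
            hopfMR.mul (stdLin ℕ (L.map wordBasis).sum) (stdLin ℕ (wordBasis z)) =
            stdLin ℕ ((hopfWord ℕ).mul (L.map wordBasis).sum (wordBasis z)) := by
          intro L hL
          induction L with
          | nil => simp
          | cons l L ih =>
            have hl := hL l List.mem_cons_self
            simp only [List.map_cons, List.sum_cons, map_add, LinearMap.add_apply]
            rw [ih fun l hl => hL l (List.mem_cons_of_mem _ hl), hopfMR_mul_stdLin _ hz]
            · intro a ha b hb
              rcases List.mem_append.1 (hl.mem_iff.1 ha) with h | h
              · exact hxz a h b hb
              · exact hyz a h b hb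
            · rw [hl.nodup_iff, List.nodup_append']
              exact ⟨hx, hy, fun a h1 h2 => lt_irrefl _ (hxy a h1 a h2)⟩
        rw [hopfWord_mul_basis]
        exact aux _ fun l hl => perm_of_mem_shuffles hl
      have e2 : hopfMR.mul (stdLin ℕ (wordBasis x))
          (stdLin ℕ ((hopfWord ℕ).mul (wordBasis y) (wordBasis z))) = stdLin ℕ ((hopfWord ℕ).mul
            (wordBasis x) ((hopfWord ℕ).mul (wordBasis y) (wordBasis z))) := by
        have aux : ∀ L : List (List ℕ), (∀ l ∈ L, l.Perm (y ++ z)) →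
            hopfMR.mul (stdLin ℕ (wordBasis x)) (stdLin ℕ (L.map wordBasis).sum) =
            stdLin ℕ ((hopfWord ℕ).mul (wordBasis x) (L.map wordBasis).sum) := by
          intro L hL
          induction L with
          | nil => simp
          | cons l L ih =>
            have hl := hL l List.mem_cons_self
            simp only [List.map_cons, List.sum_cons, map_add]
            rw [ih fun l hl => hL l (List.mem_cons_of_mem _ hl), hopfMR_mul_stdLin hx]
            · rw [hl.nodup_iff, List.nodup_append']
              exact ⟨hy, hz, fun a h1 h2 => lt_irrefl _ (hyz a h1 a h2)⟩
            · intro a ha b hb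
              rcases List.mem_append.1 (hl.mem_iff.1 hb) with h | h
              · exact hxy a ha b h
              · exact hxz a ha b h
        rw [hopfWord_mul_basis]
        exact aux _ fun l hl => perm_of_mem_shuffles hl
      rw [← ex, ← ey, ← ez, hopfMR_mul_stdLin hx hy hxy, hopfMR_mul_stdLin hy hz hyz, e1, e2,
        hopfWord_mul_assoc_basis]
    intro x y z
    induction x using MR_induction with
    | zero => simp
    | add a b ha hb => simp only [map_add, LinearMap.add_apply, ha, hb]
    | smul r a ha => simp only [map_smul, LinearMap.smul_apply, ha]
    | basis u =>
      induction y using MR_induction with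
      | zero => simp
      | add a b ha hb => simp only [map_add, LinearMap.add_apply, ha, hb]
      | smul r a ha => simp only [map_smul, LinearMap.smul_apply, ha]
      | basis v =>
        induction z using MR_induction with
        | zero => simp
        | add a b ha hb => simp only [map_add, ha, hb]
        | smul r a ha => simp only [map_smul, ha]
        | basis w => exact key u v w
  · intro x
    induction x using MR_induction with
    | zero => simp
    | add a b ha hb => simp only [map_add, ha, hb]
    | smul r a ha => simp only [map_smul, ha]
    | basis u =>
      obtain ⟨x, hx, -, ex⟩ := exists_stdLin_eq u 0
      rw [← ex, ← stdLin_nil (α := ℕ), hopfMR_mul_stdLin List.nodup_nil hx (by simp),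
        hopfWord_one_mul]
  · intro x
    induction x using MR_induction with
    | zero => simp
    | add a b ha hb => simp only [map_add, LinearMap.add_apply, ha, hb]
    | smul r a ha => simp only [map_smul, LinearMap.smul_apply, ha]
    | basis u =>
      obtain ⟨x, hx, -, ex⟩ := exists_stdLin_eq u 0
      rw [← ex, ← stdLin_nil (α := ℕ), hopfMR_mul_stdLin hx List.nodup_nil (by simp),
        hopfWord_mul_one]
  · refine LinearMap.ext fun x => ?_
    obtain ⟨x, rfl⟩ := stdLin_surjective x
    have key := LinearMap.congr_fun (hopfWord_coassoc (α := ℕ)) x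
    simp only [LinearMap.comp_apply, LinearEquiv.coe_coe] at key ⊢
    rw [hopfMR_comul_stdLin]
    have e1 : ∀ t : WordSpace ℕ ⊗[ℂ] WordSpace ℕ,
        hopfMR.comul.lTensor MR (TensorProduct.map (stdLin ℕ) (stdLin ℕ) t) =
        TensorProduct.map (stdLin ℕ) (TensorProduct.map (stdLin ℕ) (stdLin ℕ))
          ((hopfWord ℕ).comul.lTensor _ t) := fun t => by
      induction t with
      | zero => simp
      | add a b ha hb => simp only [map_add, ha, hb]
      | tmul a b => simp [hopfMR_comul_stdLin]
    have e2 : ∀ t : WordSpace ℕ ⊗[ℂ] WordSpace ℕ, TensorProduct.assoc ℂ MR MR MR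
          (hopfMR.comul.rTensor MR (TensorProduct.map (stdLin ℕ) (stdLin ℕ) t)) =
        TensorProduct.map (stdLin ℕ) (TensorProduct.map (stdLin ℕ) (stdLin ℕ))
          (TensorProduct.assoc ℂ _ _ _ ((hopfWord ℕ).comul.rTensor _ t)) := fun t => by
      induction t with
      | zero => simp
      | add a b ha hb => simp only [map_add, ha, hb]
      | tmul a b =>
        simp only [TensorProduct.map_tmul, LinearMap.rTensor_tmul, hopfMR_comul_stdLin]
        generalize (hopfWord ℕ).comul a = s
        induction s with
        | zero => simp
        | add a b ha hb => simp only [TensorProduct.add_tmul, map_add, ha, hb]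
        | tmul c d => simp
    rw [e1, e2, key]
  · refine LinearMap.ext fun x => ?_
    obtain ⟨x, rfl⟩ := stdLin_surjective x
    have key := LinearMap.congr_fun (hopfWord_rTensor_counit_comul (α := ℕ)) x
    simp only [LinearMap.comp_apply] at key ⊢
    rw [hopfMR_comul_stdLin, ← LinearMap.comp_apply, LinearMap.rTensor_comp_map, hε,
      ← LinearMap.lTensor_comp_rTensor, LinearMap.comp_apply, key]
    simp
  · refine LinearMap.ext fun x => ?_
    obtain ⟨x, rfl⟩ := stdLin_surjective x
    have key := LinearMap.congr_fun (hopfWord_lTensor_counit_comul (α := ℕ)) x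
    simp only [LinearMap.comp_apply] at key ⊢
    rw [hopfMR_comul_stdLin, ← LinearMap.comp_apply, LinearMap.lTensor_comp_map, hε,
      ← LinearMap.rTensor_comp_lTensor, LinearMap.comp_apply, key]
    simp
  · rw [← stdLin_nil (α := ℕ), hopfMR_counit_stdLin, hopfWord_counit_basis]
    simp
  · intro x y
    induction x using MR_induction with
    | zero => simp
    | add a b ha hb => simp only [map_add, LinearMap.add_apply, ha, hb, add_mul]
    | smul r a ha => simp only [map_smul, LinearMap.smul_apply, ha, smul_eq_mul, mul_assoc]
    | @basis m u =>
      induction y using MR_induction with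
      | zero => simp
      | add a b ha hb => simp only [map_add, ha, hb, mul_add]
      | smul r a ha => simp only [map_smul, ha, smul_eq_mul, mul_left_comm]
      | basis v =>
        obtain ⟨x, hx, hx', ex⟩ := exists_stdLin_eq u 0
        obtain ⟨y, hy, hy', ey⟩ := exists_stdLin_eq v m
        have hxy : ∀ a ∈ x, ∀ b ∈ y, a < b := fun a ha b hb => by
          have := hx' a ha; have := hy' b hb; omega
        rw [← ex, ← ey, hopfMR_mul_stdLin hx hy hxy, hopfMR_counit_stdLin, hopfMR_counit_stdLin,
          hopfMR_counit_stdLin, hopfWord_counit_mul_basis]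
  · rw [← stdLin_nil (α := ℕ), hopfMR_comul_stdLin, hopfWord_comul_one, TensorProduct.map_tmul]
  · intro x y
    induction x using MR_induction with
    | zero => simp
    | add a b ha hb => simp only [map_add, LinearMap.add_apply, ha, hb, TensorProduct.add_tmul]
    | smul r a ha => simp only [map_smul, LinearMap.smul_apply, ha, ← TensorProduct.smul_tmul']
    | @basis m u =>
      induction y using MR_induction with
      | zero => simp
      | add a b ha hb => simp only [map_add, ha, hb, TensorProduct.tmul_add]
      | smul r a ha => simp only [map_smul, ha, TensorProduct.tmul_smul]
      | basis v =>
        obtain ⟨x, hx, hx', ex⟩ := exists_stdLin_eq u 0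
        obtain ⟨y, hy, hy', ey⟩ := exists_stdLin_eq v m
        have hxy : ∀ a ∈ x, ∀ b ∈ y, a < b := fun a ha b hb => by
          have := hx' a ha; have := hy' b hb; omega
        rw [← ex, ← ey, hopfMR_mul_stdLin hx hy hxy, hopfMR_comul_stdLin, hopfMR_comul_stdLin,
          hopfMR_comul_stdLin, hopfWord_comul_mul_basis, hopfWord_comul_basis,
          hopfWord_comul_basis]
        simp only [map_sum, TensorProduct.sum_tmul, TensorProduct.tmul_sum,
          HopfData.mulTensor_tmul, TensorProduct.map_tmul]
        refine Finset.sum_congr rfl fun i _ => Finset.sum_congr rfl fun j _ => ?_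
        rw [hopfMR_mul_stdLin (hx.sublist (List.take_sublist _ _))
            (hy.sublist (List.take_sublist _ _)) fun a ha b hb =>
              hxy a (List.mem_of_mem_take ha) b (List.mem_of_mem_take hb),
          hopfMR_mul_stdLin (hx.sublist (List.drop_sublist _ _))
            (hy.sublist (List.drop_sublist _ _)) fun a ha b hb =>
              hxy a (List.mem_of_mem_drop ha) b (List.mem_of_mem_drop hb)]

theorem hopfMR_isHopfAlgebra : hopfMR.IsHopfAlgebra := by
  refine hopfMR_isBialgebra.isHopfAlgebra_of_graded
    (fun n => Set.range fun w : Equiv.Perm (Fin n) => fund w) ?_ ?_ ?_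
  · rw [eq_top_iff]
    intro x _
    induction x using MR_induction with
    | zero => exact zero_mem _
    | add x y hx hy => exact add_mem (hx trivial) (hy trivial)
    | smul r x hx => exact Submodule.smul_mem _ r (hx trivial)
    | @basis n w => exact Submodule.subset_span (Set.mem_iUnion.2 ⟨n, w, rfl⟩)
  · rintro _ ⟨w, rfl⟩
    refine Submodule.subset_span ?_
    exact congrArg fund (Subsingleton.elim _ _)
  · rintro n _ ⟨w, rfl⟩
    simp only
    rw [hopfMR_comul_fund]
    refine Submodule.sum_mem _ fun k _ => Submodule.subset_span ?_
    exact ⟨k, n - k, _, _, by omega, ⟨_, rfl⟩, ⟨_, rfl⟩, rfl⟩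

end Standardization

/-! ### Codes of permutations -/

section Code

variable {n : ℕ}

theorem code_eq_card (w : Equiv.Perm (Fin n)) (i : Fin n) :
    code w i = (Finset.univ.filter fun a : Fin n => i < a ∧ w.symm a < w.symm i).card := by
  rw [code]
  refine Finset.card_equiv w fun h => ?_
  simp [and_comm]

theorem add_code_lt (w : Equiv.Perm (Fin n)) (i : Fin n) : (i : ℕ) + code w i < n := by
  have h1 : code w i ≤ (Finset.Ioi i).card := by
    rw [code_eq_card]
    refine Finset.card_le_card fun a ha => ?_
    simp only [Finset.mem_filter] at ha
    exact Finset.mem_Ioi.2 ha.2.1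
  rw [Fin.card_Ioi] at h1
  omega

/-- A permutation is determined by its code: the code at `i` tells how many of the letters larger
than `i`, whose relative order is known by downward induction, precede `i`. -/
theorem code_injective : Function.Injective (code : Equiv.Perm (Fin n) → Fin n → ℕ) := by
  intro w v h
  have key : ∀ d : ℕ, ∀ a b : Fin n, n ≤ a + d → n ≤ b + d →
      (w.symm a < w.symm b ↔ v.symm a < v.symm b) := by
    intro d
    induction d with
    | zero => intro a b ha; omega
    | succ d ih =>
      have hset : ∀ i : Fin n, n ≤ i + (d + 1) →
          (Finset.univ.filter fun a : Fin n => i < a ∧ w.symm a < w.symm i) =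
          Finset.univ.filter fun a : Fin n => i < a ∧ v.symm a < v.symm i := by
        intro i hi
        have hc := congrFun h i
        rw [code_eq_card, code_eq_card] at hc
        by_cases hsub : (Finset.univ.filter fun a : Fin n => i < a ∧ w.symm a < w.symm i) ⊆
            Finset.univ.filter fun a : Fin n => i < a ∧ v.symm a < v.symm i
        · exact Finset.eq_of_subset_of_card_le hsub hc.ge
        · refine (Finset.eq_of_subset_of_card_le ?_ hc.le).symm
          obtain ⟨a, ha, ha'⟩ := Finset.not_subset.1 hsub
          intro b hb
          simp only [Finset.mem_filter, Finset.mem_univ, true_and, not_and] at ha ha' hb ⊢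
          refine ⟨hb.1, ?_⟩
          by_contra hcon
          have h1 : w.symm a < w.symm b := lt_of_lt_of_le ha.2 (not_lt.1 hcon)
          have h2 : v.symm b < v.symm a := lt_of_lt_of_le hb.2 (not_lt.1 (ha' ha.1))
          have hia : (i : ℕ) < a := ha.1
          have hib : (i : ℕ) < b := hb.1
          exact lt_asymm h2 ((ih a b (by omega) (by omega)).1 h1)
      have hlt : ∀ i a : Fin n, n ≤ i + (d + 1) → i < a →
          (w.symm a < w.symm i ↔ v.symm a < v.symm i) := by
        intro i a hi hia
        have := Finset.ext_iff.1 (hset i hi) a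
        simpa [hia] using this
      intro a b ha hb
      rcases lt_trichotomy a b with hab | rfl | hab
      · have h1 := hlt a b ha hab
        have hw : w.symm a ≠ w.symm b := fun he => hab.ne (w.symm.injective he)
        have hv : v.symm a ≠ v.symm b := fun he => hab.ne (v.symm.injective he)
        rw [← not_iff_not, not_lt, not_lt, hw.symm.le_iff_lt, hv.symm.le_iff_lt, h1]
      · simp
      · exact hlt b a hb hab
  have := sort_eq_sort w.symm v.symm fun i j _ => key n j i (by omega) (by omega)
  rwa [sort_perm_val, sort_perm_val, Equiv.symm_symm, Equiv.symm_symm] at this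

end Code

/-! ### Orthogonality and completeness of the supercharacters -/

section SuperCharacters

variable {F : Type*} [Field F] {n : ℕ}

open scoped Classical in
theorem superChar_apply (w : Equiv.Perm (Fin n)) (u : ut F n) :
    (superChar F w).1 u = if u.1 ∈ pattern F (utwPlusPos w) then
      ((Nat.card (ut F n) : ℂ) / (Nat.card (pattern F (utwPlusPos w)) : ℂ)) *
        ∏ p : Fin n × Fin n, (if utwPlusPos w p.1 p.2 ∧ ¬ utwPos w p.1 p.2
          then regSubOneAdd F (u.1 p.1 p.2) else 1) else 0 := by
  simp only [superChar, indInf, patternInd, LinearMap.comp_apply, LinearMap.pi_apply]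
  split_ifs with h
  · simp [patternInf, LinearMap.funLeft_apply, Fintype.prod_prod_type]
  · rfl

/-- The elementary matrix with entry `x` in position `(i, j)`, where `i < j`. -/
def utSingle {i j : Fin n} (hij : i < j) (x : F) : ut F n :=
  ⟨Matrix.single i j x, fun a b hab => by
    rw [Matrix.single_apply_of_ne]
    rintro ⟨rfl, rfl⟩
    exact hab hij⟩

theorem mem_pattern_add_utSingle {P : Fin n → Fin n → Prop} {i j : Fin n} (hij : i < j)
    (hP : P i j) (u : ut F n) (x : F) :
    (u + utSingle hij x).1 ∈ pattern F P ↔ u.1 ∈ pattern F P := by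
  have hs : (utSingle hij x).1 ∈ pattern F P := fun a b hab => by
    change Matrix.single i j x a b = 0
    rw [Matrix.single_apply_of_ne]
    rintro ⟨rfl, rfl⟩
    exact hab hP
  exact (pattern F P).add_mem_cancel_right hs

theorem add_utSingle_apply_ne {i j : Fin n} (hij : i < j) (u : ut F n) (x : F) {a b : Fin n}
    (h : (a, b) ≠ (i, j)) : (u + utSingle hij x).1 a b = u.1 a b := by
  change u.1 a b + Matrix.single i j x a b = _
  rw [Matrix.single_apply_of_ne, add_zero]
  rintro ⟨rfl, rfl⟩
  exact h rfl

theorem add_utSingle_apply {i j : Fin n} (hij : i < j) (u : ut F n) (x : F) :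
    (u + utSingle hij x).1 i j = u.1 i j + x := by
  change u.1 i j + Matrix.single i j x i j = _
  rw [Matrix.single_apply_same]

/-- `χ^w` does not depend on the entries in the positions of `ut_w`. -/
theorem superChar_add_utSingle (w : Equiv.Perm (Fin n)) {i j : Fin n} (hij : i < j)
    (hw : utwPos w i j) (u : ut F n) (x : F) :
    (superChar F w).1 (u + utSingle hij x) = (superChar F w).1 u := by
  classical
  have hplus : utwPlusPos w i j := ⟨hw.1, by have := hw.2; omega⟩
  rw [superChar_apply, superChar_apply, mem_pattern_add_utSingle hij hplus]
  congr 2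
  refine Finset.prod_congr rfl fun p _ => ?_
  split_ifs with hp
  · rw [add_utSingle_apply_ne]
    rintro ⟨⟩
    exact hp.2 hw
  · rfl

theorem sum_regSubOneAdd [Fintype F] (y : F) : ∑ x : F, regSubOneAdd F (y + x) = 0 := by
  classical
  have h := Fintype.sum_equiv (Equiv.addLeft y) (fun x => regSubOneAdd F (y + x)) (regSubOneAdd F)
    fun x => rfl
  rw [h]
  simp [regSubOneAdd, Finset.sum_sub_distrib]

/-- `χ^w` has mean zero in each position of `ut_w^+` outside `ut_w`. -/
theorem sum_superChar_add_utSingle [Fintype F] (w : Equiv.Perm (Fin n)) {i j : Fin n} (hij : i < j)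
    (hplus : utwPlusPos w i j) (hw : ¬ utwPos w i j) (u : ut F n) :
    ∑ x : F, (superChar F w).1 (u + utSingle hij x) = 0 := by
  classical
  simp only [superChar_apply, mem_pattern_add_utSingle hij hplus]
  split_ifs with h
  · have hp : ∀ x : F, (∏ p : Fin n × Fin n, (if utwPlusPos w p.1 p.2 ∧ ¬ utwPos w p.1 p.2
          then regSubOneAdd F ((u + utSingle hij x).1 p.1 p.2) else 1)) =
        regSubOneAdd F (u.1 i j + x) * ∏ p ∈ Finset.univ.erase (i, j),
          (if utwPlusPos w p.1 p.2 ∧ ¬ utwPos w p.1 p.2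
            then regSubOneAdd F (u.1 p.1 p.2) else 1) := by
      intro x
      rw [← Finset.mul_prod_erase _ _ (Finset.mem_univ (i, j)), if_pos ⟨hplus, hw⟩,
        add_utSingle_apply]
      congr 1
      refine Finset.prod_congr rfl fun p hp => ?_
      rw [add_utSingle_apply_ne _ _ _ (Finset.ne_of_mem_erase hp)]
    simp only [hp]
    rw [← Finset.mul_sum, ← Finset.sum_mul, sum_regSubOneAdd]
    simp
  · simp

/-- If `f` sums to zero along the translates by `φ` and `g` is constant along them, then `f` and `g`
are orthogonal. -/
theorem sum_mul_eq_zero {A X : Type*} [AddGroup A] [Fintype A] [Fintype X] [Nonempty X]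
    (φ : X → A) (f g : A → ℂ)
    (hf : ∀ u, ∑ x, f (u + φ x) = 0) (hg : ∀ u x, g (u + φ x) = g u) : ∑ u, f u * g u = 0 := by
  have h1 : ∀ x, ∑ u, f u * g u = ∑ u, f (u + φ x) * g u := fun x => by
    refine (Fintype.sum_equiv (Equiv.addRight (φ x)) _ _ fun u => ?_).symm
    simp [hg]
  have h2 : (Fintype.card X : ℂ) * ∑ u, f u * g u = 0 := by
    rw [← nsmul_eq_mul, ← Finset.card_univ, ← Finset.sum_const,
      Finset.sum_congr rfl fun x _ => h1 x, Finset.sum_comm]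
    simp [← Finset.sum_mul, hf]
  exact (mul_eq_zero.1 h2).resolve_left (by simp)

theorem utInner_apply [Fintype F] (φ ψ : ut F n → ℂ) [Fintype (ut F n)] :
    utInner φ ψ = (Nat.card (ut F n) : ℂ)⁻¹ * ∑ u : ut F n, starRingEnd ℂ (φ u) * ψ u := by
  simp only [utInner, LinearMap.smul_apply, LinearMap.sum_apply, LinearMap.proj_apply, smul_eq_mul]
  congr!

/-- The codes of `v` and `w` differ in some row `i`; if the code of `v` is smaller there, then the
position of `ut_v^+` in row `i` that is outside `ut_v` belongs to `ut_w`, so that `χ^v` has mean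
zero in this position and `χ^w` does not depend on it. -/
theorem utInner_superChar_ne [Fintype F] {v w : Equiv.Perm (Fin n)} (h : v ≠ w) :
    utInner (superChar F w).1 (superChar F v).1 = 0 := by
  classical
  let _ : Fintype (ut F n) := Fintype.ofFinite _
  obtain ⟨i, hi⟩ : ∃ i, code v i ≠ code w i := by
    by_contra! hcon
    exact h (code_injective (funext hcon))
  have hv := add_code_lt v i
  have hw := add_code_lt w i
  rw [utInner_apply]
  refine mul_eq_zero_of_right _ ?_
  rcases lt_or_gt_of_ne hi with hlt | hlt
  · have hij : i < ⟨i + code v i + 1, by omega⟩ := Fin.lt_def.2 (by simp only; omega)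
    have := sum_mul_eq_zero (utSingle (F := F) hij) (superChar F v).1
      (fun u => starRingEnd ℂ ((superChar F w).1 u))
      (sum_superChar_add_utSingle v hij ⟨hij, by simp; omega⟩ fun hc => by
        have := hc.2; simp only at this; omega)
      (fun u x => by rw [superChar_add_utSingle w hij ⟨hij, by simp; omega⟩])
    rw [← this]
    exact Finset.sum_congr rfl fun u _ => mul_comm _ _
  · have hij : i < ⟨i + code w i + 1, by omega⟩ := Fin.lt_def.2 (by simp only; omega)
    exact sum_mul_eq_zero (utSingle (F := F) hij) (fun u => starRingEnd ℂ ((superChar F w).1 u))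
      (superChar F v).1
      (fun u => by
        rw [← map_sum, sum_superChar_add_utSingle w hij ⟨hij, by simp; omega⟩, map_zero]
        intro hc
        have := hc.2; simp only at this; omega)
      (fun u x => by rw [superChar_add_utSingle v hij ⟨hij, by simp; omega⟩])

theorem superChar_zero_ne [Fintype F] (w : Equiv.Perm (Fin n)) : (superChar F w).1 0 ≠ 0 := by
  classical
  have h0 : (0 : ut F n).1 ∈ pattern F (utwPlusPos w) := zero_mem _
  rw [superChar_apply, if_pos h0]
  refine mul_ne_zero (div_ne_zero ?_ ?_) (Finset.prod_ne_zero_iff.2 fun p _ => ?_)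
  · exact_mod_cast Nat.card_pos.ne'
  · exact_mod_cast Nat.card_pos.ne'
  · split_ifs
    · have h1 : 1 < Nat.card F := Finite.one_lt_card
      have h2 : (Nat.card F : ℂ) ≠ 1 := by exact_mod_cast h1.ne'
      simpa [regSubOneAdd, sub_eq_zero] using h2
    · exact one_ne_zero

theorem utInner_self_ne [Fintype F] (φ : ut F n → ℂ) (h : φ 0 ≠ 0) : utInner φ φ ≠ 0 := by
  classical
  let _ : Fintype (ut F n) := Fintype.ofFinite _
  rw [utInner_apply]
  refine mul_ne_zero (inv_ne_zero (by exact_mod_cast Nat.card_pos.ne')) ?_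
  have e : ∀ u, starRingEnd ℂ (φ u) * φ u = ((Complex.normSq (φ u) : ℝ) : ℂ) := fun u => by
    rw [mul_comm, Complex.mul_conj]
  simp only [e]
  rw [← Complex.ofReal_sum]
  refine Complex.ofReal_ne_zero.2 (ne_of_gt ?_)
  exact Finset.sum_pos' (fun u _ => Complex.normSq_nonneg _)
    ⟨0, Finset.mem_univ _, Complex.normSq_pos.2 h⟩

theorem chDeg_superChar [Fintype F] (w : Equiv.Perm (Fin n)) :
    chDeg F n (superChar F w) = fund w := by
  classical
  rw [chDeg, LinearMap.sum_apply, Finset.sum_eq_single w]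
  · simp [inv_mul_cancel₀ (utInner_self_ne _ (superChar_zero_ne (F := F) w))]
  · intro v _ hv
    simp [utInner_superChar_ne hv.symm]
  · simp

/-- The element of `ut_n` whose row `i` has a single nonzero entry `d i` steps to the right of the
diagonal, or is zero if `d i = 0`. -/
def utRep (F : Type*) [Field F] {n : ℕ} (d : ∀ i : Fin n, Fin (n - i)) : ut F n :=
  ⟨fun i j => if (d i : ℕ) ≠ 0 ∧ (j : ℕ) = i + d i then 1 else 0, fun i j hij => by
    refine if_neg ?_
    rintro ⟨h1, h2⟩
    exact hij (Fin.lt_def.2 (by omega))⟩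

/-- A superclass of `ut_n` is determined by the position of the last nonzero entry of each row. -/
theorem exists_sameSuperclass_utRep (u : ut F n) :
    ∃ d : ∀ i : Fin n, Fin (n - i), SameSuperclass u (utRep F d) := by
  classical
  let e : Fin n → ℕ := fun i => Finset.univ.sup fun j : Fin n =>
    if u.1 i j ≠ 0 then (j : ℕ) - i else 0
  have he : ∀ i j, u.1 i j ≠ 0 → (j : ℕ) - i ≤ e i := fun i j h => by
    have := Finset.le_sup (f := fun j : Fin n => if u.1 i j ≠ 0 then (j : ℕ) - i else 0)
      (Finset.mem_univ j)
    simpa [h, e] using this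
  have he' : ∀ i, e i ≠ 0 → ∃ j, u.1 i j ≠ 0 ∧ (j : ℕ) = i + e i := fun i hi => by
    obtain ⟨j, -, hj⟩ := Finset.exists_mem_eq_sup (Finset.univ : Finset (Fin n))
      ⟨i, Finset.mem_univ _⟩
      (fun j : Fin n => if u.1 i j ≠ 0 then (j : ℕ) - i else 0)
    change e i = _ at hj
    split_ifs at hj with h
    · exact ⟨j, h, by omega⟩
    · exact absurd hj hi
  refine ⟨fun i => ⟨e i, ?_⟩, fun i k => ?_⟩
  · by_cases hi : e i = 0
    · have := i.2; omega
    · obtain ⟨j, -, hj⟩ := he' i hi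
      have := j.2; omega
  · have h1 : (∀ j, k < j → u.1 i j = 0) ↔ (e i = 0 ∨ (i : ℕ) + e i ≤ k) := by
      constructor
      · intro h
        by_contra! hcon
        obtain ⟨j, hj, hj'⟩ := he' i hcon.1
        exact hj (h j (Fin.lt_def.2 (by omega)))
      · intro h j hkj
        by_contra hne
        have h2 := he i j hne
        have h3 : i < j := by
          by_contra hc
          exact hne (u.2 i j hc)
        have h4 : (k : ℕ) < j := hkj
        have h5 : (i : ℕ) < j := h3
        omega
    have h2 : (∀ j, k < j → (utRep F (fun i => ⟨e i, by
        by_cases hi : e i = 0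
        · have := i.2; omega
        · obtain ⟨j, -, hj⟩ := he' i hi
          have := j.2; omega⟩)).1 i j = 0) ↔ (e i = 0 ∨ (i : ℕ) + e i ≤ k) := by
      constructor
      · intro h
        by_contra! hcon
        obtain ⟨j, -, hj'⟩ := he' i hcon.1
        have := h j (Fin.lt_def.2 (by omega))
        simp [utRep, hcon.1, hj'] at this
      · intro h j hkj
        have h4 : (k : ℕ) < j := hkj
        simp only [utRep]
        rw [if_neg]
        rintro ⟨h5, h6⟩
        omega
    rw [h1, h2]

/-- Row `i` (counted from `0`) is zero or has its last nonzero entry in one of `n - 1 - i` positions,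
so there are at most `n!` superclasses. -/
theorem finrank_scfUt_le (F : Type*) [Field F] [Fintype F] (n : ℕ) :
    Module.finrank ℂ (scfUt F n) ≤ n.factorial := by
  let ev : scfUt F n →ₗ[ℂ] ((∀ i : Fin n, Fin (n - i)) → ℂ) :=
    LinearMap.pi fun d => LinearMap.proj (utRep F d) ∘ₗ (scfUt F n).subtype
  have hinj : Function.Injective ev := by
    rw [← LinearMap.ker_eq_bot, LinearMap.ker_eq_bot']
    intro ψ hψ
    ext u
    obtain ⟨d, hd⟩ := exists_sameSuperclass_utRep u
    rw [ψ.2 _ _ hd]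
    exact congrFun hψ d
  have h := LinearMap.finrank_le_finrank_of_injective hinj
  rw [Module.finrank_fintype_fun_eq_card, Fintype.card_pi] at h
  simp only [Fintype.card_fin] at h
  rwa [← Finset.prod_range (fun i => n - i), ← Nat.descFactorial_eq_prod_range,
    Nat.descFactorial_self] at h

theorem span_superChar (F : Type*) [Field F] [Fintype F] (n : ℕ) :
    Submodule.span ℂ (Set.range fun w : Equiv.Perm (Fin n) => superChar F w) = ⊤ := by
  have hli : LinearIndependent ℂ fun w : Equiv.Perm (Fin n) => superChar F w := by
    refine LinearIndependent.of_comp (chDeg F n) ?_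
    have : (chDeg F n ∘ fun w : Equiv.Perm (Fin n) => superChar F w) =
        (fun p : (Σ n : ℕ, Equiv.Perm (Fin n)) => (Finsupp.single p 1 : MR)) ∘ fun w => ⟨n, w⟩ := by
      funext w
      exact chDeg_superChar w
    rw [this]
    exact (Finsupp.linearIndependent_single_one ℂ _).comp _
      (sigma_mk_injective (β := fun n => Equiv.Perm (Fin n)))
  have hfd : FiniteDimensional ℂ (scfUt F n) := inferInstance
  refine hli.span_eq_top_of_card_eq_finrank' (le_antisymm hli.fintype_card_le_finrank ?_)
  rw [Fintype.card_perm, Fintype.card_fin]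
  exact finrank_scfUt_le F n

end SuperCharacters

/-! ### The isomorphism `ch` -/

section Ch

theorem chInv_fund (F : Type*) [Field F] {n : ℕ} (w : Equiv.Perm (Fin n)) :
    chInv F (fund w) = DirectSum.lof ℂ ℕ (fun k => scfUt F k) n (superChar F w) := by
  simp [chInv, fund]

variable (F : Type*) [Field F] [Fintype F]

theorem ch_lof (n : ℕ) (ψ : scfUt F n) :
    ch F (DirectSum.lof ℂ ℕ (fun k => scfUt F k) n ψ) = chDeg F n ψ := by
  rw [ch, DirectSum.toModule_lof]

theorem ch_superChar {n : ℕ} (w : Equiv.Perm (Fin n)) :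
    ch F (DirectSum.lof ℂ ℕ (fun k => scfUt F k) n (superChar F w)) = fund w := by
  rw [ch_lof, chDeg_superChar]

theorem ch_chInv (x : MR) : ch F (chInv F x) = x := by
  induction x using MR_induction with
  | zero => simp
  | add a b ha hb => simp only [map_add, ha, hb]
  | smul r a ha => simp only [map_smul, ha]
  | basis w => rw [chInv_fund, ch_superChar]

theorem chInv_ch (x : ScfUt F) : chInv F (ch F x) = x := by
  have : chInv F ∘ₗ ch F = LinearMap.id := by
    refine DirectSum.linearMap_ext _ fun n => ?_
    refine LinearMap.ext_on (span_superChar F n) ?_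
    rintro _ ⟨w, rfl⟩
    simp only [LinearMap.comp_apply]
    rw [ch_superChar, chInv_fund]
    rfl
  exact LinearMap.congr_fun this x

/-- `ch` as a linear equivalence. -/
def chEquiv : ScfUt F ≃ₗ[ℂ] MR :=
  LinearEquiv.ofLinearMap (ch F) (chInv F) (LinearMap.ext (ch_chInv F)) (LinearMap.ext (chInv_ch F))

theorem ch_respects : (hopfUt F).Respects hopfMR (ch F) where
  map_mul x y := by simp [hopfUt, ch_chInv]
  map_one := by simp [hopfUt, ch_chInv]
  map_comul x := by
    have : ch F ∘ₗ chInv F = LinearMap.id := LinearMap.ext (ch_chInv F)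
    rw [hopfUt, LinearMap.comp_apply, ← LinearMap.comp_apply (TensorProduct.map (ch F) (ch F)),
      ← TensorProduct.map_comp, this]
    simp
  map_counit x := by simp [hopfUt]

theorem hopfUt_isHopfAlgebra : (hopfUt F).IsHopfAlgebra :=
  HopfData.Respects.isHopfAlgebra (chEquiv F) (ch_respects F) hopfMR_isHopfAlgebra

end Ch

/-! ### Deflation of pure tensors -/

section Dn

variable {G : Type*} [Group G] [Fintype G]

/-- The mean value of a function on `G`. -/
def mean (φ : G → ℂ) : ℂ := (Fintype.card G : ℂ)⁻¹ * ∑ g, φ g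

open scoped Classical in
theorem deflation_prod {k : ℕ} (a : Fin k → Prop) (φ : Fin k → G → ℂ) (x : coordSubgroup G a) :
    deflation a (fun h => ∏ j, φ j (h j)) x = ∏ j, if a j then φ j (x.1 j) else mean (φ j) := by
  have hfib : (Finset.univ.filter fun h : Fin k → G => coordProj a h = x) =
      Fintype.piFinset fun j => if a j then {x.1 j} else Finset.univ := by
    ext h
    simp only [Finset.mem_filter, Finset.mem_univ, true_and, Fintype.mem_piFinset]
    rw [Subtype.ext_iff, funext_iff]
    refine forall_congr' fun j => ?_
    by_cases hj : a j
    · simp [coordProj, hj]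
    · have : x.1 j = 1 := by
        by_contra hx
        exact hj (x.2 j hx)
      simp [coordProj, hj, this]
  simp only [deflation, LinearMap.pi_apply, LinearMap.smul_apply, LinearMap.sum_apply,
    LinearMap.proj_apply, smul_eq_mul]
  have hcard : ((Finset.univ.filter fun h : Fin k → G => coordProj a h = x).card : ℂ) =
      ∏ j, if a j then (1 : ℂ) else (Fintype.card G : ℂ) := by
    rw [hfib, Fintype.card_piFinset, Nat.cast_prod]
    refine Finset.prod_congr rfl fun j _ => ?_
    split_ifs <;> simp
  rw [hcard, hfib, ← Finset.prod_univ_sum, ← Finset.prod_inv_distrib, ← Finset.prod_mul_distrib]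
  refine Finset.prod_congr rfl fun j _ => ?_
  split_ifs <;> simp [mean]

open scoped Classical in
/-- `Dn_c[τ, α, β]` of a pure tensor. -/
theorem dn_prod {n : ℕ} (c : Fin n → ℕ) (τ α β : scfOne G) (φ : Fin (n - 1) → G → ℂ)
    (g : coordSubgroup G (lc c)) :
    dn c τ α β (fun h => ∏ j, φ j (h j)) g = ∏ j,
      (if bc c j then φ j (g.1 j) else
        (if lc c j then τ.1 (g.1 j) else 1) *
          (if llc c j then mean (fun x => α.1 x * φ j x) else mean (fun x => β.1 x * φ j x))) := by
  simp only [dn, LinearMap.comp_apply, LinearMap.mulLeft_apply]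
  have e : ((fun h : Fin (n - 1) → G =>
        ∏ j, if bc c j then 1 else if llc c j then α.1 (h j) else β.1 (h j)) *
      fun h => ∏ j, φ j (h j)) = fun h => ∏ j, (fun x => (if bc c j then 1 else
        if llc c j then α.1 x else β.1 x) * φ j x) (h j) := by
    funext h
    simp only [Pi.mul_apply, ← Finset.prod_mul_distrib]
  rw [e, Pi.mul_apply, inflation, LinearMap.funLeft_apply,
    deflation_prod (bc c) fun j x => (if bc c j then 1 else
        if llc c j then α.1 x else β.1 x) * φ j x, ← Finset.prod_mul_distrib]
  refine Finset.prod_congr rfl fun j _ => ?_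
  by_cases hb : bc c j
  · simp [hb, coordProj]
  · by_cases hl : llc c j <;> simp [hb, hl]

end Dn

section Means

variable {G : Type*} [Fintype G]

theorem mean_one [Nonempty G] : mean (fun _ : G => 1) = 1 := by
  simp [mean]

theorem mean_sub (φ ψ : G → ℂ) : mean (fun x => φ x - ψ x) = mean φ - mean ψ := by
  simp [mean, Finset.sum_sub_distrib, mul_sub]

theorem mean_mul_left (r : ℂ) (φ : G → ℂ) : mean (fun x => r * φ x) = r * mean φ := by
  simp [mean, ← Finset.mul_sum, mul_left_comm]

theorem card_sub_one_ne [Nontrivial G] : (Nat.card G : ℂ) - 1 ≠ 0 := by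
  have h1 : 1 < Nat.card G := Finite.one_lt_card
  rw [sub_ne_zero]
  exact_mod_cast h1.ne'

theorem regChar_apply {G : Type*} [Group G] (g : G) [Decidable (g = 1)] :
    (regChar G).1 g = if g = 1 then (Nat.card G : ℂ) else 0 := by
  simp only [regChar]; congr

variable [Group G]

theorem mean_reg_mul (φ : G → ℂ) : mean (fun x => (regChar G).1 x * φ x) = φ 1 := by
  classical
  simp [mean, regChar_apply]

theorem mean_reg : mean (regChar G).1 = 1 := by
  simpa using mean_reg_mul (fun _ : G => 1)

theorem mean_dual : mean (regSubOneDual G).1 = 0 := by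
  have : (regSubOneDual G).1 = fun x => ((Nat.card G : ℂ) - 1)⁻¹ * ((regChar G).1 x - 1) := rfl
  rw [this, mean_mul_left, mean_sub, mean_reg, mean_one, sub_self, mul_zero]

theorem mean_dual_mul_reg [Nontrivial G] :
    mean (fun x => (regSubOneDual G).1 x * (regChar G).1 x) = 1 := by
  classical
  have : (fun x => (regSubOneDual G).1 x * (regChar G).1 x) =
      fun x => (regChar G).1 x * (((Nat.card G : ℂ) - 1)⁻¹ * ((regChar G).1 x - 1)) := by
    funext x
    rw [mul_comm]; rfl
  rw [this, mean_reg_mul, regChar_apply, if_pos rfl, inv_mul_cancel₀ card_sub_one_ne]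

end Means

/-! ### The basis of products of regular characters -/

section RegTensor

open scoped Classical in
/-- The tensor product in `scf(G^k)` with factor `reg` in the coordinates (counted from `0`) in the
set `T` and factor `1` in the others. The set `T` may contain numbers `≥ k`, which are ignored, so
that elements of different degrees can be compared without casts. -/
def regTensor (G : Type*) [Group G] (k : ℕ) (T : ℕ → Prop) : scf G k :=
  ⟨fun g => ∏ j : Fin k, if T j then (regChar G).1 (g j) else 1,
    fun _ _ hgh => Finset.prod_congr rfl fun j _ => by
      split_ifs
      · exact scfOne_apply_eq _ (hgh j)
      · rfl⟩

/-- `regTensor`, as a homogeneous element of degree `n` of `scf(G^•)`. -/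
def regTensorAt (G : Type*) [Group G] (n : ℕ) (T : ℕ → Prop) : ScfG G :=
  DirectSum.lof ℂ ℕ (fun k => scf G (k - 1)) n (regTensor G (n - 1) T)

variable {G : Type*} [Group G]

theorem regTensor_apply {k : ℕ} (T : ℕ → Prop) [DecidablePred T] (g : Fin k → G) :
    (regTensor G k T).1 g = ∏ j : Fin k, if T j then (regChar G).1 (g j) else 1 := by
  simp only [regTensor]; congr!

theorem regTensor_congr {k : ℕ} {S T : ℕ → Prop} (h : ∀ j < k, (S j ↔ T j)) :
    regTensor G k S = regTensor G k T := by
  classical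
  refine Subtype.ext (funext fun g => ?_)
  rw [regTensor_apply, regTensor_apply]
  refine Finset.prod_congr rfl fun j _ => ?_
  exact if_congr (h j j.2) rfl rfl

theorem regTensorAt_congr {m n : ℕ} {S T : ℕ → Prop} (hmn : m = n)
    (h : ∀ j, j + 1 < n → (S j ↔ T j)) : regTensorAt G m S = regTensorAt G n T := by
  subst hmn
  rw [regTensorAt, regTensorAt, regTensor_congr fun j hj => h j (by omega)]

theorem scf_eq_sum_classIndicator [Nontrivial G] {k : ℕ} (ψ : scf G k) :
    ψ = ∑ S : Finset (Fin k), ψ.1 (classRep G S) • classIndicator G S := by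
  classical
  refine Subtype.ext (funext fun g => ?_)
  have hrep : ∀ (S : Finset (Fin k)) j, classRep G S j ≠ 1 ↔ j ∈ S := fun S j => by
    by_cases h : j ∈ S
    · simp [classRep, h, Classical.choose_spec (exists_ne (1 : G))]
    · simp [classRep, h]
  have : (∑ S : Finset (Fin k), ψ.1 (classRep G S) • classIndicator G S).1 g =
      ∑ S : Finset (Fin k), ψ.1 (classRep G S) * (classIndicator G S).1 g := by
    simp [Finset.sum_apply]
  rw [this, Finset.sum_eq_single (Finset.univ.filter fun j => g j ≠ 1)]
  · have h1 : (classIndicator G (Finset.univ.filter fun j => g j ≠ 1)).1 g = 1 :=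
      if_pos fun j => by simp
    rw [h1, mul_one]
    refine ψ.2 _ _ fun j => ?_
    rw [← not_iff_not, ← ne_eq, ← ne_eq, hrep]
    simp
  · intro S _ hS
    have h1 : (classIndicator G S).1 g = 0 := if_neg fun h => hS (by ext j; simp [← h j])
    rw [h1, mul_zero]
  · simp

/-- The tensors with factors `reg` and `1` span `scf(G^k)`, since the superclass identifier
functions are combinations of them. -/
theorem span_regTensor [Fintype G] [Nontrivial G] (k : ℕ) :
    Submodule.span ℂ (Set.range fun T : ℕ → Prop => regTensor G k T) = ⊤ := by
  classical
  rw [eq_top_iff]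
  rintro ψ -
  rw [scf_eq_sum_classIndicator ψ]
  refine Submodule.sum_mem _ fun S _ => Submodule.smul_mem _ _ ?_
  have hc : (Nat.card G : ℂ) ≠ 0 := by exact_mod_cast Nat.card_pos.ne'
  -- In each coordinate the indicators of `{1}` and `G - {1}` are `reg / |G|` and `1 - reg / |G|`.
  have e : classIndicator G S = ∑ t ∈ S.powerset,
      ((-1) ^ t.card * ((Nat.card G : ℂ)⁻¹) ^ (t.card + (k - S.card))) •
        regTensor G k (fun j => ∃ h : j < k, (⟨j, h⟩ : Fin k) ∈ t ∪ Sᶜ) := by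
    refine Subtype.ext (funext fun g => ?_)
    have h1 : (classIndicator G S).1 g =
        ∏ j, if j ∈ S then 1 + -((Nat.card G : ℂ)⁻¹ * (regChar G).1 (g j))
          else (Nat.card G : ℂ)⁻¹ * (regChar G).1 (g j) := by
      by_cases h : ∀ j, g j ≠ 1 ↔ j ∈ S
      · refine (if_pos h).trans (Finset.prod_eq_one fun j _ => ?_).symm
        by_cases hj : j ∈ S
        · simp [hj, regChar_apply, (h j).2 hj]
        · have : g j = 1 := by
            by_contra hcon
            exact hj ((h j).1 hcon)
          simp [hj, regChar_apply, this]
      · refine (if_neg h).trans ?_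
        push Not at h
        obtain ⟨j, hj⟩ := h
        refine (Finset.prod_eq_zero (Finset.mem_univ j) ?_).symm
        rcases hj with ⟨h1, h2⟩ | ⟨h1, h2⟩
        · simp [h2, regChar_apply, h1]
        · simp [h2, regChar_apply, h1]
    have h2 : (∑ t ∈ S.powerset, ((-1) ^ t.card * ((Nat.card G : ℂ)⁻¹) ^ (t.card + (k - S.card))) •
        regTensor G k (fun j => ∃ h : j < k, (⟨j, h⟩ : Fin k) ∈ t ∪ Sᶜ)).1 g =
        ∑ t ∈ S.powerset, ((-1) ^ t.card * ((Nat.card G : ℂ)⁻¹) ^ (t.card + (k - S.card))) *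
        (regTensor G k (fun j => ∃ h : j < k, (⟨j, h⟩ : Fin k) ∈ t ∪ Sᶜ)).1 g := by
      simp [Finset.sum_apply]
    rw [h1, h2, Finset.prod_ite, Finset.filter_mem_eq_inter, Finset.univ_inter, Finset.prod_one_add,
      Finset.sum_mul]
    refine Finset.sum_congr rfl fun t ht => ?_
    have h3 : (Finset.univ.filter fun j => j ∉ S) = Sᶜ := by ext; simp
    have h4 : (regTensor G k (fun j => ∃ h : j < k, (⟨j, h⟩ : Fin k) ∈ t ∪ Sᶜ)).1 g =
        ∏ j ∈ t ∪ Sᶜ, (regChar G).1 (g j) := by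
      rw [regTensor_apply, ← Finset.prod_subset (Finset.subset_univ (t ∪ Sᶜ)) (f := fun j : Fin k =>
        if (∃ h : (j : ℕ) < k, (⟨j, h⟩ : Fin k) ∈ t ∪ Sᶜ) then (regChar G).1 (g j) else 1)]
      · refine Finset.prod_congr rfl fun j hj => ?_
        rw [if_pos ⟨j.2, hj⟩]
      · intro j _ hj
        rw [if_neg]
        rintro ⟨_, h⟩
        exact hj h
    have hd : Disjoint t Sᶜ :=
      disjoint_compl_right.mono_left (Finset.mem_powerset.1 ht)
    rw [h3, h4, Finset.prod_union hd, Finset.prod_neg, Finset.prod_mul_distrib,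
      Finset.prod_mul_distrib, Finset.prod_const, Finset.prod_const, Finset.card_compl,
      Fintype.card_fin, pow_add]
    ring
  rw [e]
  exact Submodule.sum_mem _ fun t _ => Submodule.smul_mem _ _ (Submodule.subset_span ⟨_, rfl⟩)

theorem scfG_induction [Fintype G] [Nontrivial G] {motive : ScfG G → Prop} (x : ScfG G)
    (zero : motive 0) (add : ∀ x y, motive x → motive y → motive (x + y))
    (smul : ∀ (r : ℂ) x, motive x → motive (r • x))
    (basis : ∀ n T, motive (regTensorAt G n T)) : motive x := by
  induction x using DirectSum.induction_on with
  | zero => exact zero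
  | add x y hx hy => exact add x y hx hy
  | of n ψ =>
    have hψ : ψ ∈ Submodule.span ℂ (Set.range fun T : ℕ → Prop => regTensor G (n - 1) T) :=
      span_regTensor (G := G) (n - 1) ▸ Submodule.mem_top
    change motive (DirectSum.lof ℂ ℕ (fun k => scf G (k - 1)) n ψ)
    induction hψ using Submodule.span_induction with
    | mem x hx =>
      obtain ⟨T, rfl⟩ := hx
      exact basis n T
    | zero => rw [map_zero]; exact zero
    | add a b _ _ ha hb => rw [map_add]; exact add _ _ ha hb
    | smul r a _ ha => rw [map_smul]; exact smul r _ ha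

end RegTensor

/-! ### The composite of `ch` and `twst` on tensors -/

section Psi

variable {G : Type*} [Group G] [Fintype G] (F : Type*) [Field F]

theorem lo_lt_hi {n : ℕ} (j : Fin (n - 1)) : lo j < hi j := Fin.lt_def.2 (Nat.lt_succ_self _)

theorem not_bc_permBlocks {n : ℕ} (w : Equiv.Perm (Fin n)) (j : Fin (n - 1)) :
    ¬ bc (permBlocks w) j := fun h =>
  (lo_lt_hi j).ne' (w.symm.injective (Fin.ext h))

theorem not_lc_permBlocks {n : ℕ} (w : Equiv.Perm (Fin n)) (j : Fin (n - 1)) :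
    ¬ lc (permBlocks w) j := fun ⟨_, h1, h2⟩ =>
  h1.ne' (w.symm.injective (Fin.ext h2))

open scoped Classical in
/-- On a pure tensor, `Dn_w̃` takes the mean of each factor, weighted by `(reg - 1)^*` at the
descents of `w⁻¹`. -/
theorem infDn_prod {n : ℕ} (w : Equiv.Perm (Fin n)) (φ : Fin (n - 1) → G → ℂ)
    (ψ : scf G (n - 1)) (hψ : ψ.1 = fun h => ∏ j, φ j (h j)) :
    infDn G F w ψ = fun _ => ∏ j, if w.symm (lo j) < w.symm (hi j) then mean (φ j) else
      mean (fun x => (regSubOneDual G).1 x * φ j x) := by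
  funext u
  simp only [infDn, LinearMap.comp_apply, LinearMap.funLeft_apply, Submodule.subtype_apply, hψ]
  rw [dn_prod]
  refine Finset.prod_congr rfl fun j _ => ?_
  rw [if_neg (not_bc_permBlocks w j), if_neg (not_lc_permBlocks w j), one_mul]
  have hiff : llc (permBlocks w) j ↔ w.symm (lo j) < w.symm (hi j) := by
    have hne : w.symm (lo j) ≠ w.symm (hi j) := fun h => (lo_lt_hi j).ne (w.symm.injective h)
    exact hne.le_iff_lt
  by_cases h : w.symm (lo j) < w.symm (hi j)
  · rw [if_pos h, if_pos (hiff.2 h)]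
    simp [trivialChar]
  · rw [if_neg h, if_neg fun h' => h (hiff.1 h')]

variable [Fintype F]

open scoped Classical in
theorem ch_twst_prod {n : ℕ} (φ : Fin (n - 1) → G → ℂ)
    (ψ : scf G (n - 1)) (hψ : ψ.1 = fun h => ∏ j, φ j (h j)) :
    ch F (twst G F (DirectSum.lof ℂ ℕ (fun k => scf G (k - 1)) n ψ)) =
      ∑ w : Equiv.Perm (Fin n), (∏ j, if w.symm (lo j) < w.symm (hi j) then mean (φ j) else
        mean (fun x => (regSubOneDual G).1 x * φ j x)) • fund w := by
  rw [twst, DirectSum.toModule_lof, LinearMap.comp_apply, ch_lof, twstDeg, LinearMap.sum_apply,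
    map_sum]
  refine Finset.sum_congr rfl fun w _ => ?_
  rw [← chDeg_superChar (F := F), ← map_smul]
  congr 1
  refine Subtype.ext ?_
  have h1 : ∀ r : ℂ, indInf (F := F) w (fun _ => r) = r • (superChar F w).1 := fun r => by
    rw [superChar, ← map_smul]
    congr 1
    funext
    simp
  change indInf w (infDn G F w ψ) = _ • (superChar F w).1
  rw [infDn_prod F w φ ψ hψ, h1]

variable [Nontrivial G]

/-- All descents of `w⁻¹` (counted from `0`) lie in `T`. -/
def DescentsIn {n : ℕ} (T : ℕ → Prop) (w : Equiv.Perm (Fin n)) : Prop :=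
  ∀ j : Fin (n - 1), ¬ T j → w.symm (lo j) < w.symm (hi j)

open scoped Classical in
/-- The pairings of `1` and of `(reg - 1)^*` with the factor `reg` are `1`; with the factor `1` they
are `1` and `0`. So the factors `1` forbid descents of `w⁻¹`, and the factors `reg` impose nothing.
-/
theorem ch_twst_regTensorAt (n : ℕ) (T : ℕ → Prop) :
    ch F (twst G F (regTensorAt G n T)) =
      ∑ w : Equiv.Perm (Fin n), if DescentsIn T w then fund w else 0 := by
  rw [regTensorAt, ch_twst_prod F (fun j x => if T j then (regChar G).1 x else 1) _
    (funext fun h => regTensor_apply T h)]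
  refine Finset.sum_congr rfl fun w _ => ?_
  have hfac : ∀ j : Fin (n - 1), (if w.symm (lo j) < w.symm (hi j) then
      mean (fun x => if T j then (regChar G).1 x else 1) else
      mean (fun x => (regSubOneDual G).1 x * if T j then (regChar G).1 x else 1)) =
      if ¬ T j → w.symm (lo j) < w.symm (hi j) then 1 else 0 := by
    intro j
    by_cases h : w.symm (lo j) < w.symm (hi j) <;> by_cases hT : T j <;>
      simp [h, hT, mean_reg, mean_one, mean_dual, mean_dual_mul_reg]
  rw [Finset.prod_congr rfl fun j _ => hfac j, Finset.prod_ite_zero]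
  by_cases hD : DescentsIn T w
  · rw [if_pos hD, if_pos fun j _ => hD j]; simp
  · rw [if_neg hD, if_neg fun h => hD fun j => h j (Finset.mem_univ _), zero_smul]

open scoped Classical in
/-- The tensor product in `scf(G^k)` with factor `reg - 1` in the coordinates in `S` and factor `1`
in the others. -/
def ribbonTensor (G : Type*) [Group G] {k : ℕ} (S : Finset (Fin k)) : scf G k :=
  ⟨fun g => ∏ j : Fin k, if j ∈ S then (regChar G - trivialChar G).1 (g j) else 1,
    fun _ _ hgh => Finset.prod_congr rfl fun j _ => by
      split_ifs
      · exact scfOne_apply_eq _ (hgh j)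
      · rfl⟩

/-- The set of coordinates `j` (counted from `0`) such that `j` is a descent of `w⁻¹`. -/
def invDescents {n : ℕ} (w : Equiv.Perm (Fin n)) : Finset (Fin (n - 1)) :=
  Finset.univ.filter fun j => w.symm (hi j) < w.symm (lo j)

/-- The pairings of `1` and of `(reg - 1)^*` with the factor `reg - 1` are `0` and `1`. So the
factors `reg - 1` impose descents of `w⁻¹`, and the factors `1` forbid them. -/
theorem ch_twst_ribbonTensor (n : ℕ) (S : Finset (Fin (n - 1))) :
    ch F (twst G F (DirectSum.lof ℂ ℕ (fun k => scf G (k - 1)) n (ribbonTensor G S))) =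
      ∑ w : Equiv.Perm (Fin n), if invDescents w = S then fund w else 0 := by
  classical
  rw [ch_twst_prod F (fun j x => if j ∈ S then (regChar G).1 x - 1 else 1) _
    (funext fun h => by simp only [ribbonTensor]; congr!)]
  refine Finset.sum_congr rfl fun w _ => ?_
  have hfac : ∀ j : Fin (n - 1), (if w.symm (lo j) < w.symm (hi j) then
      mean (fun x => if j ∈ S then (regChar G).1 x - 1 else 1) else
      mean (fun x => (regSubOneDual G).1 x * if j ∈ S then (regChar G).1 x - 1 else 1)) =
      if j ∈ invDescents w ↔ j ∈ S then 1 else 0 := by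
    intro j
    have hne : w.symm (hi j) ≠ w.symm (lo j) := fun h => (lo_lt_hi j).ne' (w.symm.injective h)
    have hinv : j ∈ invDescents w ↔ ¬ w.symm (lo j) < w.symm (hi j) := by
      rw [not_lt, hne.le_iff_lt]
      simp [invDescents]
    by_cases h : w.symm (lo j) < w.symm (hi j) <;> by_cases hT : j ∈ S <;>
      simp [h, hT, hinv, mean_reg, mean_one, mean_dual, mean_dual_mul_reg, mul_sub, mean_sub]
  rw [Finset.prod_congr rfl fun j _ => hfac j, Finset.prod_ite_zero]
  by_cases hD : invDescents w = S
  · rw [if_pos hD, if_pos fun j _ => by rw [hD]]; simp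
  · rw [if_neg hD, if_neg fun h => hD (Finset.ext fun j => h j (Finset.mem_univ _)), zero_smul]

/-- `reg = 1 + (reg - 1)` in each coordinate of `T`. -/
theorem regTensor_eq_sum_ribbonTensor {G : Type*} [Group G] (k : ℕ) (T : ℕ → Prop)
    [DecidablePred T] : regTensor G k T =
      ∑ S ∈ (Finset.univ.filter fun j : Fin k => T j).powerset, ribbonTensor G S := by
  classical
  refine Subtype.ext (funext fun g => ?_)
  have h2 : (∑ S ∈ (Finset.univ.filter fun j : Fin k => T j).powerset, ribbonTensor G S).1 g =
      ∑ S ∈ (Finset.univ.filter fun j : Fin k => T j).powerset, (ribbonTensor G S).1 g := by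
    simp [Finset.sum_apply]
  rw [h2, regTensor_apply, ← Finset.prod_filter]
  have h3 : ∀ j : Fin k, (regChar G).1 (g j) = 1 + (regChar G - trivialChar G).1 (g j) := by
    intro j; simp [trivialChar]
  rw [Finset.prod_congr rfl fun j _ => h3 j, Finset.prod_one_add]
  refine Finset.sum_congr rfl fun S _ => ?_
  simp only [ribbonTensor, Finset.prod_ite_mem, Finset.univ_inter]

/-- Each set of coordinates is the set of descents of some `w⁻¹`. -/
theorem exists_invDescents_eq {n : ℕ} (S : Finset (Fin (n - 1))) :
    ∃ w : Equiv.Perm (Fin n), invDescents w = S := by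
  classical
  -- `w⁻¹` standardizes a walk that steps down at the coordinates in `S` and up at the others.
  let f : Fin n → ℤ := fun i => ∑ j : Fin (n - 1),
    if (j : ℕ) < i then (if j ∈ S then -1 else 1) else 0
  have hstep : ∀ j, f (hi j) = f (lo j) + if j ∈ S then -1 else 1 := by
    intro j
    have e : (if j ∈ S then (-1 : ℤ) else 1) =
        ∑ i : Fin (n - 1), if i = j then (if i ∈ S then (-1 : ℤ) else 1) else 0 := by simp
    rw [e]
    simp only [f]
    rw [← Finset.sum_add_distrib]
    refine Finset.sum_congr rfl fun i _ => ?_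
    have c1 : (i : ℕ) < (hi j : Fin n) ↔ (i : ℕ) < j + 1 := Iff.rfl
    have c2 : (i : ℕ) < (lo j : Fin n) ↔ (i : ℕ) < j := Iff.rfl
    simp only [c1, c2]
    rcases lt_trichotomy (i : ℕ) j with h | h | h
    · have hne : i ≠ j := fun he => by simp [he] at h
      rw [if_pos (show (i : ℕ) < j + 1 by omega), if_pos h, if_neg hne, add_zero]
    · have he : i = j := Fin.ext h
      rw [if_pos (show (i : ℕ) < j + 1 by omega), if_neg (show ¬ (i : ℕ) < j by omega), if_pos he,
        zero_add]
    · have hne : i ≠ j := fun he => by simp [he] at h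
      rw [if_neg (show ¬ (i : ℕ) < j + 1 by omega), if_neg (show ¬ (i : ℕ) < j by omega),
        if_neg hne, add_zero]
  refine ⟨Tuple.sort f, Finset.ext fun j => ?_⟩
  rw [invDescents, Finset.mem_filter, ← sort_symm_lt_iff f (lo_lt_hi j), hstep]
  by_cases h : j ∈ S <;> simp [h]

/-- The images of the ribbon tensors are sums over disjoint nonempty sets of permutations. -/
theorem ch_twst_injective : Function.Injective (ch F ∘ₗ twst G F) := by
  classical
  choose p hp using fun (n : ℕ) (S : Finset (Fin (n - 1))) => exists_invDescents_eq S
  -- A left inverse: send one `F_w` for each set of descents to the ribbon, and the others to `0`.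
  let Λ : MR →ₗ[ℂ] ScfG G := Finsupp.lift _ ℂ _ fun w => if w.2 = p w.1 (invDescents w.2) then
    DirectSum.lof ℂ ℕ (fun k => scf G (k - 1)) w.1 (ribbonTensor G (invDescents w.2)) else 0
  have hΛ : ∀ {n : ℕ} (w : Equiv.Perm (Fin n)), Λ (fund w) = if w = p n (invDescents w) then
      DirectSum.lof ℂ ℕ (fun k => scf G (k - 1)) n (ribbonTensor G (invDescents w)) else 0 := by
    intro n w
    simp [Λ, fund]
  have hleft : ∀ x, Λ (ch F (twst G F x)) = x := by
    intro x
    induction x using scfG_induction with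
    | zero => simp
    | add a b ha hb => simp only [map_add, ha, hb]
    | smul r a ha => simp only [map_smul, ha]
    | basis n T =>
      rw [regTensorAt, regTensor_eq_sum_ribbonTensor]
      simp only [map_sum]
      refine Finset.sum_congr rfl fun S _ => ?_
      rw [ch_twst_ribbonTensor, map_sum, Finset.sum_eq_single (p n S)]
      · rw [if_pos (hp n S), hΛ, if_pos (by rw [hp]), hp]
      · intro w _ hw
        split_ifs with h
        · rw [hΛ, if_neg (by rwa [h])]
        · exact map_zero _
      · simp
  exact Function.LeftInverse.injective hleft

end Psi

/-! ### The product of `H` -/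

section Product

variable {G : Type*} [Group G]

/-- The set of coordinates of a product of elements of degrees `m` and `n`: the coordinates of both
factors and the new one between them. -/
def concatSet (m : ℕ) (S T : ℕ → Prop) (j : ℕ) : Prop :=
  (j + 1 < m ∧ S j) ∨ j + 1 = m ∨ (m ≤ j ∧ T (j - m))

theorem lc_twoBlocks_iff (m n : ℕ) (j : Fin (m + n - 1)) :
    lc (twoBlocks m n) j ↔ (j : ℕ) + 1 ≠ m := by
  constructor
  · rintro ⟨k, hk, hk'⟩ hj
    have hk : (j : ℕ) < k := hk
    have h1 : ((lo j : Fin (m + n)) : ℕ) < m := by simp only [lo]; omega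
    have h2 : ¬ (k : ℕ) < m := by omega
    simp [twoBlocks, h1, h2] at hk'
  · intro hj
    refine ⟨hi j, lo_lt_hi j, ?_⟩
    have : (j : ℕ) + 1 < m ↔ (j : ℕ) < m := by omega
    exact if_congr this rfl rfl

theorem mulDeg_regTensor (m n : ℕ) (S T : ℕ → Prop) :
    mulDeg (regChar G) m n (regTensor G (m - 1) S) (regTensor G (n - 1) T) =
      regTensor G (m + n - 1) (concatSet m S T) := by
  classical
  refine Subtype.ext (funext fun g => ?_)
  let r : ℕ → ℂ := fun j => if h : j < m + n - 1 then (regChar G).1 (g ⟨j, h⟩) else 1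
  have hr : ∀ j : Fin (m + n - 1), (regChar G).1 (g j) = r j := fun j => by simp [r]
  have hproj : ∀ j : Fin (m + n - 1), (j : ℕ) + 1 ≠ m →
      (regChar G).1 ((coordProj (lc (twoBlocks m n)) g).1 j) = r j := fun j hj => by
    rw [← hr]
    simp [coordProj, (lc_twoBlocks_iff m n j).2 hj]
  have e : (mulDeg (regChar G) m n (regTensor G (m - 1) S) (regTensor G (n - 1) T)).1 g =
      (∏ j : Fin (m + n - 1), if lc (twoBlocks m n) j then 1 else (regChar G).1 (g j)) *
      ((regTensor G (m - 1) S).1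
        (fun i => (coordProj (lc (twoBlocks m n)) g).1 ⟨i, by omega⟩) *
        (regTensor G (n - 1) T).1
        (fun i => (coordProj (lc (twoBlocks m n)) g).1 ⟨m + i, by omega⟩)) := by
    simp only [mulDeg, LinearMap.mk₂_apply, infTop, inflationTop, outer, LinearMap.comp_apply,
      LinearMap.mulLeft_apply, Pi.mul_apply, LinearMap.funLeft_apply]
  have e1 : (∏ j : Fin (m + n - 1), if lc (twoBlocks m n) j then 1 else (regChar G).1 (g j)) =
      ∏ j ∈ Finset.range (m + n - 1), if j + 1 = m then r j else 1 := by
    rw [Finset.prod_range]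
    refine Finset.prod_congr rfl fun j _ => ?_
    by_cases hj : (j : ℕ) + 1 = m
    · rw [if_neg fun h => (lc_twoBlocks_iff m n j).1 h hj, if_pos hj, hr]
    · rw [if_pos ((lc_twoBlocks_iff m n j).2 hj), if_neg hj]
  have e2 : (regTensor G (m - 1) S).1
        (fun i => (coordProj (lc (twoBlocks m n)) g).1 ⟨i, by omega⟩) =
      ∏ j ∈ Finset.range (m - 1), if S j then r j else 1 := by
    rw [Finset.prod_range, regTensor_apply]
    refine Finset.prod_congr rfl fun j _ => ?_
    rw [hproj ⟨j, by omega⟩ (by simp only; omega)]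
  have e3 : (regTensor G (n - 1) T).1
        (fun i => (coordProj (lc (twoBlocks m n)) g).1 ⟨m + i, by omega⟩) =
      ∏ j ∈ Finset.range (n - 1), if T j then r (m + j) else 1 := by
    rw [Finset.prod_range, regTensor_apply]
    refine Finset.prod_congr rfl fun j _ => ?_
    rw [hproj ⟨m + j, by omega⟩ (by simp only; omega)]
  have e4 : (regTensor G (m + n - 1) (concatSet m S T)).1 g =
      ∏ j ∈ Finset.range (m + n - 1), if concatSet m S T j then r j else 1 := by
    rw [Finset.prod_range, regTensor_apply]
    refine Finset.prod_congr rfl fun j _ => ?_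
    rw [hr]
  rw [e, e1, e2, e3, e4]
  rcases Nat.eq_zero_or_pos m with rfl | hm
  · simp [concatSet]
  rcases Nat.eq_zero_or_pos n with rfl | hn
  · have h1 : ∀ j ∈ Finset.range (m - 1), (if j + 1 = m then r j else 1) = 1 := fun j hj => by
      rw [if_neg]; have := Finset.mem_range.1 hj; omega
    have h2 : ∀ j ∈ Finset.range (m - 1), (if concatSet m S T j then r j else 1) =
        if S j then r j else 1 := fun j hj => by
      have := Finset.mem_range.1 hj
      refine if_congr ?_ rfl rfl
      simp only [concatSet]
      have a1 : j + 1 < m := by omega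
      have a2 : j + 1 ≠ m := by omega
      have a3 : ¬ m ≤ j := by omega
      simp [a1, a2, a3]
    simp only [add_zero]
    rw [Finset.prod_congr rfl h1, Finset.prod_congr rfl h2]
    simp
  obtain ⟨m, rfl⟩ := Nat.exists_eq_succ_of_ne_zero hm.ne'
  obtain ⟨n, rfl⟩ := Nat.exists_eq_succ_of_ne_zero hn.ne'
  have hmn : m.succ + n.succ - 1 = m + 1 + n := by omega
  simp only [hmn, Nat.succ_eq_add_one, Nat.add_sub_cancel]
  rw [Finset.prod_range_add _ (m + 1) n, Finset.prod_range_add _ (m + 1) n, Finset.prod_range_succ,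
    Finset.prod_range_succ]
  have h1 : ∀ j ∈ Finset.range m, (if j + 1 = m + 1 then r j else 1) = 1 := fun j hj => by
    rw [if_neg]; have := Finset.mem_range.1 hj; omega
  have h2 : ∀ j ∈ Finset.range m, (if concatSet (m + 1) S T j then r j else 1) =
      if S j then r j else 1 := fun j hj => by
    have := Finset.mem_range.1 hj
    refine if_congr ?_ rfl rfl
    have a2 : j ≠ m := by omega
    have a3 : ¬ m + 1 ≤ j := by omega
    simp [concatSet, this, a2, a3]
  have h3 : ∀ j ∈ Finset.range n, (if m + 1 + j + 1 = m + 1 then r (m + 1 + j) else 1) = 1 :=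
    fun j _ => if_neg (by omega)
  have h4 : ∀ j ∈ Finset.range n, (if concatSet (m + 1) S T (m + 1 + j) then r (m + 1 + j) else 1) =
      if T j then r (m + 1 + j) else 1 := fun j _ => by
    refine if_congr ?_ rfl rfl
    have a1 : ¬ m + 1 + j < m := by omega
    have a2 : m + 1 + j ≠ m := by omega
    simp [concatSet, a1, a2]
  have h5 : concatSet (m + 1) S T m := Or.inr (Or.inl rfl)
  rw [Finset.prod_congr rfl h1, Finset.prod_congr rfl h2, Finset.prod_congr rfl h3,
    Finset.prod_congr rfl h4, if_pos h5]
  simp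
  ring

theorem hopfG_mul_regTensorAt [Fintype G] [Nontrivial G] (α β : scfOne G) (m n : ℕ)
    (S T : ℕ → Prop) :
    (hopfG (regChar G) α β).mul (regTensorAt G m S) (regTensorAt G n T) =
      regTensorAt G (m + n) (concatSet m S T) := by
  simp only [hopfG, regTensorAt, DirectSum.toModule_lof, LinearMap.flip_apply]
  rw [LinearMap.compr₂_apply, mulDeg_regTensor]

end Product

/-! ### Multiplicativity of the composite of `ch` and `twst` -/

section PsiMul

theorem exists_isShuffle {m n : ℕ} (w : Equiv.Perm (Fin (m + n))) :
    ∃ u : Equiv.Perm (Fin m), ∃ v : Equiv.Perm (Fin n), IsShuffle u v w := by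
  have key : ∀ {k : ℕ} {f : Fin k → Fin (m + n)}, Function.Injective f → ∀ i j,
      (f i < f j ↔ (Tuple.sort f).symm i < (Tuple.sort f).symm j) := by
    intro k f hf i j
    have : StrictMono (f ∘ Tuple.sort f) :=
      (Tuple.monotone_sort f).strictMono_of_injective (hf.comp (Tuple.sort f).injective)
    have := this.lt_iff_lt (a := (Tuple.sort f).symm i) (b := (Tuple.sort f).symm j)
    simpa using this
  exact ⟨Tuple.sort fun i => w.symm (Fin.castAdd n i), Tuple.sort fun i => w.symm (Fin.natAdd m i),
    key (w.symm.injective.comp (Fin.castAdd_injective m n)),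
    key (w.symm.injective.comp (Fin.natAdd_injective n m))⟩

theorem IsShuffle.unique {m n : ℕ} {w : Equiv.Perm (Fin (m + n))} {u u' : Equiv.Perm (Fin m)}
    {v v' : Equiv.Perm (Fin n)} (h : IsShuffle u v w) (h' : IsShuffle u' v' w) :
    u = u' ∧ v = v' := by
  have h1 := sort_eq_sort u.symm u'.symm fun i j _ => by rw [← h.1, ← h'.1]
  have h2 := sort_eq_sort v.symm v'.symm fun i j _ => by rw [← h.2, ← h'.2]
  rw [sort_perm_val, sort_perm_val, Equiv.symm_symm, Equiv.symm_symm] at h1 h2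
  exact ⟨h1, h2⟩

theorem IsShuffle.descentsIn_iff {m n : ℕ} {w : Equiv.Perm (Fin (m + n))} {u : Equiv.Perm (Fin m)}
    {v : Equiv.Perm (Fin n)} (h : IsShuffle u v w) (S T : ℕ → Prop) :
    DescentsIn (concatSet m S T) w ↔ DescentsIn S u ∧ DescentsIn T v := by
  constructor
  · intro hw
    constructor
    · intro j hj
      rw [← h.1]
      refine hw ⟨j, by omega⟩ fun hc => ?_
      rcases hc with hc | hc | hc
      · exact hj hc.2
      · simp only at hc; omega
      · simp only at hc; omega
    · intro j hj
      rw [← h.2]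
      refine hw ⟨m + j, by omega⟩ fun hc => ?_
      rcases hc with hc | hc | hc
      · simp only at hc; omega
      · simp only at hc; omega
      · exact hj (by simpa using hc.2)
  · rintro ⟨hu, hv⟩ j hj
    have hne : (j : ℕ) + 1 ≠ m := fun h => hj (Or.inr (Or.inl h))
    by_cases hlt : (j : ℕ) + 1 < m
    · exact (h.1 ⟨j, by omega⟩ ⟨j + 1, by omega⟩).2
        (hu ⟨j, by omega⟩ fun hS => hj (Or.inl ⟨hlt, hS⟩))
    · have hmj : m ≤ j := by omega
      have := (h.2 ⟨j - m, by omega⟩ ⟨j - m + 1, by omega⟩).2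
        (hv ⟨j - m, by omega⟩ fun hT => hj (Or.inr (Or.inr ⟨hmj, hT⟩)))
      have e1 : Fin.natAdd m (⟨j - m, by omega⟩ : Fin n) = lo j := Fin.ext (by simp [lo]; omega)
      have e2 : Fin.natAdd m (⟨j - m + 1, by omega⟩ : Fin n) = hi j := Fin.ext (by simp [hi]; omega)
      rwa [e1, e2] at this

variable {G : Type*} [Group G] [Fintype G] [Nontrivial G] (F : Type*) [Field F] [Fintype F]

/-- Each `w` is a shuffle of exactly one pair `(u, v)`, and `w⁻¹` has its descents in `concatSet m S
T` exactly if those of `u⁻¹` lie in `S` and those of `v⁻¹` in `T`. -/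
theorem ch_twst_mul (x y : ScfG G) :
    (ch F ∘ₗ twst G F) ((hopfG (regChar G) (trivialChar G) (regSubOneDual G)).mul x y) =
      hopfMR.mul ((ch F ∘ₗ twst G F) x) ((ch F ∘ₗ twst G F) y) := by
  classical
  induction x using scfG_induction with
  | zero => simp
  | add a b ha hb => simp only [map_add, LinearMap.add_apply, ha, hb]
  | smul r a ha => simp only [map_smul, LinearMap.smul_apply, ha]
  | basis m S =>
    induction y using scfG_induction with
    | zero => simp
    | add a b ha hb => simp only [map_add, ha, hb]
    | smul r a ha => simp only [map_smul, ha]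
    | basis n T =>
      rw [hopfG_mul_regTensorAt, LinearMap.comp_apply, LinearMap.comp_apply, LinearMap.comp_apply,
        ch_twst_regTensorAt, ch_twst_regTensorAt, ch_twst_regTensorAt]
      have e : ∀ (u : Equiv.Perm (Fin m)) (v : Equiv.Perm (Fin n)),
          hopfMR.mul (if DescentsIn S u then fund u else 0) (if DescentsIn T v then fund v else 0) =
          ∑ w : Equiv.Perm (Fin (m + n)),
            if DescentsIn (concatSet m S T) w ∧ IsShuffle u v w then fund w else 0 := by
        intro u v
        have e' : ∀ w : Equiv.Perm (Fin (m + n)), (DescentsIn (concatSet m S T) w ∧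
            IsShuffle u v w) ↔ ((DescentsIn S u ∧ DescentsIn T v) ∧ IsShuffle u v w) := fun w =>
          and_congr_left fun h => h.descentsIn_iff S T
        simp only [e']
        by_cases hu : DescentsIn S u
        · by_cases hv : DescentsIn T v
          · simp only [hu, hv, if_true, and_self, true_and, hopfMR_mul_fund, Finset.sum_filter]
          · simp [hv]
        · simp [hu]
      simp only [map_sum, LinearMap.sum_apply, e]
      rw [Finset.sum_congr rfl fun v _ => Finset.sum_comm, Finset.sum_comm]
      refine Finset.sum_congr rfl fun w _ => ?_
      obtain ⟨u, v, h⟩ := exists_isShuffle w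
      rw [Finset.sum_eq_single v, Finset.sum_eq_single u]
      · simp [h]
      · intro u' _ hu'
        exact if_neg fun hc => hu' (hc.2.unique h).1
      · simp
      · intro v' _ hv'
        exact Finset.sum_eq_zero fun u' _ => if_neg fun hc => hv' (hc.2.unique h).2
      · simp

end PsiMul

/-! ### Ranks in a subset -/

section Rank

variable {n : ℕ} {B : Finset (Fin n)}

theorem rankIn_lt_rankIn {i j : Fin n} (hi : i ∈ B) (hij : i < j) : rankIn B i < rankIn B j := by
  refine Finset.card_lt_card ⟨fun a ha => ?_, fun h => ?_⟩
  · simp only [Finset.mem_filter] at ha ⊢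
    exact ⟨ha.1, ha.2.trans hij⟩
  · have := h (Finset.mem_filter.2 ⟨hi, hij⟩)
    simp at this

theorem rankIn_inj {i j : Fin n} (hi : i ∈ B) (hj : j ∈ B) (h : rankIn B i = rankIn B j) :
    i = j := by
  rcases lt_trichotomy i j with hij | hij | hij
  · exact absurd h (rankIn_lt_rankIn hi hij).ne
  · exact hij
  · exact absurd h (rankIn_lt_rankIn hj hij).ne'

theorem rankIn_lt_card {i : Fin n} (hi : i ∈ B) : rankIn B i < B.card :=
  Finset.card_lt_card ⟨Finset.filter_subset _ _, fun h => by
    have := h hi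
    simp at this⟩

theorem exists_rankIn_eq {i : ℕ} (hi : i < B.card) : ∃ j ∈ B, rankIn B j = i := by
  have : B.image (rankIn B) = Finset.range B.card := by
    refine Finset.eq_of_subset_of_card_le (fun a ha => ?_) ?_
    · obtain ⟨j, hj, rfl⟩ := Finset.mem_image.1 ha
      exact Finset.mem_range.2 (rankIn_lt_card hj)
    · rw [Finset.card_image_of_injOn fun a ha b hb h => rankIn_inj ha hb h, Finset.card_range]
  exact Finset.mem_image.1 (this ▸ Finset.mem_range.2 hi)

/-- An element is the maximum of `B` exactly if its rank is the largest possible. -/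
theorem rankIn_lt_card_sub_one_iff {i : Fin n} (hi : i ∈ B) :
    rankIn B i < B.card - 1 ↔ ∃ k ∈ B, i < k := by
  refine ⟨exists_gt_of_rankIn_lt hi, ?_⟩
  rintro ⟨k, hk, hik⟩
  have h1 := rankIn_lt_rankIn hi hik
  have h2 := rankIn_lt_card hk
  omega

/-- The set of coordinates with factor `reg` in the component of the coproduct of `regTensor T`
that belongs to the block `B`: the coordinate of an element `j` of `B` gets the factor `reg` if it
comes from such a coordinate, or if `j + 1` is not in `B`. -/
def restrictSet (B : Finset (Fin n)) (T : ℕ → Prop) (i : ℕ) : Prop :=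
  ∃ j ∈ B, rankIn B j = i ∧ ∀ k ∈ B, (k : ℕ) = j + 1 → T j

theorem restrictSet_rankIn {T : ℕ → Prop} {j : Fin n} (hj : j ∈ B) :
    restrictSet B T (rankIn B j) ↔ ∀ k ∈ B, (k : ℕ) = j + 1 → T j := by
  constructor
  · rintro ⟨j', hj', h, hT⟩
    obtain rfl := rankIn_inj hj' hj h
    exact hT
  · exact fun h => ⟨j, hj, rfl, h⟩

open scoped Classical in
/-- The factors in the coordinates of `G^(n-1)` that belong to nonmaximal elements of `B`, collected
in the order of these elements. -/
theorem prod_restrictSet {G : Type*} [Group G] (B : Finset (Fin n)) (T : ℕ → Prop) {p : ℕ}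
    (hp : p = B.card - 1) (x : Fin p → G) :
    (∏ j : Fin (n - 1), if h : lo j ∈ B ∧ rankIn B (lo j) < p then
      (if hi j ∈ B → T j then (regChar G).1 (x ⟨rankIn B (lo j), h.2⟩) else 1) else 1) =
    (regTensor G p (restrictSet B T)).1 x := by
  rw [regTensor_apply]
  have hfilter : ∀ j : Fin (n - 1), j ∉ (Finset.univ.filter fun j : Fin (n - 1) =>
      lo j ∈ B ∧ rankIn B (lo j) < p) → ¬ (lo j ∈ B ∧ rankIn B (lo j) < p) := fun j hj => by
    simpa using hj
  rw [← Finset.prod_subset (Finset.subset_univ (Finset.univ.filter fun j : Fin (n - 1) =>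
      lo j ∈ B ∧ rankIn B (lo j) < p)) fun j _ hj => dif_neg (hfilter j hj)]
  refine Finset.prod_bij (fun j hj => ⟨rankIn B (lo j), (Finset.mem_filter.1 hj).2.2⟩)
    (fun _ _ => Finset.mem_univ _) ?_ ?_ ?_
  · intro j hj j' hj' h
    have := rankIn_inj (Finset.mem_filter.1 hj).2.1 (Finset.mem_filter.1 hj').2.1
      (congrArg Fin.val h)
    exact Fin.ext (congrArg (fun i : Fin n => (i : ℕ)) this)
  · intro i _
    obtain ⟨j, hj, hji⟩ := exists_rankIn_eq (B := B) (i := i) (by omega)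
    obtain ⟨k, hk, hjk⟩ := (rankIn_lt_card_sub_one_iff hj).1 (by omega)
    have hjk : (j : ℕ) < k := hjk
    have hlo : lo (⟨j, by omega⟩ : Fin (n - 1)) = j := rfl
    refine ⟨⟨j, by omega⟩, ?_, Fin.ext hji⟩
    rw [Finset.mem_filter, hlo]
    exact ⟨Finset.mem_univ _, hj, by omega⟩
  · intro j hj
    have h := (Finset.mem_filter.1 hj).2
    rw [dif_pos h]
    refine if_congr ?_ rfl rfl
    simp only
    rw [restrictSet_rankIn h.1]
    constructor
    · intro hT k hk hkj
      have : k = hi j := Fin.ext hkj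
      exact hT (this ▸ hk)
    · exact fun hT hB => hT _ hB rfl

end Rank

/-! ### The coproduct of `H` on tensors -/

section Coproduct

variable {G : Type*} [Group G] [Nontrivial G]

theorem toTensor_mul (p q : ℕ) (γ : scf G p) (ψ : scf G q) :
    toTensor G p q (fun z => γ.1 z.1 * ψ.1 z.2) = γ ⊗ₜ[ℂ] ψ := by
  conv_rhs => rw [scf_eq_sum_classIndicator γ, scf_eq_sum_classIndicator ψ]
  simp only [toTensor, LinearMap.sum_apply, LinearMap.smulRight_apply, LinearMap.proj_apply,
    TensorProduct.sum_tmul, TensorProduct.tmul_sum, TensorProduct.smul_tmul_smul]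
  exact Finset.sum_comm

/-- A coordinate between an element outside `A` and an element of `A` carries the factor `reg`. -/
def Admissible {n : ℕ} (A : Finset (Fin n)) (T : ℕ → Prop) : Prop :=
  ∀ j : Fin (n - 1), lo j ∉ A → hi j ∈ A → T j

variable [Fintype G]

open scoped Classical in
theorem dn_regTensor {n : ℕ} (A : Finset (Fin n)) (T : ℕ → Prop)
    (x : Fin (A.card - 1) → G) (y : Fin (n - A.card - 1) → G) :
    dn (splitBlocks A) (regChar G) (trivialChar G) (regSubOneDual G) (regTensor G (n - 1) T).1
      (shuffleCoords A x y) = (if Admissible A T then 1 else 0) *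
        ((regTensor G _ (restrictSet A T)).1 x * (regTensor G _ (restrictSet Aᶜ T)).1 y) := by
  have e0 : (regTensor G (n - 1) T).1 =
      fun h => ∏ j : Fin (n - 1), (fun x => if T j then (regChar G).1 x else 1) (h j) :=
    funext fun h => regTensor_apply T h
  have hcompl : n - A.card - 1 = Aᶜ.card - 1 := by rw [Finset.card_compl, Fintype.card_fin]
  rw [e0, dn_prod (φ := fun j x => if T j then (regChar G).1 x else 1),
    ← prod_restrictSet A T rfl x, ← prod_restrictSet Aᶜ T hcompl y]
  have hadm : (if Admissible A T then (1 : ℂ) else 0) =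
      ∏ j : Fin (n - 1), if lo j ∉ A → hi j ∈ A → T j then 1 else 0 := by
    rw [Finset.prod_ite_zero]
    by_cases h : Admissible A T
    · rw [if_pos h, if_pos fun j _ => h j]; simp
    · rw [if_neg h, if_neg fun h' => h fun j => h' j (Finset.mem_univ _)]
  rw [hadm, ← Finset.prod_mul_distrib, ← Finset.prod_mul_distrib]
  refine Finset.prod_congr rfl fun j _ => ?_
  have hbc : bc (splitBlocks A) j ↔ (hi j ∈ A ↔ lo j ∈ A) := by
    simp only [bc, splitBlocks]
    by_cases h1 : hi j ∈ A <;> by_cases h2 : lo j ∈ A <;> simp [h1, h2]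
  have hllc : llc (splitBlocks A) j ↔ (hi j ∈ A → lo j ∈ A) := by
    simp only [llc, splitBlocks]
    by_cases h1 : hi j ∈ A <;> by_cases h2 : lo j ∈ A <;> simp [h1, h2]
  have hm1 : mean (fun x => (trivialChar G).1 x * if T j then (regChar G).1 x else 1) = 1 := by
    by_cases hT : T j <;> simp [hT, trivialChar, mean_reg, mean_one]
  have hm2 : mean (fun x => (regSubOneDual G).1 x * if T j then (regChar G).1 x else 1) =
      if T j then 1 else 0 := by
    by_cases hT : T j <;> simp [hT, mean_dual, mean_dual_mul_reg]
  rw [hm1, hm2]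
  by_cases hA : lo j ∈ A
  · have hlc : lc (splitBlocks A) j ↔ rankIn A (lo j) < A.card - 1 := by
      rw [rankIn_lt_card_sub_one_iff hA]
      simp only [lc, splitBlocks, hA, if_true]
      refine exists_congr fun k => ?_
      by_cases hk : k ∈ A <;> simp [hk]
    have hAc : ¬ (lo j ∈ Aᶜ ∧ rankIn Aᶜ (lo j) < n - A.card - 1) := fun h =>
      Finset.mem_compl.1 h.1 hA
    rw [dif_neg hAc]
    by_cases hr : rankIn A (lo j) < A.card - 1
    · have hval : (shuffleCoords A x y).1 j = x ⟨rankIn A (lo j), hr⟩ := by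
        simp [shuffleCoords, hA, hr]
      rw [dif_pos ⟨hA, hr⟩, hval]
      by_cases hB : hi j ∈ A <;> simp [hbc, hllc, hlc, hA, hr, hB]
    · have hB : hi j ∉ A := fun hB =>
        hr ((rankIn_lt_card_sub_one_iff hA).2 ⟨hi j, hB, lo_lt_hi j⟩)
      rw [dif_neg fun h => hr h.2]
      simp [hbc, hllc, hlc, hA, hr, hB]
  · have hA' : lo j ∈ Aᶜ := Finset.mem_compl.2 hA
    have hlc : lc (splitBlocks A) j ↔ rankIn Aᶜ (lo j) < n - A.card - 1 := by
      rw [hcompl, rankIn_lt_card_sub_one_iff hA']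
      simp only [lc, splitBlocks, hA, if_false]
      refine exists_congr fun k => ?_
      by_cases hk : k ∈ A <;> simp [hk]
    have hAc : ¬ (lo j ∈ A ∧ rankIn A (lo j) < A.card - 1) := fun h => hA h.1
    rw [dif_neg hAc]
    by_cases hr : rankIn Aᶜ (lo j) < n - A.card - 1
    · have hval : (shuffleCoords A x y).1 j = y ⟨rankIn Aᶜ (lo j), hr⟩ := by
        simp [shuffleCoords, hA, hr]
      rw [dif_pos ⟨hA', hr⟩, hval]
      by_cases hB : hi j ∈ A
      · by_cases hT : T j <;> simp [hbc, hllc, hlc, hA, hr, hB, hT]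
      · by_cases hT : T j <;> simp [hbc, hA, hB, hT]
    · have hB : hi j ∈ A := by
        by_contra hB
        refine hr ?_
        rw [hcompl]
        exact (rankIn_lt_card_sub_one_iff hA').2 ⟨hi j, Finset.mem_compl.2 hB, lo_lt_hi j⟩
      rw [dif_neg fun h => hr h.2]
      by_cases hT : T j <;> simp [hbc, hllc, hlc, hA, hr, hB, hT]

open scoped Classical in
theorem comulDeg_regTensor (n : ℕ) (T : ℕ → Prop) :
    comulDeg (regChar G) (trivialChar G) (regSubOneDual G) n (regTensor G (n - 1) T) =
      ∑ A : Finset (Fin n), if Admissible A T then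
        regTensorAt G A.card (restrictSet A T) ⊗ₜ[ℂ] regTensorAt G Aᶜ.card (restrictSet Aᶜ T)
        else 0 := by
  rw [comulDeg, LinearMap.sum_apply]
  refine Finset.sum_congr rfl fun A _ => ?_
  simp only [LinearMap.comp_apply, Submodule.subtype_apply]
  have e : LinearMap.funLeft ℂ ℂ (fun p : (Fin (A.card - 1) → G) × (Fin (n - A.card - 1) → G) =>
      shuffleCoords A p.1 p.2) (dn (splitBlocks A) (regChar G) (trivialChar G) (regSubOneDual G)
        (regTensor G (n - 1) T).1) = (if Admissible A T then (1 : ℂ) else 0) •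
        fun z => (regTensor G _ (restrictSet A T)).1 z.1 *
          (regTensor G _ (restrictSet Aᶜ T)).1 z.2 := by
    funext z
    rw [LinearMap.funLeft_apply, dn_regTensor]
    rfl
  rw [e, map_smul, toTensor_mul, map_smul, TensorProduct.map_tmul]
  have hc : n - A.card = Aᶜ.card := by rw [Finset.card_compl, Fintype.card_fin]
  have e2 : regTensorAt G Aᶜ.card (restrictSet Aᶜ T) =
      regTensorAt G (n - A.card) (restrictSet Aᶜ T) :=
    regTensorAt_congr hc.symm fun _ _ => Iff.rfl
  rw [e2]
  split_ifs
  · rw [one_smul]; rfl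
  · rw [zero_smul]

open scoped Classical in
theorem hopfG_comul_regTensorAt (n : ℕ) (T : ℕ → Prop) :
    (hopfG (regChar G) (trivialChar G) (regSubOneDual G)).comul (regTensorAt G n T) =
      ∑ A : Finset (Fin n), if Admissible A T then
        regTensorAt G A.card (restrictSet A T) ⊗ₜ[ℂ] regTensorAt G Aᶜ.card (restrictSet Aᶜ T)
        else 0 := by
  rw [← comulDeg_regTensor, regTensorAt]
  simp only [hopfG, DirectSum.toModule_lof]

end Coproduct

/-! ### Multiplicativity of the coproduct of `H` -/

section Join

variable {m n : ℕ}

/-- The subset of `{0, …, m+n-1}` made of `A` and of the translate of `B` by `m`. -/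
def joinSet (A : Finset (Fin m)) (B : Finset (Fin n)) : Finset (Fin (m + n)) :=
  A.map (Fin.castAddEmb n) ∪ B.map (Fin.natAddEmb m)

theorem castAdd_mem_joinSet {A : Finset (Fin m)} {B : Finset (Fin n)} {i : Fin m} :
    Fin.castAdd n i ∈ joinSet A B ↔ i ∈ A := by
  simp only [joinSet, Finset.mem_union, Finset.mem_map, Fin.castAddEmb_apply, Fin.natAddEmb_apply]
  constructor
  · rintro (⟨a, ha, h⟩ | ⟨b, hb, h⟩)
    · rwa [← Fin.castAdd_injective m n h]
    · have := congrArg Fin.val h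
      simp at this
      omega
  · exact fun h => Or.inl ⟨i, h, rfl⟩

theorem natAdd_mem_joinSet {A : Finset (Fin m)} {B : Finset (Fin n)} {i : Fin n} :
    Fin.natAdd m i ∈ joinSet A B ↔ i ∈ B := by
  simp only [joinSet, Finset.mem_union, Finset.mem_map, Fin.castAddEmb_apply, Fin.natAddEmb_apply]
  constructor
  · rintro (⟨a, ha, h⟩ | ⟨b, hb, h⟩)
    · have := congrArg Fin.val h
      simp at this
      omega
    · rwa [← Fin.natAdd_injective n m h]
  · exact fun h => Or.inr ⟨i, h, rfl⟩

theorem compl_joinSet (A : Finset (Fin m)) (B : Finset (Fin n)) :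
    (joinSet A B)ᶜ = joinSet Aᶜ Bᶜ := by
  ext i
  refine Fin.addCases (fun i => ?_) (fun i => ?_) i
  · simp [castAdd_mem_joinSet]
  · simp [natAdd_mem_joinSet]

theorem card_joinSet (A : Finset (Fin m)) (B : Finset (Fin n)) :
    (joinSet A B).card = A.card + B.card := by
  rw [joinSet, Finset.card_union_of_disjoint, Finset.card_map, Finset.card_map]
  rw [Finset.disjoint_left]
  rintro _ ha hb
  obtain ⟨a, -, rfl⟩ := Finset.mem_map.1 ha
  obtain ⟨b, -, h⟩ := Finset.mem_map.1 hb
  have := congrArg Fin.val h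
  simp at this
  omega

theorem rankIn_joinSet_castAdd (A : Finset (Fin m)) (B : Finset (Fin n)) (i : Fin m) :
    rankIn (joinSet A B) (Fin.castAdd n i) = rankIn A i := by
  have : (joinSet A B).filter (fun a => a < Fin.castAdd n i) =
      (A.filter fun a => a < i).map (Fin.castAddEmb n) := by
    ext a
    refine Fin.addCases (fun a => ?_) (fun a => ?_) a
    · rw [Finset.mem_filter, castAdd_mem_joinSet]
      have : Fin.castAdd n a < Fin.castAdd n i ↔ a < i := Iff.rfl
      simp [this]
    · simp only [Finset.mem_filter, Finset.mem_map, Fin.castAddEmb_apply]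
      constructor
      · rintro ⟨-, h⟩
        have : m + (a : ℕ) < i := h
        omega
      · rintro ⟨b, -, h⟩
        have := congrArg Fin.val h
        simp at this
        omega
  rw [rankIn, this, Finset.card_map, rankIn]

theorem rankIn_joinSet_natAdd (A : Finset (Fin m)) (B : Finset (Fin n)) (i : Fin n) :
    rankIn (joinSet A B) (Fin.natAdd m i) = A.card + rankIn B i := by
  have : (joinSet A B).filter (fun a => a < Fin.natAdd m i) =
      joinSet A (B.filter fun a => a < i) := by
    ext a
    refine Fin.addCases (fun a => ?_) (fun a => ?_) a
    · rw [Finset.mem_filter, castAdd_mem_joinSet, castAdd_mem_joinSet]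
      refine and_iff_left ?_
      change (a : ℕ) < m + i
      omega
    · rw [Finset.mem_filter, natAdd_mem_joinSet, natAdd_mem_joinSet]
      simp
  rw [rankIn, this, card_joinSet, rankIn]

/-- Subsets of `{0, …, m+n-1}` as pairs of subsets. -/
def joinEquiv (m n : ℕ) : Finset (Fin m) × Finset (Fin n) ≃ Finset (Fin (m + n)) where
  toFun p := joinSet p.1 p.2
  invFun A := (Finset.univ.filter fun i => Fin.castAdd n i ∈ A,
    Finset.univ.filter fun i => Fin.natAdd m i ∈ A)
  left_inv p := by
    refine Prod.ext ?_ ?_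
    · ext i; simp [castAdd_mem_joinSet]
    · ext i; simp [natAdd_mem_joinSet]
  right_inv A := by
    ext i
    refine Fin.addCases (fun i => ?_) (fun i => ?_) i
    · simp [castAdd_mem_joinSet]
    · simp [natAdd_mem_joinSet]

theorem admissible_joinSet (A : Finset (Fin m)) (B : Finset (Fin n)) (S T : ℕ → Prop) :
    Admissible (joinSet A B) (concatSet m S T) ↔ Admissible A S ∧ Admissible B T := by
  constructor
  · intro h
    constructor
    · intro j h1 h2
      have := h ⟨j, by omega⟩ (fun hc => h1 (castAdd_mem_joinSet.1 hc))
        (castAdd_mem_joinSet (i := hi j).2 h2)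
      rcases this with hc | hc | hc
      · exact hc.2
      · simp only at hc; omega
      · simp only at hc; omega
    · intro j h1 h2
      have := h ⟨m + j, by omega⟩ (fun hc => h1 (natAdd_mem_joinSet.1 hc))
        (natAdd_mem_joinSet (i := hi j).2 h2)
      rcases this with hc | hc | hc
      · simp only at hc; omega
      · simp only at hc; omega
      · simpa using hc.2
  · rintro ⟨hA, hB⟩ j h1 h2
    rcases lt_trichotomy ((j : ℕ) + 1) m with hlt | heq | hgt
    · exact Or.inl ⟨hlt, hA ⟨j, by omega⟩
        (fun hc => h1 (castAdd_mem_joinSet (i := ⟨j, by omega⟩).2 hc))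
        (castAdd_mem_joinSet (i := ⟨j + 1, by omega⟩).1 h2)⟩
    · exact Or.inr (Or.inl heq)
    · have e1 : Fin.natAdd m (⟨j - m, by omega⟩ : Fin n) = lo j := Fin.ext (by simp [lo]; omega)
      have e2 : Fin.natAdd m (⟨j - m + 1, by omega⟩ : Fin n) = hi j := Fin.ext (by simp [hi]; omega)
      rw [← e1, natAdd_mem_joinSet] at h1
      rw [← e2, natAdd_mem_joinSet] at h2
      exact Or.inr (Or.inr ⟨by omega, hB ⟨j - m, by omega⟩ h1 h2⟩)

/-- The largest element of `A` can be followed by its successor in the joined set only across the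
new coordinate, which carries `reg`; so its factor in the component of the joined set is always
`reg`. -/
theorem restrictSet_joinSet (A : Finset (Fin m)) (B : Finset (Fin n)) (S T : ℕ → Prop) (i : ℕ)
    (hi : i + 1 < A.card + B.card) : restrictSet (joinSet A B) (concatSet m S T) i ↔
      concatSet A.card (restrictSet A S) (restrictSet B T) i := by
  obtain ⟨j, hj, rfl⟩ := exists_rankIn_eq (B := joinSet A B) (i := i) (by rw [card_joinSet]; omega)
  rw [restrictSet_rankIn hj]
  revert hj hi
  refine Fin.addCases (fun j => ?_) (fun j => ?_) j
  · intro hj hi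
    rw [castAdd_mem_joinSet] at hj
    rw [rankIn_joinSet_castAdd] at hi ⊢
    have hlt := rankIn_lt_card hj
    constructor
    · intro h
      by_cases hmax : rankIn A j + 1 < A.card
      · refine Or.inl ⟨hmax, (restrictSet_rankIn hj).2 fun k hk hkj => ?_⟩
        rcases h (Fin.castAdd n k) (castAdd_mem_joinSet.2 hk) hkj with hc | hc | hc
        · exact hc.2
        · have := k.2; simp only [Fin.val_castAdd] at hc; omega
        · simp only [Fin.val_castAdd] at hc; omega
      · exact Or.inr (Or.inl (by omega))
    · intro h k hk hkj
      by_cases hjm : (j : ℕ) + 1 = m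
      · exact Or.inr (Or.inl hjm)
      refine Or.inl ⟨by simp only [Fin.val_castAdd]; omega, ?_⟩
      have hk' : Fin.castAdd n (⟨j + 1, by omega⟩ : Fin m) = k := Fin.ext hkj.symm
      rw [← hk', castAdd_mem_joinSet] at hk
      have h2 := rankIn_lt_rankIn hj (j := ⟨j + 1, by omega⟩) (Fin.lt_def.2 (Nat.lt_succ_self _))
      have h3 := rankIn_lt_card hk
      rcases h with hc | hc | hc
      · exact (restrictSet_rankIn hj).1 hc.2 _ hk rfl
      · omega
      · omega
  · intro hj hi
    rw [natAdd_mem_joinSet] at hj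
    rw [rankIn_joinSet_natAdd] at hi ⊢
    constructor
    · intro h
      refine Or.inr (Or.inr ⟨by omega, ?_⟩)
      rw [Nat.add_sub_cancel_left, restrictSet_rankIn hj]
      intro k hk hkj
      rcases h (Fin.natAdd m k) (natAdd_mem_joinSet.2 hk) (by simp; omega) with hc | hc | hc
      · simp only [Fin.val_natAdd] at hc; omega
      · simp only [Fin.val_natAdd] at hc; omega
      · simpa using hc.2
    · intro h k hk hkj
      refine Or.inr (Or.inr ⟨by simp, ?_⟩)
      simp only [Fin.val_natAdd] at hkj
      have hk' : Fin.natAdd m (⟨j + 1, by omega⟩ : Fin n) = k := Fin.ext (by simp; omega)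
      rw [← hk', natAdd_mem_joinSet] at hk
      rcases h with hc | hc | hc
      · omega
      · omega
      · have h4 := hc.2
        rw [Nat.add_sub_cancel_left, restrictSet_rankIn hj] at h4
        simpa using h4 _ hk rfl

variable {G : Type*} [Group G] [Nontrivial G] [Fintype G]

/-- The subsets of `{0, …, m+n-1}` are the pairs of subsets of the two parts, and the summands of
the coproduct factor accordingly. -/
theorem hopfG_comul_mul (x y : ScfG G) :
    (hopfG (regChar G) (trivialChar G) (regSubOneDual G)).comul
      ((hopfG (regChar G) (trivialChar G) (regSubOneDual G)).mul x y) =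
    (hopfG (regChar G) (trivialChar G) (regSubOneDual G)).mulTensor
      ((hopfG (regChar G) (trivialChar G) (regSubOneDual G)).comul x ⊗ₜ[ℂ]
        (hopfG (regChar G) (trivialChar G) (regSubOneDual G)).comul y) := by
  classical
  induction x using scfG_induction with
  | zero => simp
  | add a b ha hb => simp only [map_add, LinearMap.add_apply, ha, hb, TensorProduct.add_tmul]
  | smul r a ha => simp only [map_smul, LinearMap.smul_apply, ha, ← TensorProduct.smul_tmul']
  | basis m S =>
    induction y using scfG_induction with
    | zero => simp
    | add a b ha hb => simp only [map_add, ha, hb, TensorProduct.tmul_add]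
    | smul r a ha => simp only [map_smul, ha, TensorProduct.tmul_smul]
    | basis n T =>
      rw [hopfG_mul_regTensorAt, hopfG_comul_regTensorAt, hopfG_comul_regTensorAt,
        hopfG_comul_regTensorAt, ← Equiv.sum_comp (joinEquiv m n), Fintype.sum_prod_type]
      simp only [TensorProduct.sum_tmul, TensorProduct.tmul_sum, map_sum]
      rw [Finset.sum_comm]
      refine Finset.sum_congr rfl fun B _ => Finset.sum_congr rfl fun A _ => ?_
      change (if Admissible (joinSet A B) (concatSet m S T) then
        regTensorAt G (joinSet A B).card (restrictSet (joinSet A B) (concatSet m S T)) ⊗ₜ[ℂ]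
        regTensorAt G (joinSet A B)ᶜ.card (restrictSet (joinSet A B)ᶜ (concatSet m S T))
        else 0) = _
      by_cases hA : Admissible A S
      · by_cases hB : Admissible B T
        · rw [if_pos ((admissible_joinSet A B S T).2 ⟨hA, hB⟩), if_pos hA, if_pos hB,
            HopfData.mulTensor_tmul, hopfG_mul_regTensorAt, hopfG_mul_regTensorAt, compl_joinSet,
            regTensorAt_congr (card_joinSet A B) fun j hj => restrictSet_joinSet A B S T j hj,
            regTensorAt_congr (card_joinSet Aᶜ Bᶜ) fun j hj => restrictSet_joinSet Aᶜ Bᶜ S T j hj]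
        · rw [if_neg fun h => hB ((admissible_joinSet A B S T).1 h).2, if_neg hB]
          simp
      · rw [if_neg fun h => hA ((admissible_joinSet A B S T).1 h).1, if_neg hA]
        simp

/-- A set of consecutive elements inherits no factor `reg` from the function `1`. -/
theorem restrictSet_false_iff {n : ℕ} {B : Finset (Fin n)}
    (hB : ∀ j ∈ B, ∀ k ∈ B, j < k → ∀ l : Fin n, (l : ℕ) = j + 1 → l ∈ B) (i : ℕ)
    (hi : i + 1 < B.card) : restrictSet B (fun _ => False) i ↔ False := by
  obtain ⟨j, hj, rfl⟩ := exists_rankIn_eq (B := B) (i := i) (by omega)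
  rw [restrictSet_rankIn hj, iff_false]
  obtain ⟨k, hk, hjk⟩ := (rankIn_lt_card_sub_one_iff hj).1 (by omega)
  have hjk' : (j : ℕ) < k := hjk
  exact fun h => h ⟨j + 1, by omega⟩ (hB j hj k hk hjk _ rfl) rfl

/-- The trivial characters are the divided powers: `Δ(1_n) = ∑ 1_k ⊗ 1_{n-k}`. -/
theorem hopfG_comul_trivial (n : ℕ) :
    (hopfG (regChar G) (trivialChar G) (regSubOneDual G)).comul
        (regTensorAt G n fun _ => False) =
      ∑ k ∈ Finset.range (n + 1), regTensorAt G k (fun _ => False) ⊗ₜ[ℂ]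
        regTensorAt G (n - k) fun _ => False := by
  classical
  rw [hopfG_comul_regTensorAt, ← Finset.sum_filter]
  have hdown : ∀ A : Finset (Fin n), Admissible A (fun _ => False) →
      ∀ (d : ℕ) (a b : Fin n), (a : ℕ) + d = b → b ∈ A → a ∈ A := by
    intro A hA d
    induction d with
    | zero => intro a b hab hb; rwa [show a = b from Fin.ext hab]
    | succ d ih =>
      intro a b hab hb
      have h1 := ih ⟨a + 1, by omega⟩ b (by simp only; omega) hb
      by_contra ha
      exact hA ⟨a, by omega⟩ ha h1
  have hinit : ∀ k ≤ n, (Finset.univ.filter fun j : Fin n => (j : ℕ) < k).card = k := by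
    intro k hk
    rw [Fin.card_filter_val_lt]
    omega
  have hA_eq : ∀ A : Finset (Fin n), Admissible A (fun _ => False) →
      (Finset.univ.filter fun j : Fin n => (j : ℕ) < A.card) = A := by
    intro A hA
    have hn : A.card ≤ n := by simpa using Finset.card_le_univ A
    refine (Finset.eq_of_subset_of_card_le (fun a ha => ?_) (hinit _ hn).le).symm
    rw [Finset.mem_filter]
    refine ⟨Finset.mem_univ _, ?_⟩
    have : (Finset.univ.filter fun j : Fin n => (j : ℕ) < a + 1) ⊆ A := fun j hj => by
      have := (Finset.mem_filter.1 hj).2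
      exact hdown A hA (a - j) j a (by omega) ha
    have := Finset.card_le_card this
    rw [hinit _ a.2] at this
    omega
  refine Finset.sum_nbij' (fun A => A.card) (fun k => Finset.univ.filter fun j => (j : ℕ) < k)
    ?_ ?_ ?_ ?_ ?_
  · intro A _
    have hn : A.card ≤ n := by simpa using Finset.card_le_univ A
    exact Finset.mem_range.2 (by omega)
  · intro k _
    rw [Finset.mem_filter]
    refine ⟨Finset.mem_univ _, fun j h1 h2 => ?_⟩
    simp only [Finset.mem_filter, Finset.mem_univ, true_and, lo, hi] at h1 h2
    omega
  · exact fun A hA => hA_eq A (Finset.mem_filter.1 hA).2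
  · exact fun k hk => hinit k (by have := Finset.mem_range.1 hk; omega)
  · intro A hA
    have hA := (Finset.mem_filter.1 hA).2
    rw [regTensorAt_congr rfl (restrictSet_false_iff (B := A) ?_),
      regTensorAt_congr (n := n - A.card) ?_ (fun i hi => restrictSet_false_iff (B := Aᶜ) ?_ i ?_)]
    · rw [Finset.card_compl, Fintype.card_fin]
    · intro j hj k _ _ l hl
      rw [Finset.mem_compl] at hj ⊢
      exact fun h => hj (hdown A hA 1 j l (by omega) h)
    · rwa [Finset.card_compl, Fintype.card_fin]
    · intro j _ k hk hjk l hl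
      have hjk : (j : ℕ) < k := hjk
      exact hdown A hA (k - l) l k (by omega) hk

end Join

/-! ### Algebra axioms, unit and counit of `H` -/

section UnitCounit

theorem regTensor_zero_apply {G : Type*} [Group G] (T : ℕ → Prop)
    (g : Fin 0 → G) : (regTensor G 0 T).1 g = 1 := by
  simp [regTensor]

variable (G : Type*) [Group G] [Fintype G] [Nontrivial G]

/-- The Hopf algebra `H_(reg, 1, (reg - 1)^*)`. -/
abbrev hopfReg : HopfData (ScfG G) := hopfG (regChar G) (trivialChar G) (regSubOneDual G)

variable {G}

theorem hopfReg_one (T : ℕ → Prop) : (hopfReg G).one = regTensorAt G 0 T := by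
  have : (⟨fun _ => 1, fun _ _ _ => rfl⟩ : scf G (0 - 1)) = regTensor G (0 - 1) T := by
    refine Subtype.ext (funext fun g => ?_)
    exact (regTensor_zero_apply T g).symm
  exact congrArg (DirectSum.lof ℂ ℕ (fun k => scf G (k - 1)) 0) this

theorem hopfReg_counit (n : ℕ) (T : ℕ → Prop) :
    (hopfReg G).counit (regTensorAt G n T) = if n = 0 then 1 else 0 := by
  simp only [hopfG, regTensorAt, LinearMap.comp_apply]
  split_ifs with h
  · subst h
    rw [DirectSum.component.lof_self]
    exact regTensor_zero_apply T fun i : Fin 0 => (i.elim0 : G)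
  · rw [DirectSum.component.of, dif_neg h]
    simp

theorem hopfReg_mul_assoc (x y z : ScfG G) : (hopfReg G).mul ((hopfReg G).mul x y) z =
    (hopfReg G).mul x ((hopfReg G).mul y z) := by
  induction x using scfG_induction with
  | zero => simp
  | add a b ha hb => simp only [map_add, LinearMap.add_apply, ha, hb]
  | smul r a ha => simp only [map_smul, LinearMap.smul_apply, ha]
  | basis m S =>
    induction y using scfG_induction with
    | zero => simp
    | add a b ha hb => simp only [map_add, LinearMap.add_apply, ha, hb]
    | smul r a ha => simp only [map_smul, LinearMap.smul_apply, ha]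
    | basis n T =>
      induction z using scfG_induction with
      | zero => simp
      | add a b ha hb => simp only [map_add, ha, hb]
      | smul r a ha => simp only [map_smul, ha]
      | basis p U =>
        simp only [hopfG_mul_regTensorAt]
        refine regTensorAt_congr (add_assoc _ _ _) fun j _ => ?_
        simp only [concatSet]
        have e : j - (m + n) = j - m - n := by omega
        rw [e]
        grind

theorem hopfReg_one_mul (x : ScfG G) : (hopfReg G).mul (hopfReg G).one x = x := by
  induction x using scfG_induction with
  | zero => simp
  | add a b ha hb => simp only [map_add, ha, hb]
  | smul r a ha => simp only [map_smul, ha]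
  | basis n T =>
    rw [hopfReg_one T, hopfG_mul_regTensorAt]
    exact regTensorAt_congr (zero_add n) fun j _ => by simp [concatSet]

theorem hopfReg_mul_one (x : ScfG G) : (hopfReg G).mul x (hopfReg G).one = x := by
  induction x using scfG_induction with
  | zero => simp
  | add a b ha hb => simp only [map_add, LinearMap.add_apply, ha, hb]
  | smul r a ha => simp only [map_smul, LinearMap.smul_apply, ha]
  | basis n T =>
    rw [hopfReg_one T, hopfG_mul_regTensorAt]
    exact regTensorAt_congr (add_zero n) fun j hj => by
      have h1 : j + 1 ≠ n := by omega
      have h2 : ¬ n ≤ j := by omega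
      simp [concatSet, hj, h1, h2]

theorem hopfReg_comul_one :
    (hopfReg G).comul (hopfReg G).one = (hopfReg G).one ⊗ₜ[ℂ] (hopfReg G).one := by
  rw [hopfReg_one fun _ => False, hopfG_comul_trivial]
  simp

theorem hopfReg_counit_one : (hopfReg G).counit (hopfReg G).one = 1 := by
  rw [hopfReg_one fun _ => False, hopfReg_counit, if_pos rfl]

theorem hopfReg_counit_mul (x y : ScfG G) :
    (hopfReg G).counit ((hopfReg G).mul x y) = (hopfReg G).counit x * (hopfReg G).counit y := by
  induction x using scfG_induction with
  | zero => simp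
  | add a b ha hb => simp only [map_add, LinearMap.add_apply, ha, hb, add_mul]
  | smul r a ha => simp only [map_smul, LinearMap.smul_apply, ha, smul_eq_mul, mul_assoc]
  | basis m S =>
    induction y using scfG_induction with
    | zero => simp
    | add a b ha hb => simp only [map_add, ha, hb, mul_add]
    | smul r a ha => simp only [map_smul, ha, smul_eq_mul, mul_left_comm]
    | basis n T =>
      rw [hopfG_mul_regTensorAt, hopfReg_counit, hopfReg_counit, hopfReg_counit]
      by_cases hm : m = 0 <;> by_cases hn : n = 0 <;> simp [hm, hn]

variable (F : Type*) [Field F] [Fintype F]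

theorem descentsIn_of_isEmpty (T : ℕ → Prop) (w : Equiv.Perm (Fin 0)) : DescentsIn T w :=
  fun j => Fin.elim0 j

theorem ch_twst_one : (ch F ∘ₗ twst G F) (hopfReg G).one = hopfMR.one := by
  classical
  rw [hopfReg_one (fun _ => False), LinearMap.comp_apply, ch_twst_regTensorAt,
    Fintype.sum_unique, if_pos (descentsIn_of_isEmpty _ _)]
  exact congrArg fund (Subsingleton.elim _ _)

theorem ch_twst_counit (x : ScfG G) :
    hopfMR.counit ((ch F ∘ₗ twst G F) x) = (hopfReg G).counit x := by
  classical
  induction x using scfG_induction with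
  | zero => simp
  | add a b ha hb => simp only [map_add, ha, hb]
  | smul r a ha => simp only [map_smul, ha]
  | basis n T =>
    rw [hopfReg_counit, LinearMap.comp_apply, ch_twst_regTensorAt, map_sum]
    simp only [apply_ite hopfMR.counit, hopfMR_counit_fund, map_zero]
    split_ifs with h
    · subst h
      rw [Fintype.sum_unique, if_pos (descentsIn_of_isEmpty _ _)]
    · simp

end UnitCounit

/-! ### Morphisms out of `NSym` -/

section FromNSym

variable {W : Type*} [AddCommGroup W] [Module ℂ W] {E : HopfData W} {f : NSym →ₗ[ℂ] W}

theorem nsymGen_coe (k : ℕ+) : nsymGen k = FreeAlgebra.ι ℂ k := by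
  exact dif_pos k.2

theorem hopfNSym_mulTensor (s t : NSym ⊗[ℂ] NSym) : hopfNSym.mulTensor (s ⊗ₜ[ℂ] t) = s * t := by
  induction s with
  | zero => simp
  | add a b ha hb => simp only [TensorProduct.add_tmul, map_add, ha, hb, add_mul]
  | tmul a b =>
    induction t with
    | zero => simp
    | add c d hc hd => simp only [TensorProduct.tmul_add, map_add, hc, hd, mul_add]
    | tmul c d => simp [HopfData.mulTensor_tmul, hopfNSym]

theorem hopfNSym_comul_gen (k : ℕ+) : hopfNSym.comul (FreeAlgebra.ι ℂ k) =
    ∑ j ∈ Finset.range (k + 1), nsymGen j ⊗ₜ[ℂ] nsymGen (k - j) := by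
  simp [hopfNSym]

/-- A multiplicative unital map from `NSym` to a bialgebra is compatible with coproduct and counit
as soon as it is so on the generators. -/
theorem hopfNSym_respects (hmul : ∀ x y, f (x * y) = E.mul (f x) (f y)) (hone : f 1 = E.one)
    (hΔ1 : E.comul E.one = E.one ⊗ₜ[ℂ] E.one)
    (hΔ : ∀ x y, E.comul (E.mul x y) = E.mulTensor (E.comul x ⊗ₜ[ℂ] E.comul y))
    (hε1 : E.counit E.one = 1)
    (hε : ∀ x y, E.counit (E.mul x y) = E.counit x * E.counit y)
    (hgen : ∀ k : ℕ+, E.comul (f (nsymGen k)) =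
      ∑ j ∈ Finset.range (k + 1), f (nsymGen j) ⊗ₜ[ℂ] f (nsymGen (k - j)))
    (hgen' : ∀ k : ℕ+, E.counit (f (nsymGen k)) = 0) :
    hopfNSym.Respects E f where
  map_mul := hmul
  map_one := hone
  map_comul x := by
    induction x using FreeAlgebra.induction with
    | grade0 r =>
      have h1 : hopfNSym.comul (1 : NSym) = 1 ⊗ₜ[ℂ] 1 := by
        simp [hopfNSym, Algebra.TensorProduct.one_def]
      rw [Algebra.algebraMap_eq_smul_one]
      simp only [map_smul, hone, hΔ1, h1, TensorProduct.map_tmul]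
    | grade1 k =>
      rw [hopfNSym_comul_gen, ← nsymGen_coe, hgen, map_sum]
      simp only [TensorProduct.map_tmul]
    | mul a b ha hb =>
      have h1 : hopfNSym.comul (a * b) = hopfNSym.comul a * hopfNSym.comul b := by
        simp [hopfNSym]
      rw [hmul, hΔ, ha, hb, h1, ← hopfNSym_mulTensor]
      exact (map_mulTensor (D := hopfNSym) (E := E) (f := f) hmul _ _).symm
    | add a b ha hb => simp only [map_add, ha, hb]
  map_counit x := by
    induction x using FreeAlgebra.induction with
    | grade0 r =>
      rw [Algebra.algebraMap_eq_smul_one]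
      simp only [map_smul, hone, hε1]
      simp [hopfNSym]
    | grade1 k =>
      rw [← nsymGen_coe, hgen', nsymGen_coe]
      simp [hopfNSym]
    | mul a b ha hb =>
      rw [hmul, hε, ha, hb]
      simp [hopfNSym]
    | add a b ha hb => simp only [map_add, ha, hb]

end FromNSym

/-! ### The morphism from `NSym` to `H` -/

section Phi

variable (G : Type*) [Group G] [Fintype G] [Nontrivial G]

/-- The representation of `NSym` on `scf(G^•)` in which `H_k` is left multiplication by the constant
function `1` of degree `k`. -/
def nsymRep : NSym →ₐ[ℂ] Module.End ℂ (ScfG G) :=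
  FreeAlgebra.lift ℂ fun k : ℕ+ => (hopfReg G).mul (regTensorAt G k fun _ => False)

/-- The algebra morphism `NSym → H` sending `H_k` to the constant function `1` of degree `k`. It is
the orbit map of the unit under `nsymRep`, as `H` is given by its structure maps and is not an
instance of an algebra. -/
def nsymToScfG : NSym →ₗ[ℂ] ScfG G :=
  LinearMap.applyₗ (hopfReg G).one ∘ₗ (nsymRep G).toLinearMap

theorem nsymToScfG_apply (x : NSym) : nsymToScfG G x = nsymRep G x (hopfReg G).one := rfl

theorem nsymRep_eq_mul (x : NSym) : nsymRep G x = (hopfReg G).mul (nsymToScfG G x) := by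
  induction x using FreeAlgebra.induction with
  | grade0 r =>
    refine LinearMap.ext fun y => ?_
    rw [nsymToScfG_apply, Algebra.algebraMap_eq_smul_one]
    simp [hopfReg_one_mul]
  | grade1 k =>
    have h : nsymRep G (FreeAlgebra.ι ℂ k) = (hopfReg G).mul (regTensorAt G k fun _ => False) :=
      FreeAlgebra.lift_ι_apply _ _
    rw [nsymToScfG_apply, h, hopfReg_mul_one]
  | mul a b ha hb =>
    refine LinearMap.ext fun y => ?_
    rw [nsymToScfG_apply, map_mul, ha, hb]
    simp only [Module.End.mul_apply, hopfReg_mul_assoc, hopfReg_mul_one]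
  | add a b ha hb => rw [map_add, ha, hb, map_add, map_add]

theorem nsymToScfG_mul (x y : NSym) :
    nsymToScfG G (x * y) = (hopfReg G).mul (nsymToScfG G x) (nsymToScfG G y) := by
  rw [nsymToScfG_apply, map_mul, Module.End.mul_apply, nsymRep_eq_mul G x, nsymToScfG_apply G y]

theorem nsymToScfG_one : nsymToScfG G 1 = (hopfReg G).one := by
  rw [nsymToScfG_apply, map_one, Module.End.one_apply]

theorem nsymToScfG_gen (k : ℕ) : nsymToScfG G (nsymGen k) = regTensorAt G k fun _ => False := by
  rcases Nat.eq_zero_or_pos k with rfl | hk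
  · rw [nsymGen, dif_neg (lt_irrefl 0), nsymToScfG_one, hopfReg_one fun _ => False]
  · have h : nsymRep G (FreeAlgebra.ι ℂ ⟨k, hk⟩) =
        (hopfReg G).mul (regTensorAt G k fun _ => False) := FreeAlgebra.lift_ι_apply _ _
    have e : nsymGen k = FreeAlgebra.ι ℂ ⟨k, hk⟩ := nsymGen_coe ⟨k, hk⟩
    rw [e, nsymToScfG_apply, h, hopfReg_mul_one]

/-- Each product inserts a factor `reg` between its factors, that is, at the proper partial sums. -/
theorem nsymToScfG_prod (L : List ℕ) (hL : ∀ a ∈ L, 0 < a) :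
    nsymToScfG G (L.map nsymGen).prod =
      regTensorAt G L.sum fun j => ∃ i, 0 < i ∧ i < L.length ∧ (L.take i).sum = j + 1 := by
  induction L with
  | nil => simpa using (nsymToScfG_one G).trans (hopfReg_one _)
  | cons a L ih =>
    have hpos : ∀ a ∈ L, 0 < a := fun b hb => hL b (List.mem_cons_of_mem _ hb)
    have ha : 0 < a := hL a List.mem_cons_self
    rw [List.map_cons, List.prod_cons, nsymToScfG_mul, ih hpos, nsymToScfG_gen,
      hopfG_mul_regTensorAt, List.sum_cons]
    refine regTensorAt_congr rfl fun j hj => ?_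
    simp only [concatSet, and_false, false_or]
    constructor
    · rintro (h | ⟨h, i, hi0, hi, hs⟩)
      · refine ⟨1, Nat.one_pos, ?_, by simp [h]⟩
        rw [List.length_cons]
        have : L ≠ [] := by rintro rfl; simp at hj; omega
        have := List.length_pos_iff.2 this
        omega
      · exact ⟨i + 1, Nat.succ_pos _, by simpa using hi, by simp [hs]; omega⟩
    · rintro ⟨i, hi0, hi, hs⟩
      obtain ⟨i, rfl⟩ := Nat.exists_eq_succ_of_ne_zero hi0.ne'
      rw [List.take_succ_cons, List.sum_cons] at hs
      rcases Nat.eq_zero_or_pos i with rfl | hi'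
      · left; simpa using hs.symm
      · right
        have hlen : i < L.length := by simpa using hi
        have h1 : 0 < (L.take i).sum := by
          cases L with
          | nil => simp at hlen
          | cons b L =>
            obtain ⟨i, rfl⟩ := Nat.exists_eq_succ_of_ne_zero hi'.ne'
            have := hpos b List.mem_cons_self
            simp; omega
        exact ⟨by omega, i, hi', hlen, by omega⟩

theorem nsymToScfG_nsymH {n : ℕ} (μ : Composition n) :
    nsymToScfG G (nsymH μ) = regTensorAt G n fun j => IsPartialSum μ (j + 1) := by
  rw [nsymH, nsymToScfG_prod G μ.blocks fun a ha => μ.blocks_pos ha]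
  exact regTensorAt_congr μ.blocks_sum fun j _ => Iff.rfl

end Phi

/-! ### Compositions and sets of partial sums -/

section Compositions

/-- The bijection between compositions of `n` and sets of coordinates: the proper partial sums,
shifted down by `1`. -/
def partialSumEquiv (n : ℕ) : Composition n ≃ Finset (Fin (n - 1)) :=
  (compositionEquiv n).trans (compositionAsSetEquiv n)

variable {n : ℕ}

theorem mem_boundaries_iff (μ : Composition n) (s : Fin (n + 1)) :
    s ∈ μ.boundaries ↔ ∃ i, i ≤ μ.length ∧ μ.sizeUpTo i = s := by
  simp only [Composition.boundaries, Finset.mem_map, Finset.mem_univ, true_and]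
  constructor
  · rintro ⟨i, rfl⟩
    exact ⟨i, Nat.lt_succ_iff.1 i.2, rfl⟩
  · rintro ⟨i, hi, hs⟩
    exact ⟨⟨i, Nat.lt_succ_iff.2 hi⟩, Fin.ext hs⟩

theorem mem_partialSumEquiv (μ : Composition n) (j : Fin (n - 1)) :
    j ∈ partialSumEquiv n μ ↔ IsPartialSum μ (j + 1) := by
  have : j ∈ partialSumEquiv n μ ↔ (⟨1 + j, by omega⟩ : Fin (n + 1)) ∈ μ.boundaries := by
    simp only [partialSumEquiv, compositionAsSetEquiv, compositionEquiv, Equiv.trans_apply,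
      Equiv.coe_fn_mk, Set.mem_toFinset, Set.mem_ofPred_eq]
    exact Iff.rfl
  rw [this, mem_boundaries_iff]
  constructor
  · rintro ⟨i, hi, hs⟩
    simp only at hs
    refine ⟨i, Nat.pos_of_ne_zero ?_, lt_of_le_of_ne hi ?_, by omega⟩
    · rintro rfl
      rw [μ.sizeUpTo_zero] at hs
      omega
    · rintro rfl
      rw [μ.sizeUpTo_length] at hs
      omega
  · rintro ⟨i, _, hi, hs⟩
    exact ⟨i, hi.le, by simp only; omega⟩

theorem mem_boundaries_iff_partialSumEquiv (μ : Composition n) (s : Fin (n + 1)) :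
    s ∈ μ.boundaries ↔ s = 0 ∨ s = Fin.last n ∨ ∃ j ∈ partialSumEquiv n μ, (j : ℕ) + 1 = s := by
  constructor
  · intro h
    by_cases h0 : s = 0
    · exact Or.inl h0
    by_cases hn : s = Fin.last n
    · exact Or.inr (Or.inl hn)
    have h0' : (s : ℕ) ≠ 0 := fun e => h0 (Fin.ext e)
    have hn' : (s : ℕ) ≠ n := fun e => hn (Fin.ext e)
    obtain ⟨i, hi, hs⟩ := (mem_boundaries_iff μ s).1 h
    refine Or.inr (Or.inr ⟨⟨s - 1, by omega⟩, (mem_partialSumEquiv μ _).2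
      ⟨i, Nat.pos_of_ne_zero ?_, lt_of_le_of_ne hi ?_, by simp only; omega⟩, by simp only; omega⟩)
    · rintro rfl
      exact h0' (by simpa using hs.symm)
    · rintro rfl
      exact hn' (by simpa using hs.symm)
  · rintro (rfl | rfl | ⟨j, hj, hs⟩)
    · exact μ.toCompositionAsSet.zero_mem
    · exact μ.toCompositionAsSet.getLast_mem
    · obtain ⟨i, _, hi, hi'⟩ := (mem_partialSumEquiv μ j).1 hj
      exact (mem_boundaries_iff μ s).2 ⟨i, hi.le, hi'.trans hs⟩

theorem mem_boundaries_coord (μ : Composition n) (j : Fin (n - 1)) :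
    (⟨j + 1, by omega⟩ : Fin (n + 1)) ∈ μ.boundaries ↔ j ∈ partialSumEquiv n μ := by
  rw [mem_boundaries_iff_partialSumEquiv]
  constructor
  · rintro (h | h | ⟨i, hi, hs⟩)
    · simp [Fin.ext_iff] at h
    · simp only [Fin.ext_iff, Fin.val_last] at h
      omega
    · rwa [show j = i from Fin.ext (by simpa using hs.symm)]
  · exact fun h => Or.inr (Or.inr ⟨j, h, rfl⟩)

theorem boundaries_subset_iff (μ ν : Composition n) :
    ν.boundaries ⊆ μ.boundaries ↔ partialSumEquiv n ν ⊆ partialSumEquiv n μ := by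
  constructor
  · intro h j hj
    exact (mem_boundaries_coord μ j).1 (h ((mem_boundaries_coord ν j).2 hj))
  · intro h s hs
    rw [mem_boundaries_iff_partialSumEquiv] at hs ⊢
    exact hs.imp_right fun hs => hs.imp_right fun ⟨j, hj, hs⟩ => ⟨j, h hj, hs⟩

theorem length_sub_length {μ ν : Composition n}
    (h : partialSumEquiv n ν ⊆ partialSumEquiv n μ) :
    μ.length - ν.length = (partialSumEquiv n μ \ partialSumEquiv n ν).card := by
  classical
  have h1 := μ.card_boundaries_eq_succ_length
  have h2 := ν.card_boundaries_eq_succ_length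
  have h3 : (μ.boundaries \ ν.boundaries).card = μ.boundaries.card - ν.boundaries.card :=
    Finset.card_sdiff_of_subset ((boundaries_subset_iff μ ν).2 h)
  have h4 : (partialSumEquiv n μ \ partialSumEquiv n ν).card =
      (μ.boundaries \ ν.boundaries).card := by
    refine Finset.card_bij (fun j _ => (⟨j + 1, by omega⟩ : Fin (n + 1))) ?_ ?_ ?_
    · intro j hj
      simpa only [Finset.mem_sdiff, mem_boundaries_coord] using hj
    · intro i _ j _ hij
      simpa [Fin.ext_iff] using hij
    · intro s hs
      obtain ⟨hs1, hs2⟩ := Finset.mem_sdiff.1 hs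
      rw [mem_boundaries_iff_partialSumEquiv] at hs1 hs2
      push Not at hs2
      obtain ⟨j, hj, hjs⟩ := (hs1.resolve_left hs2.1).resolve_left hs2.2.1
      exact ⟨j, Finset.mem_sdiff.2 ⟨hj, fun hj' => hs2.2.2 j hj' hjs⟩, Fin.ext hjs⟩
  omega

end Compositions

/-! ### Ribbons -/

section Ribbons

variable (G : Type*) [Group G] {n : ℕ}

theorem regTensor_isPartialSum_apply (μ : Composition n) (g : Fin (n - 1) → G) :
    (regTensor G (n - 1) fun j => IsPartialSum μ (j + 1)).1 g =
      ∏ j ∈ partialSumEquiv n μ, (regChar G).1 (g j) := by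
  classical
  rw [regTensor_apply, ← Finset.prod_filter]
  refine Finset.prod_congr (Finset.ext fun j => ?_) fun _ _ => rfl
  simp [mem_partialSumEquiv]

theorem ribbonG_eq_ribbonTensor (μ : Composition n) :
    ribbonG G μ = ribbonTensor G (partialSumEquiv n μ) := by
  classical
  refine Subtype.ext (funext fun g => ?_)
  simp only [ribbonG, ribbonTensor]
  exact Finset.prod_congr rfl fun j _ => if_congr (mem_partialSumEquiv μ j).symm rfl rfl

/-- The expansion of the ribbons by inclusion and exclusion: `reg - 1` is `reg` plus `-1`. -/
theorem ribbonG_eq_sum (μ : Composition n) : ribbonG G μ =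
    ∑ ν ∈ Finset.univ.filter (fun ν : Composition n => ν.boundaries ⊆ μ.boundaries),
      (-1 : ℂ) ^ (μ.length - ν.length) • regTensor G (n - 1) fun j => IsPartialSum ν (j + 1) := by
  classical
  refine Subtype.ext (funext fun g => ?_)
  have e : (∑ ν ∈ Finset.univ.filter (fun ν : Composition n => ν.boundaries ⊆ μ.boundaries),
      (-1 : ℂ) ^ (μ.length - ν.length) •
        regTensor G (n - 1) fun j => IsPartialSum ν (j + 1)).1 g =
      ∑ ν ∈ Finset.univ.filter (fun ν : Composition n => ν.boundaries ⊆ μ.boundaries),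
        (-1 : ℂ) ^ (μ.length - ν.length) *
          (regTensor G (n - 1) fun j => IsPartialSum ν (j + 1)).1 g := by
    simp [Finset.sum_apply]
  have e' : (ribbonTensor G (partialSumEquiv n μ)).1 g =
      ∏ j ∈ partialSumEquiv n μ, ((regChar G).1 (g j) + -1) := by
    simp only [ribbonTensor, Finset.prod_ite_mem, Finset.univ_inter]
    exact Finset.prod_congr rfl fun j _ => sub_eq_add_neg _ _
  rw [e, ribbonG_eq_ribbonTensor, e', Finset.prod_add]
  symm
  refine Finset.sum_equiv (partialSumEquiv n) (fun ν => ?_) fun ν hν => ?_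
  · simp [boundaries_subset_iff]
  · have hsub := (boundaries_subset_iff μ ν).1 (Finset.mem_filter.1 hν).2
    rw [regTensor_isPartialSum_apply, length_sub_length hsub, Finset.prod_const, mul_comm]

variable [Fintype G] [Nontrivial G]

theorem nsymToScfG_nsymR (μ : Composition n) : nsymToScfG G (nsymR μ) =
    DirectSum.lof ℂ ℕ (fun k => scf G (k - 1)) n (ribbonG G μ) := by
  rw [nsymR, ribbonG_eq_sum, map_sum, map_sum]
  simp only [map_smul, nsymToScfG_nsymH, regTensorAt]

variable (F : Type*) [Field F] [Fintype F]

theorem ch_twst_nsymR (μ : Composition n) :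
    ch F (twst G F (nsymToScfG G (nsymR μ))) = ribbonMR μ := by
  classical
  rw [nsymToScfG_nsymR, ribbonG_eq_ribbonTensor, ch_twst_ribbonTensor, ribbonMR,
    ← Finset.sum_filter]
  refine Finset.sum_congr (Finset.ext fun w => ?_) fun _ _ => rfl
  simp [Finset.ext_iff, mem_partialSumEquiv, invDescents]

end Ribbons

/-! ### Bijectivity of the morphism from `NSym` to `H` -/

section Bijective

variable (G : Type*) [Group G] [Fintype G] {k : ℕ}

open scoped Classical in
/-- The coefficient of the tensor with factor `reg` in the coordinates in `S` and `1` elsewhere, for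
the basis of `scf(G^k)` formed by these tensors: in each coordinate, `(reg - 1)^*` and
`1 - (reg - 1)^*` are the dual basis of `reg` and `1` for the pairing `mean (φ ψ)`. -/
def regCoeff (S : Finset (Fin k)) : scf G k →ₗ[ℂ] ℂ :=
  LinearMap.proj (1 : coordSubgroup G fun _ : Fin k => False) ∘ₗ deflation (fun _ => False) ∘ₗ
    LinearMap.mulLeft ℂ (fun g : Fin k → G => ∏ j, if j ∈ S then (regSubOneDual G).1 (g j)
      else 1 - (regSubOneDual G).1 (g j)) ∘ₗ (scf G k).subtype

variable [Nontrivial G]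

open scoped Classical in
/-- Duality of the bases, coordinate by coordinate. -/
theorem regCoeff_regTensor (S : Finset (Fin k)) (T : ℕ → Prop) : regCoeff G S (regTensor G k T) =
    if S = Finset.univ.filter (fun j : Fin k => T j) then 1 else 0 := by
  have e : ((fun g : Fin k → G => ∏ j, if j ∈ S then (regSubOneDual G).1 (g j)
      else 1 - (regSubOneDual G).1 (g j)) * (regTensor G k T).1) = fun g => ∏ j,
      (fun x => (if j ∈ S then (regSubOneDual G).1 x else 1 - (regSubOneDual G).1 x) *
        if T j then (regChar G).1 x else 1) (g j) := by
    funext g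
    simp only [Pi.mul_apply, regTensor_apply T g, ← Finset.prod_mul_distrib]
  simp only [regCoeff, LinearMap.comp_apply, LinearMap.proj_apply, LinearMap.mulLeft_apply,
    Submodule.subtype_apply]
  rw [e, deflation_prod (fun _ => False) fun (j : Fin k) x =>
    (if j ∈ S then (regSubOneDual G).1 x else 1 - (regSubOneDual G).1 x) *
        if T j then (regChar G).1 x else 1]
  have hfac : ∀ j : Fin k,
      mean (fun x => (if j ∈ S then (regSubOneDual G).1 x else 1 - (regSubOneDual G).1 x) *
        if T j then (regChar G).1 x else 1) = if j ∈ S ↔ T j then 1 else 0 := by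
    intro j
    by_cases h : j ∈ S <;> by_cases hT : T j <;>
      simp [h, hT, mean_reg, mean_one, mean_dual, mean_dual_mul_reg, sub_mul, mean_sub]
  simp only [if_false, hfac]
  rw [Finset.prod_ite_zero]
  simp [Finset.ext_iff]

/-- The inverse of `nsymToScfG`, by expansion in the basis of products of `reg`s. -/
def scfGToNSym : ScfG G →ₗ[ℂ] NSym :=
  DirectSum.toModule ℂ ℕ _ fun n =>
    ∑ μ : Composition n, (regCoeff G (partialSumEquiv n μ)).smulRight (nsymH μ)

open scoped Classical in
theorem scfGToNSym_regTensorAt (n : ℕ) (T : ℕ → Prop) : scfGToNSym G (regTensorAt G n T) =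
    nsymH ((partialSumEquiv n).symm (Finset.univ.filter fun j : Fin (n - 1) => T j)) := by
  rw [scfGToNSym, regTensorAt, DirectSum.toModule_lof, LinearMap.sum_apply]
  simp only [LinearMap.smulRight_apply, regCoeff_regTensor, ite_smul, one_smul, zero_smul]
  simp only [← Equiv.eq_symm_apply]
  rw [Finset.sum_ite_eq' Finset.univ, if_pos (Finset.mem_univ _)]

theorem nsymToScfG_scfGToNSym (x : ScfG G) : nsymToScfG G (scfGToNSym G x) = x := by
  classical
  induction x using scfG_induction with
  | zero => simp
  | add a b ha hb => simp only [map_add, ha, hb]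
  | smul r a ha => simp only [map_smul, ha]
  | basis n T =>
    rw [scfGToNSym_regTensorAt, nsymToScfG_nsymH]
    refine regTensorAt_congr rfl fun j hj => ?_
    have := mem_partialSumEquiv
      ((partialSumEquiv n).symm (Finset.univ.filter fun j : Fin (n - 1) => T j)) ⟨j, by omega⟩
    rw [← this, Equiv.apply_symm_apply]
    simp

theorem scfGToNSym_nsymH {n : ℕ} (μ : Composition n) :
    scfGToNSym G (nsymToScfG G (nsymH μ)) = nsymH μ := by
  classical
  rw [nsymToScfG_nsymH, scfGToNSym_regTensorAt]
  congr 1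
  rw [Equiv.symm_apply_eq]
  ext j
  simp [mem_partialSumEquiv]

theorem mem_span_nsymH (x : NSym) :
    x ∈ Submodule.span ℂ {y | ∃ (n : ℕ) (μ : Composition n), y = nsymH μ} := by
  have key : x ∈ Submodule.span ℂ
      {y | ∃ L : List ℕ, (∀ a ∈ L, 0 < a) ∧ y = (L.map nsymGen).prod} := by
    induction x using FreeAlgebra.induction with
    | grade0 r =>
      rw [Algebra.algebraMap_eq_smul_one]
      exact Submodule.smul_mem _ _ (Submodule.subset_span ⟨[], by simp, by simp⟩)
    | grade1 k =>
      refine Submodule.subset_span ⟨[(k : ℕ)], by simp, ?_⟩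
      rw [← nsymGen_coe]
      simp
    | add a b ha hb => exact Submodule.add_mem _ ha hb
    | mul a b ha hb =>
      have h := Submodule.mul_mem_mul ha hb
      rw [Submodule.span_mul_span] at h
      refine Submodule.span_mono ?_ h
      rintro _ ⟨_, ⟨L, hL, rfl⟩, _, ⟨M, hM, rfl⟩, rfl⟩
      refine ⟨L ++ M, fun c hc => ?_, by simp⟩
      exact (List.mem_append.1 hc).elim (hL c) (hM c)
  refine Submodule.span_mono ?_ key
  rintro _ ⟨L, hL, rfl⟩
  exact ⟨L.sum, ⟨L, fun {i} hi => hL i hi, rfl⟩, rfl⟩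

theorem scfGToNSym_nsymToScfG (x : NSym) : scfGToNSym G (nsymToScfG G x) = x := by
  induction mem_span_nsymH x using Submodule.span_induction with
  | mem x hx =>
    obtain ⟨n, μ, rfl⟩ := hx
    exact scfGToNSym_nsymH G μ
  | zero => simp
  | add a b _ _ ha hb => simp only [map_add, ha, hb]
  | smul r a _ ha => simp only [map_smul, ha]

/-- The isomorphism from `NSym` onto `H`. -/
def nsymEquiv : NSym ≃ₗ[ℂ] ScfG G :=
  LinearEquiv.ofLinearMap (nsymToScfG G) (scfGToNSym G)
    (LinearMap.ext (nsymToScfG_scfGToNSym G)) (LinearMap.ext (scfGToNSym_nsymToScfG G))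

end Bijective

/-! ### The Hopf algebra structures -/

section HopfStructures

theorem hopfMR_comul_fund_one (n : ℕ) : hopfMR.comul (fund (1 : Equiv.Perm (Fin n))) =
    ∑ k ∈ Finset.range (n + 1), fund (1 : Equiv.Perm (Fin k)) ⊗ₜ[ℂ]
      fund (1 : Equiv.Perm (Fin (n - k))) := by
  have hstd : ∀ {m : ℕ} {f : Fin m → Fin n}, Monotone f → std f = 1 := fun hf => by
    rw [std, Tuple.sort_eq_refl_iff_monotone.2 hf]; rfl
  rw [hopfMR_comul_fund, Finset.sum_range]
  refine Finset.sum_congr rfl fun k _ => ?_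
  congr 2
  · exact hstd fun i j hij => hij
  · exact hstd fun i j hij => Fin.le_def.2 (Nat.add_le_add_left hij _)

theorem descentsIn_false_iff {n : ℕ} (w : Equiv.Perm (Fin n)) :
    DescentsIn (fun _ => False) w ↔ w = 1 := by
  constructor
  · intro h
    have hmono : StrictMono w.symm := by
      cases n with
      | zero => exact fun i => i.elim0
      | succ n => exact Fin.strictMono_iff_lt_succ.2 fun i => h i not_false
    have h1 : Tuple.sort w.symm = 1 := Tuple.sort_eq_refl_iff_monotone.2 hmono.monotone
    rw [sort_perm_val, Equiv.symm_symm] at h1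
    exact h1
  · rintro rfl j -
    exact lo_lt_hi j

variable (G : Type*) [Group G] [Fintype G] [Nontrivial G] (F : Type*) [Field F] [Fintype F]

theorem ch_twst_trivial (n : ℕ) : ch F (twst G F (regTensorAt G n fun _ => False)) =
    fund (1 : Equiv.Perm (Fin n)) := by
  classical
  rw [ch_twst_regTensorAt]
  simp only [descentsIn_false_iff]
  rw [Finset.sum_ite_eq' Finset.univ, if_pos (Finset.mem_univ _)]

theorem nsymToScfG_respects : hopfNSym.Respects (hopfReg G) (nsymToScfG G) :=
  hopfNSym_respects (nsymToScfG_mul G) (nsymToScfG_one G) hopfReg_comul_one hopfG_comul_mul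
    hopfReg_counit_one hopfReg_counit_mul
    (fun k => by simp only [nsymToScfG_gen, hopfG_comul_trivial])
    (fun k => by rw [nsymToScfG_gen, hopfReg_counit, if_neg k.ne_zero])

theorem nsymEquiv_respects : hopfNSym.Respects (hopfReg G) (nsymEquiv G).toLinearMap :=
  nsymToScfG_respects G

theorem ch_twst_nsymToScfG_respects :
    hopfNSym.Respects hopfMR ((ch F ∘ₗ twst G F) ∘ₗ nsymToScfG G) :=
  hopfNSym_respects
    (fun x y => by
      rw [LinearMap.comp_apply, nsymToScfG_mul, ch_twst_mul, LinearMap.comp_apply _ _ x,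
        LinearMap.comp_apply _ _ y])
    (by rw [LinearMap.comp_apply, nsymToScfG_one, ch_twst_one])
    hopfMR_isBialgebra.comul_one hopfMR_isBialgebra.comul_mul hopfMR_isBialgebra.counit_one
    hopfMR_isBialgebra.counit_mul
    (fun k => by
      simp only [LinearMap.comp_apply, nsymToScfG_gen, ch_twst_trivial, hopfMR_comul_fund_one])
    (fun k => by
      simp only [LinearMap.comp_apply, nsymToScfG_gen, ch_twst_trivial, hopfMR_counit_fund]
      rw [if_neg k.ne_zero])

/-- Compatibility with the coproduct is checked on the generators of `NSym`, and `NSym → H` is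
surjective. -/
theorem ch_twst_respects : (hopfReg G).Respects hopfMR (ch F ∘ₗ twst G F) where
  map_mul := ch_twst_mul F
  map_one := ch_twst_one F
  map_comul x := by
    obtain ⟨y, rfl⟩ := (nsymEquiv G).surjective x
    have h1 : (hopfReg G).comul (nsymToScfG G y) =
        TensorProduct.map (nsymToScfG G) (nsymToScfG G) (hopfNSym.comul y) :=
      (nsymToScfG_respects G).map_comul y
    have h2 := (ch_twst_nsymToScfG_respects G F).map_comul y
    rw [TensorProduct.map_comp, LinearMap.comp_apply,
      LinearMap.comp_apply (TensorProduct.map _ _), ← h1] at h2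
    exact h2
  map_counit := ch_twst_counit F

/-- The axioms hold in `MR`, and `ch ∘ twst` is injective for any finite field, for instance the one
with two elements. -/
theorem hopfReg_isBialgebra : (hopfReg G).IsBialgebra :=
  (ch_twst_respects G (ZMod 2)).isBialgebra (ch_twst_injective (ZMod 2)) hopfMR_isBialgebra

theorem hopfReg_isHopfAlgebra : (hopfReg G).IsHopfAlgebra := by
  classical
  refine (hopfReg_isBialgebra G).isHopfAlgebra_of_graded
    (fun n => Set.range (regTensorAt G n)) ?_ ?_ ?_
  · rw [eq_top_iff]
    rintro x -
    induction x using scfG_induction with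
    | zero => exact Submodule.zero_mem _
    | add a b ha hb => exact Submodule.add_mem _ ha hb
    | smul r a ha => exact Submodule.smul_mem _ _ ha
    | basis n T => exact Submodule.subset_span (Set.mem_iUnion.2 ⟨n, T, rfl⟩)
  · rintro _ ⟨T, rfl⟩
    rw [← hopfReg_one T]
    exact Submodule.mem_span_singleton_self _
  · rintro n _ ⟨T, rfl⟩
    rw [hopfG_comul_regTensorAt]
    refine Submodule.sum_mem _ fun A _ => ?_
    split_ifs
    · exact Submodule.subset_span ⟨A.card, Aᶜ.card, _, _, by
        rw [Finset.card_add_card_compl, Fintype.card_fin], ⟨_, rfl⟩, ⟨_, rfl⟩, rfl⟩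
    · exact Submodule.zero_mem _

/-- Transport from `H`, for the group with two elements. -/
theorem hopfNSym_isHopfAlgebra : hopfNSym.IsHopfAlgebra :=
  (nsymEquiv_respects (Multiplicative (ZMod 2))).isHopfAlgebra _
    (hopfReg_isHopfAlgebra (Multiplicative (ZMod 2)))

theorem twst_respects : (hopfReg G).Respects (hopfUt F) (twst G F) :=
  (ch_respects F).of_comp (chEquiv F).injective (ch_twst_respects G F)

theorem twst_injective : Function.Injective (twst G F) :=
  Function.Injective.of_comp (f := ch F) (ch_twst_injective F)

end HopfStructures

end TwstEmbedding

end

theorem proposition4p6 (G : Type*) [Group G] [Fintype G] [Nontrivial G]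
    (F : Type*) [Field F] [Fintype F] :
    -- `twst` is an injective Hopf algebra morphism
    (TwstEmbedding.IsHopfMorphism
        (TwstEmbedding.hopfG (TwstEmbedding.regChar G) (TwstEmbedding.trivialChar G)
          (TwstEmbedding.regSubOneDual G))
        (TwstEmbedding.hopfUt F) (TwstEmbedding.twst G F) ∧
      Function.Injective (TwstEmbedding.twst G F)) ∧
    -- `ch` is a Hopf algebra isomorphism from `scf(ut_•)` to `MR` with `χ^w ↦ F_w`
    (TwstEmbedding.IsHopfMorphism (TwstEmbedding.hopfUt F) TwstEmbedding.hopfMR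
        (TwstEmbedding.ch F) ∧
      Function.Bijective (TwstEmbedding.ch F) ∧
      ∀ (n : ℕ) (w : Equiv.Perm (Fin n)),
        TwstEmbedding.ch F (DirectSum.lof ℂ ℕ (fun k => TwstEmbedding.scfUt F k) n
          (TwstEmbedding.superChar F w)) = TwstEmbedding.fund w) ∧
    -- the isomorphism `Φ` from `NSym`, and the composite `NSym → MR`, `R_μ ↦ R_μ`
    ∃ Φ : TwstEmbedding.NSym ≃ₗ[ℂ] TwstEmbedding.ScfG G,
      TwstEmbedding.IsHopfMorphism TwstEmbedding.hopfNSym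
        (TwstEmbedding.hopfG (TwstEmbedding.regChar G) (TwstEmbedding.trivialChar G)
          (TwstEmbedding.regSubOneDual G)) Φ.toLinearMap ∧
      (∀ (n : ℕ) (μ : Composition n), Φ (TwstEmbedding.nsymR μ) =
        DirectSum.lof ℂ ℕ (fun k => TwstEmbedding.scf G (k - 1)) n (TwstEmbedding.ribbonG G μ)) ∧
      TwstEmbedding.IsHopfMorphism TwstEmbedding.hopfNSym TwstEmbedding.hopfMR
        (TwstEmbedding.ch F ∘ₗ TwstEmbedding.twst G F ∘ₗ Φ.toLinearMap) ∧
      Function.Injective (TwstEmbedding.ch F ∘ₗ TwstEmbedding.twst G F ∘ₗ Φ.toLinearMap) ∧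
      ∀ (n : ℕ) (μ : Composition n),
        TwstEmbedding.ch F (TwstEmbedding.twst G F (Φ (TwstEmbedding.nsymR μ))) =
          TwstEmbedding.ribbonMR μ := by
  have hG := TwstEmbedding.hopfReg_isHopfAlgebra G
  have hU := TwstEmbedding.hopfUt_isHopfAlgebra F
  have hN := TwstEmbedding.hopfNSym_isHopfAlgebra
  have hM := TwstEmbedding.hopfMR_isHopfAlgebra
  have hΦ := TwstEmbedding.nsymEquiv_respects G
  refine ⟨⟨(TwstEmbedding.twst_respects G F).isHopfMorphism hG hU,
      TwstEmbedding.twst_injective G F⟩,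
    ⟨(TwstEmbedding.ch_respects F).isHopfMorphism hU hM, (TwstEmbedding.chEquiv F).bijective,
      fun n w => TwstEmbedding.ch_superChar F w⟩,
    TwstEmbedding.nsymEquiv G, hΦ.isHopfMorphism hN hG,
    fun n μ => TwstEmbedding.nsymToScfG_nsymR G μ, ?_, ?_,
    fun n μ => TwstEmbedding.ch_twst_nsymR G F μ⟩
  · exact ((TwstEmbedding.ch_twst_respects G F).comp hΦ).isHopfMorphism hN hM
  · exact (TwstEmbedding.ch_twst_injective F).comp (TwstEmbedding.nsymEquiv G).injective
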